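/- **Notation.** For a Lie algebra $\mathfrak g$ put $H_1(\mathfrak g)=\mathfrak g/[\mathfrak g,\mathfrak g]$. If $\mathfrak g=\bigoplus_{k\ge 0}\mathfrak g(k)$ is graded, let $H_1(\mathfrak g)_k=\mathfrak g(k)/\sum_{i+j=k,\ i,j\ge 0}[\mathfrak g(i),\mathfrak g(j)]$ be the weight $k$ part of $H_1(\mathfrak g)$. Let $H_n$ be the free abelian group on $x_1,\dots,x_n$, let $T(H_n)=\bigoplus_{i\ge 1}H_n^{\otimes i}$ be the free associative algebra without constant terms and $\mathcal L_n=\bigoplus_{i\ge1}\mathcal L_n(i)$ the free Lie algebra over $\mathbb Z$ generated by $H_n$. $\mathrm{Der}(T(H_n))$ and $\mathrm{Der}(\mathcal L_n)$ are the Lie algebras over $\mathbb Z$ of all derivations of $T(H_n)$ and $\mathcal L_n$; their degree $k$ parts consist of the derivations mapping $H_n$ into $H_n^{\otimes(k+1)}$, respectively $\mathcal L_n(k+1)$, so that the degree $0$ part is $\mathrm{Hom}(H_n,H_n)=\mathfrak{gl}(n,\mathbb Z)$ in both cases. Let $H_{\mathbb Q}=\mathbb Q^{2g}$ with symplectic basis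 $a_1,\dots,a_g,b_1,\dots,b_g$ and $\omega_0=\sum_i(a_i\otimes b_i-b_i\otimes a_i)$. $\mathfrak a_g$ is the Lie algebra over $\mathbb Q$ of the derivations $D$ of $T(H_{\mathbb Q})=\bigoplus_{i\ge 1}H_{\mathbb Q}^{\otimes i}$ with $D(\omega_0)=0$, $\mathfrak a_g(0)$ is its degree $0$ part and $\mathfrak a_g^+$ its ideal of derivations of positive degree. In the direct limits below, the maps are induced by extending a derivation by zero on the additional basis elements. **Theorem.** (i) The trace of the degree $0$ part in $\mathfrak{gl}(n,\mathbb Z)$ induces an isomorphism $\varinjlim_n H_1(\mathrm{Der}(T(H_n)))\cong\mathbb Z$. More precisely, for $n\ge 2$ the trace induces $H_1(\mathrm{Der}(T(H_n)))_0\cong\mathbb Z$ and $H_1(\mathrm{Der}(T(H_n)))_1=0$; and $H_1(\mathrm{Der}(T(H_n)))_k=0$ whenever $n\ge k\ge 2$. (ii) The trace of the degree $0$ part induces an isomorphism $\varinjlim_n H_1(\mathrm{Der}(\mathcal L_n))\cong\mathbb Z$. More precisely, for $n\ge 2$ the trace induces $H_1(\mathrm{Der}(\mathcal L_n))_0\cong\mathbb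 Z$ and $H_1(\mathrm{Der}(\mathcal L_n))_1=0$; and $H_1(\mathrm{Der}(\mathcal L_n))_k=0$ whenever $n\ge k+2\ge 4$. (iii) $\varinjlim_g H_1(\mathfrak a_g)=0$. Moreover, for every $g$, sending a derivation of degree $0$ to its matrix on $H_{\mathbb Q}$ is an isomorphism of Lie algebras $\mathfrak a_g(0)\cong\mathfrak{sp}(2g,\mathbb Q)$, and $$H_1(\mathfrak a_g)\;\cong\; H_1(\mathfrak a_g^+)_{\mathfrak{sp}}\oplus H_1(\mathfrak{sp}(2g,\mathbb Q)),$$ where the subscript denotes coinvariants under the action of $\mathfrak a_g(0)\cong\mathfrak{sp}(2g,\mathbb Q)$, and the isomorphism sends the class of $D\in\mathfrak a_g^+$ to $([D],0)$ and the class of $D\in\mathfrak a_g(0)$ to $(0,[D])$. -/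

import Mathlib

namespace StableAb

/-! ### Abelianization of a Lie algebra -/

section Lie

variable (R : Type*) {L : Type*} [CommRing R] [LieRing L] [LieAlgebra R L]

/-- The submodule `[P, Q]` spanned by all brackets `⁅x, y⁆` with `x ∈ P`, `y ∈ Q`. -/
def bracketSpan (P Q : Submodule R L) : Submodule R L :=
  Submodule.span R {z | ∃ x ∈ P, ∃ y ∈ Q, z = ⁅x, y⁆}

variable (L) in
/-- The abelianization `H₁(L) = L / [L, L]`. -/
abbrev H1 : Type _ := L ⧸ bracketSpan R (⊤ : Submodule R L) ⊤

/-- The class in `H₁(L)` of an element of `L`. -/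
def H1.mk (x : L) : H1 R L := Submodule.Quotient.mk x

/-- `H₁` is functorial with respect to Lie algebra homomorphisms. -/
def H1.map {L' : Type*} [LieRing L'] [LieAlgebra R L'] (f : L →ₗ⁅R⁆ L') : H1 R L →ₗ[R] H1 R L' :=
  Submodule.mapQ _ _ (f : L →ₗ[R] L') (by
    rw [bracketSpan, Submodule.span_le]
    rintro _ ⟨x, -, y, -, rfl⟩
    exact Submodule.subset_span ⟨f x, trivial, f y, trivial, f.map_lie x y⟩)

/-- The weight `k` part of the abelianization of a Lie algebra with homogeneous parts
`gr 0, gr 1, …`: the quotient of `gr k` by `∑_{i + j = k} [gr i, gr j]`. -/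
abbrev H1wt (gr : ℕ → Submodule R L) (k : ℕ) : Type _ :=
  gr k ⧸ (⨆ p ∈ Finset.HasAntidiagonal.antidiagonal k, bracketSpan R (gr p.1) (gr p.2)).submoduleOf (gr k)

/-- The coinvariants `H₁(I)_S`, for an ideal `I` of `L` and a Lie subalgebra `S` of `L`:
the quotient of `H₁(I)` by the span of all `s · [x] = [⁅s, x⁆]` with `s ∈ S`, `x ∈ I`. -/
abbrev H1coinv (I : LieIdeal R L) (S : LieSubalgebra R L) : Type _ :=
  H1 R I ⧸ Submodule.span R
    {z : H1 R I | ∃ s ∈ S, ∃ x : I, z = H1.mk R (⟨⁅s, (x : L)⁆, I.lie_mem x.2⟩ : I)}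

end Lie

/-! ### The free associative algebra without constant terms and its derivations -/

section Assoc

variable (R : Type*) (X : Type*) [CommRing R]

/-- The free associative algebra without constant terms (and without unit) on `X`: the elements
of the free associative algebra whose constant term is zero. -/
def T : NonUnitalSubalgebra R (FreeAlgebra R X) where
  carrier := {a | FreeAlgebra.algebraMapInv a = 0}
  add_mem' {a b} ha hb := by simp_all
  zero_mem' := by simp
  mul_mem' {a b} ha hb := by simp_all
  smul_mem' c a ha := by simp_all

instance : NonUnitalRing (T R X) := inferInstance

instance : AddCommGroup (T R X) := inferInstance

instance : Module R (T R X) := inferInstance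

variable {X} in
/-- The generator `x` as an element of `T R X`. -/
def T.gen (x : X) : T R X :=
  ⟨FreeAlgebra.ι R x, by
    change FreeAlgebra.algebraMapInv _ = 0
    simp [FreeAlgebra.algebraMapInv]⟩

/-- The homogeneous part of degree `i` of the free associative algebra, spanned by the words of
length `i` in the generators. -/
def wordDeg (i : ℕ) : Submodule R (FreeAlgebra R X) :=
  Submodule.span R (Set.range (FreeAlgebra.ι R)) ^ i

section

attribute [local instance 100] LieRing.ofAssociativeRing

/-- The derivations of `T R X`: all linear endomorphisms `D` with
`D (x y) = D(x) y + x D(y)`, with the commutator bracket. -/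
def derT : LieSubalgebra R (Module.End R (T R X)) where
  carrier := {D | ∀ x y : T R X, D (x * y) = D x * y + x * D y}
  add_mem' {D E} hD hE x y := by
    simp only [LinearMap.add_apply, hD x y, hE x y, add_mul, mul_add]; abel
  zero_mem' x y := by simp
  smul_mem' c D hD x y := by
    simp only [LinearMap.smul_apply, hD x y, smul_add, smul_mul_assoc, mul_smul_comm]
  lie_mem' {D E} hD hE x y := by
    simp only [LieRing.of_associative_ring_bracket, LinearMap.sub_apply, Module.End.mul_apply,
      hD x y, hE x y, map_add, hD _ _, hE _ _, sub_mul, mul_sub]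
    abel

end

/-- The Lie algebra of derivations of `T R X`. -/
abbrev DerT : Type _ := derT R X

instance : LieRing (DerT R X) := inferInstance

instance : LieAlgebra R (DerT R X) := inferInstance

instance : AddCommGroup (DerT R X) := LieRing.toAddCommGroup

instance : Module R (DerT R X) := LieAlgebra.toModule

variable {R X}

theorem DerT.leibniz (D : DerT R X) (x y : T R X) :
    D.1 (x * y) = D.1 x * y + x * D.1 y := D.2 x y

theorem DerT.lie_apply (D E : DerT R X) (x : T R X) :
    (⁅D, E⁆ : DerT R X).1 x = D.1 (E.1 x) - E.1 (D.1 x) := rfl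

variable (R X) in
/-- The degree `k` part of `DerT R X`: the derivations mapping every generator into the
homogeneous part of degree `k + 1`. -/
def DerT.deg (k : ℕ) : Submodule R (DerT R X) where
  carrier := {D | ∀ x : X, (D.1 (T.gen R x) : FreeAlgebra R X) ∈ wordDeg R X (k + 1)}
  add_mem' hD hE x := add_mem (hD x) (hE x)
  zero_mem' _ := zero_mem _
  smul_mem' c _ hD x := Submodule.smul_mem _ c (hD x)

/-- The coefficient of the one-letter word `x`. -/
noncomputable def linCoeff (x : X) (a : FreeAlgebra R X) : R :=
  (FreeAlgebra.equivMonoidAlgebraFreeMonoid a).coeff (FreeMonoid.of x)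

/-- The matrix of the degree `0` part of a derivation of `T R X`: the entry `(i, j)` is the
coefficient of `x_i` in `D x_j`. -/
noncomputable def DerT.mat (D : DerT R X) : Matrix X X R :=
  Matrix.of fun i j => linCoeff i (D.1 (T.gen R j) : FreeAlgebra R X)

/-! #### Derivations are determined by, and can be prescribed on, the generators -/

theorem T.eq_top (M : Submodule R (T R X)) (hgen : ∀ x, T.gen R x ∈ M)
    (hmul : ∀ a ∈ M, ∀ b ∈ M, a * b ∈ M) : M = ⊤ := by
  have key : ∀ a : FreeAlgebra R X, ∃ m ∈ M,
      a = algebraMap R _ (FreeAlgebra.algebraMapInv a) + (m : FreeAlgebra R X) := by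
    intro a
    induction a using FreeAlgebra.induction with
    | grade0 r => exact ⟨0, zero_mem _, by simp [FreeAlgebra.algebraMapInv]⟩
    | grade1 x => exact ⟨T.gen R x, hgen x, by simp [FreeAlgebra.algebraMapInv, T.gen]⟩
    | add a b ha hb =>
      obtain ⟨m, hm, ha⟩ := ha
      obtain ⟨n, hn, hb⟩ := hb
      refine ⟨m + n, add_mem hm hn, ?_⟩
      conv_lhs => rw [ha, hb]
      simp only [map_add, NonUnitalSubalgebra.coe_add]
      abel
    | mul a b ha hb =>
      obtain ⟨m, hm, ha⟩ := ha
      obtain ⟨n, hn, hb⟩ := hb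
      refine ⟨FreeAlgebra.algebraMapInv a • n + FreeAlgebra.algebraMapInv b • m + m * n,
        add_mem (add_mem (M.smul_mem _ hn) (M.smul_mem _ hm)) (hmul _ hm _ hn), ?_⟩
      conv_lhs => rw [ha, hb]
      simp only [map_mul, NonUnitalSubalgebra.coe_add, NonUnitalSubalgebra.coe_smul,
        NonUnitalSubalgebra.coe_mul, add_mul, mul_add, Algebra.smul_def]
      rw [← Algebra.commutes (FreeAlgebra.algebraMapInv b) (m : FreeAlgebra R X)]
      abel
  rw [eq_top_iff]
  rintro ⟨a, ha⟩ -
  obtain ⟨m, hm, h⟩ := key a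
  have ha' : FreeAlgebra.algebraMapInv a = 0 := ha
  rw [ha', map_zero, zero_add] at h
  have : (⟨a, ha⟩ : T R X) = m := Subtype.ext h
  rwa [this]

theorem DerT.ext_gen {D E : DerT R X} (h : ∀ x, D.1 (T.gen R x) = E.1 (T.gen R x)) : D = E := by
  have := T.eq_top (LinearMap.ker (D.1 - E.1)) (fun x => by simp [h x]) (fun a ha b hb => by
    simp only [LinearMap.mem_ker, LinearMap.sub_apply, sub_eq_zero] at ha hb ⊢
    rw [D.leibniz, E.leibniz, ha, hb])
  refine Subtype.ext (sub_eq_zero.1 (LinearMap.ker_eq_top.1 this))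

/-- The algebra homomorphism `a ↦ a + ε D(a)`, where `D` is the derivation with values `f x` on
the generators. -/
noncomputable def derAux (f : X → T R X) :
    FreeAlgebra R X →ₐ[R] TrivSqZeroExt (FreeAlgebra R X) (FreeAlgebra R X) :=
  FreeAlgebra.lift R fun x =>
    TrivSqZeroExt.inl (FreeAlgebra.ι R x) + TrivSqZeroExt.inr (f x : FreeAlgebra R X)

theorem derAux_fst (f : X → T R X) (a : FreeAlgebra R X) : (derAux f a).fst = a := by
  have : (TrivSqZeroExt.fstHom R (FreeAlgebra R X) (FreeAlgebra R X)).comp (derAux f) =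
      AlgHom.id R _ := by
    ext x; simp [derAux]
  exact DFunLike.congr_fun this a

theorem derAux_snd_mul (f : X → T R X) (a b : FreeAlgebra R X) :
    (derAux f (a * b)).snd = (derAux f a).snd * b + a * (derAux f b).snd := by
  rw [map_mul, TrivSqZeroExt.snd_mul, derAux_fst, derAux_fst]
  simp [add_comm]

theorem derAux_snd_mem (f : X → T R X) (a : FreeAlgebra R X) : (derAux f a).snd ∈ T R X := by
  induction a using FreeAlgebra.induction with
  | grade0 r =>
    rw [AlgHom.commutes]
    simp [TrivSqZeroExt.algebraMap_eq_inl']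
  | grade1 x => simp [derAux]
  | add a b ha hb => simpa using add_mem ha hb
  | mul a b ha hb =>
    have ha' : FreeAlgebra.algebraMapInv (derAux f a).snd = 0 := ha
    have hb' : FreeAlgebra.algebraMapInv (derAux f b).snd = 0 := hb
    change FreeAlgebra.algebraMapInv (derAux f (a * b)).snd = 0
    rw [derAux_snd_mul]
    simp [ha', hb']

/-- The unique derivation of `T R X` with prescribed values on the generators. -/
noncomputable def DerT.ofGen (f : X → T R X) : DerT R X :=
  ⟨{ toFun := fun a => ⟨(derAux f a).snd, derAux_snd_mem f a⟩
     map_add' := fun a b => Subtype.ext (by simp)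
     map_smul' := fun c a => Subtype.ext (by simp) },
   fun a b => Subtype.ext (derAux_snd_mul f a b)⟩

theorem DerT.ofGen_gen (f : X → T R X) (x : X) : (DerT.ofGen f).1 (T.gen R x) = f x :=
  Subtype.ext (by
    change (derAux f (FreeAlgebra.ι R x)).snd = _
    simp [derAux])

/-! #### Stabilization maps -/

variable {Y : Type*}

variable (R) in
/-- The homomorphism `T R X → T R Y` induced by a map of generators. -/
noncomputable def T.map (φ : X → Y) : T R X →ₙₐ[R] T R Y where
  toFun a := ⟨FreeAlgebra.lift R (FreeAlgebra.ι R ∘ φ) a, by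
    have : (FreeAlgebra.algebraMapInv).comp (FreeAlgebra.lift R (FreeAlgebra.ι R ∘ φ)) =
        (FreeAlgebra.algebraMapInv : FreeAlgebra R X →ₐ[R] R) := by
      ext x; simp [FreeAlgebra.algebraMapInv]
    exact (DFunLike.congr_fun this (a : FreeAlgebra R X)).trans a.2⟩
  map_smul' c a := Subtype.ext (by simp)
  map_zero' := Subtype.ext (by simp)
  map_add' a b := Subtype.ext (by simp)
  map_mul' a b := Subtype.ext (by simp)

theorem T.map_gen (φ : X → Y) (x : X) : T.map R φ (T.gen R x) = T.gen R (φ x) :=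
  Subtype.ext (by
    change FreeAlgebra.lift R (FreeAlgebra.ι R ∘ φ) (FreeAlgebra.ι R x) = _
    simp [T.gen])

/-- The extension of a derivation of `T R X` along an injection `φ : X → Y` of generators: the
derivation of `T R Y` which agrees with `D` on the generators in the image of `φ` and kills all
the other generators. -/
noncomputable def DerT.extend (φ : X → Y) (D : DerT R X) : DerT R Y :=
  DerT.ofGen (Function.extend φ (fun x => T.map R φ (D.1 (T.gen R x))) 0)

theorem DerT.extend_gen {φ : X → Y} (hφ : Function.Injective φ) (D : DerT R X) (x : X) :
    (D.extend φ).1 (T.gen R (φ x)) = T.map R φ (D.1 (T.gen R x)) := by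
  rw [DerT.extend, DerT.ofGen_gen, hφ.extend_apply]

theorem DerT.extend_gen_of_notMem {φ : X → Y} (D : DerT R X) {y : Y} (hy : ¬ ∃ x, φ x = y) :
    (D.extend φ).1 (T.gen R y) = 0 := by
  rw [DerT.extend, DerT.ofGen_gen, Function.extend_apply' _ _ _ hy, Pi.zero_apply]

theorem DerT.extend_map {φ : X → Y} (hφ : Function.Injective φ) (D : DerT R X) (a : T R X) :
    (D.extend φ).1 (T.map R φ a) = T.map R φ (D.1 a) := by
  let p : T R X →ₗ[R] T R Y := (T.map R φ : T R X →ₗ[R] T R Y)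
  have hp : ∀ a, p a = T.map R φ a := fun _ => rfl
  have := T.eq_top (LinearMap.ker ((D.extend φ).1 ∘ₗ p - p ∘ₗ D.1))
    (fun x => by simp [hp, T.map_gen, DerT.extend_gen hφ])
    (fun a ha b hb => by
      simp only [LinearMap.mem_ker, LinearMap.sub_apply, sub_eq_zero, LinearMap.comp_apply,
        hp] at ha hb ⊢
      rw [map_mul, DerT.leibniz, DerT.leibniz, map_add, map_mul, map_mul, ha, hb])
  have h := (LinearMap.ker_eq_top.1 this)
  exact sub_eq_zero.1 (DFunLike.congr_fun h a)

/-- Extension of derivations along an injection of generators, as a Lie algebra homomorphism. -/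
noncomputable def DerT.extendHom (R : Type*) [CommRing R] (φ : X → Y) (hφ : Function.Injective φ) :
    DerT R X →ₗ⁅R⁆ DerT R Y where
  toFun := DerT.extend φ
  map_add' D E := DerT.ext_gen fun y => by
    change _ = (D.extend φ).1 _ + (E.extend φ).1 _
    by_cases hy : ∃ x, φ x = y
    · obtain ⟨x, rfl⟩ := hy
      simp only [DerT.extend_gen hφ]
      exact map_add (T.map R φ) _ _
    · simp only [DerT.extend_gen_of_notMem _ hy, add_zero]
  map_smul' c D := DerT.ext_gen fun y => by
    change _ = c • (D.extend φ).1 _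
    by_cases hy : ∃ x, φ x = y
    · obtain ⟨x, rfl⟩ := hy
      simp only [DerT.extend_gen hφ]
      exact map_smul (T.map R φ) _ _
    · simp only [DerT.extend_gen_of_notMem _ hy, smul_zero]
  map_lie' {D E} := DerT.ext_gen fun y => by
    rw [DerT.lie_apply]
    by_cases hy : ∃ x, φ x = y
    · obtain ⟨x, rfl⟩ := hy
      simp only [DerT.extend_gen hφ, DerT.extend_map hφ, DerT.lie_apply, map_sub]
    · simp only [DerT.extend_gen_of_notMem _ hy, map_zero, sub_zero]

end Assoc

/-! ### Derivations of the free Lie algebra -/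

section FreeLie

variable (R : Type*) (X : Type*) [CommRing R]

variable {X} in
/-- `IsBracketMonomial R k z` says that `z` is an iterated bracket of `k` generators. -/
inductive IsBracketMonomial : ℕ → FreeLieAlgebra R X → Prop
  | of (x : X) : IsBracketMonomial 1 (FreeLieAlgebra.of R x)
  | lie {i j : ℕ} {y z : FreeLieAlgebra R X} :
      IsBracketMonomial i y → IsBracketMonomial j z → IsBracketMonomial (i + j) ⁅y, z⁆

/-- The homogeneous part of degree `i` of the free Lie algebra. -/
noncomputable def lieDeg (i : ℕ) : Submodule R (FreeLieAlgebra R X) :=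
  Submodule.span R {z | IsBracketMonomial R i z}

/-- The Lie algebra of derivations of the free Lie algebra on `X`. -/
abbrev DerL : Type _ := LieDerivation R (FreeLieAlgebra R X) (FreeLieAlgebra R X)

/-- The degree `k` part of `DerL R X`: the derivations mapping every generator into the
homogeneous part of degree `k + 1`. -/
noncomputable def DerL.deg (k : ℕ) : Submodule R (DerL R X) where
  carrier := {D | ∀ x : X, D (FreeLieAlgebra.of R x) ∈ lieDeg R X (k + 1)}
  add_mem' hD hE x := add_mem (hD x) (hE x)
  zero_mem' _ := zero_mem _
  smul_mem' c _ hD x := Submodule.smul_mem _ c (hD x)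

variable {R X}

section

attribute [local instance 100] LieRing.ofAssociativeRing

variable (R X) in
/-- The map from the free Lie algebra to the free associative algebra that is the identity on
generators and sends the bracket to the commutator. -/
noncomputable def lieToAssoc : FreeLieAlgebra R X →ₗ⁅R⁆ FreeAlgebra R X :=
  FreeLieAlgebra.lift R (FreeAlgebra.ι R)

/-- The matrix of the degree `0` part of a derivation of the free Lie algebra: the entry `(i, j)`
is the coefficient of `x_i` in `D x_j`. -/
noncomputable def DerL.mat (D : DerL R X) : Matrix X X R :=
  Matrix.of fun i j => linCoeff i (lieToAssoc R X (D (FreeLieAlgebra.of R j)))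

end

theorem FreeLie.eq_top (M : Submodule R (FreeLieAlgebra R X)) (hgen : ∀ x, FreeLieAlgebra.of R x ∈ M)
    (hlie : ∀ a ∈ M, ∀ b ∈ M, ⁅a, b⁆ ∈ M) : M = ⊤ := by
  let K : LieSubalgebra R (FreeLieAlgebra R X) :=
    { M with lie_mem' := fun {a b} ha hb => hlie a ha b hb }
  let F : FreeLieAlgebra R X →ₗ⁅R⁆ K := FreeLieAlgebra.lift R fun x => ⟨_, hgen x⟩
  have h : K.incl.comp F = LieHom.id := FreeLieAlgebra.hom_ext fun x => by simp [F]
  rw [eq_top_iff]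
  rintro a -
  have h2 : ((F a : K) : FreeLieAlgebra R X) = a := DFunLike.congr_fun h a
  rw [← h2]
  exact (F a).2

theorem DerL.ext_gen {D E : DerL R X}
    (h : ∀ x, D (FreeLieAlgebra.of R x) = E (FreeLieAlgebra.of R x)) : D = E := by
  have := FreeLie.eq_top (LinearMap.ker ((D : FreeLieAlgebra R X →ₗ[R] FreeLieAlgebra R X) -
    (E : FreeLieAlgebra R X →ₗ[R] FreeLieAlgebra R X)))
    (fun x => by simp [h x]) (fun a ha b hb => by
      simp only [LinearMap.mem_ker, LinearMap.sub_apply, sub_eq_zero, LieDerivation.coeFn_coe]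
        at ha hb ⊢
      rw [LieDerivation.apply_lie_eq_add, LieDerivation.apply_lie_eq_add, ha, hb])
  ext a
  exact sub_eq_zero.1 (DFunLike.congr_fun (LinearMap.ker_eq_top.1 this) a)

/-- The Lie algebra `L ⊕ ε L` with `ε² = 0`. -/
def DualLie (L : Type*) : Type _ := L × L

section DualLie

variable {L : Type*} [LieRing L] [LieAlgebra R L]

instance : AddCommGroup (DualLie L) := inferInstanceAs (AddCommGroup (L × L))

instance : Module R (DualLie L) := inferInstanceAs (Module R (L × L))

instance : LieRing (DualLie L) where
  bracket a b := (⁅a.1, b.1⁆, ⁅a.1, b.2⁆ + ⁅a.2, b.1⁆)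
  add_lie a b c := Prod.ext (add_lie a.1 b.1 c.1) (by
    change ⁅a.1 + b.1, c.2⁆ + ⁅a.2 + b.2, c.1⁆ =
      (⁅a.1, c.2⁆ + ⁅a.2, c.1⁆) + (⁅b.1, c.2⁆ + ⁅b.2, c.1⁆)
    rw [add_lie, add_lie]; abel)
  lie_add a b c := Prod.ext (lie_add a.1 b.1 c.1) (by
    change ⁅a.1, b.2 + c.2⁆ + ⁅a.2, b.1 + c.1⁆ =
      (⁅a.1, b.2⁆ + ⁅a.2, b.1⁆) + (⁅a.1, c.2⁆ + ⁅a.2, c.1⁆)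
    rw [lie_add, lie_add]; abel)
  lie_self a := Prod.ext (lie_self a.1) (by
    change ⁅a.1, a.2⁆ + ⁅a.2, a.1⁆ = 0
    rw [← lie_skew a.1 a.2]; abel)
  leibniz_lie a b c := Prod.ext (leibniz_lie a.1 b.1 c.1) (by
    change ⁅a.1, ⁅b.1, c.2⁆ + ⁅b.2, c.1⁆⁆ + ⁅a.2, ⁅b.1, c.1⁆⁆ =
      (⁅⁅a.1, b.1⁆, c.2⁆ + ⁅⁅a.1, b.2⁆ + ⁅a.2, b.1⁆, c.1⁆) +
      (⁅b.1, ⁅a.1, c.2⁆ + ⁅a.2, c.1⁆⁆ + ⁅b.2, ⁅a.1, c.1⁆⁆)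
    rw [lie_add, lie_add, add_lie, leibniz_lie a.1 b.1 c.2, leibniz_lie a.1 b.2 c.1,
      leibniz_lie a.2 b.1 c.1]
    abel)

instance : LieAlgebra R (DualLie L) where
  lie_smul t a b := Prod.ext (lie_smul t a.1 b.1) (by
    change ⁅a.1, t • b.2⁆ + ⁅a.2, t • b.1⁆ = t • (⁅a.1, b.2⁆ + ⁅a.2, b.1⁆)
    rw [lie_smul, lie_smul, smul_add])

end DualLie

/-- The element `a + ε b`. -/
def DualLie.mk {L : Type*} (a b : L) : DualLie L := (a, b)

/-- The homomorphism `a ↦ a + ε D(a)`, where `D` is the derivation with values `f x` on the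
generators. -/
noncomputable def derLAux (f : X → FreeLieAlgebra R X) :
    FreeLieAlgebra R X →ₗ⁅R⁆ DualLie (FreeLieAlgebra R X) :=
  FreeLieAlgebra.lift R fun x => DualLie.mk (FreeLieAlgebra.of R x) (f x)

theorem derLAux_fst (f : X → FreeLieAlgebra R X) (a : FreeLieAlgebra R X) :
    (derLAux f a).1 = a := by
  let p : DualLie (FreeLieAlgebra R X) →ₗ⁅R⁆ FreeLieAlgebra R X :=
    { toFun := fun z => z.1
      map_add' := fun _ _ => rfl
      map_smul' := fun _ _ => rfl
      map_lie' := rfl }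
  have h : p.comp (derLAux f) = LieHom.id := FreeLieAlgebra.hom_ext fun x => by
    change (derLAux f (FreeLieAlgebra.of R x)).1 = FreeLieAlgebra.of R x
    rw [derLAux, FreeLieAlgebra.lift_of_apply]
    rfl
  exact DFunLike.congr_fun h a

/-- The unique derivation of the free Lie algebra with prescribed values on the generators. -/
noncomputable def DerL.ofGen (f : X → FreeLieAlgebra R X) : DerL R X where
  toFun a := (derLAux f a).2
  map_add' a b := by rw [map_add]; rfl
  map_smul' c a := by rw [map_smul]; rfl
  leibniz' a b := by
    change (derLAux f ⁅a, b⁆).2 = ⁅a, (derLAux f b).2⁆ - ⁅b, (derLAux f a).2⁆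
    rw [LieHom.map_lie]
    change ⁅(derLAux f a).1, (derLAux f b).2⁆ + ⁅(derLAux f a).2, (derLAux f b).1⁆ = _
    rw [derLAux_fst, derLAux_fst, ← lie_skew (derLAux f a).2 b]
    abel

theorem DerL.ofGen_gen (f : X → FreeLieAlgebra R X) (x : X) :
    DerL.ofGen f (FreeLieAlgebra.of R x) = f x := by
  change (derLAux f (FreeLieAlgebra.of R x)).2 = _
  rw [derLAux, FreeLieAlgebra.lift_of_apply]
  rfl

variable {Y : Type*}

variable (R) in
/-- The homomorphism of free Lie algebras induced by a map of generators. -/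
noncomputable def FreeLie.map (φ : X → Y) : FreeLieAlgebra R X →ₗ⁅R⁆ FreeLieAlgebra R Y :=
  FreeLieAlgebra.lift R (FreeLieAlgebra.of R ∘ φ)

/-- The extension of a derivation along an injection `φ : X → Y` of generators: the derivation
which agrees with `D` on the generators in the image of `φ` and kills all the other generators. -/
noncomputable def DerL.extend (φ : X → Y) (D : DerL R X) : DerL R Y :=
  DerL.ofGen (Function.extend φ (fun x => FreeLie.map R φ (D (FreeLieAlgebra.of R x))) 0)

theorem DerL.extend_gen {φ : X → Y} (hφ : Function.Injective φ) (D : DerL R X) (x : X) :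
    D.extend φ (FreeLieAlgebra.of R (φ x)) = FreeLie.map R φ (D (FreeLieAlgebra.of R x)) := by
  rw [DerL.extend, DerL.ofGen_gen, hφ.extend_apply]

theorem DerL.extend_gen_of_notMem {φ : X → Y} (D : DerL R X) {y : Y} (hy : ¬ ∃ x, φ x = y) :
    D.extend φ (FreeLieAlgebra.of R y) = 0 := by
  rw [DerL.extend, DerL.ofGen_gen, Function.extend_apply' _ _ _ hy, Pi.zero_apply]

theorem DerL.extend_map {φ : X → Y} (hφ : Function.Injective φ) (D : DerL R X)
    (a : FreeLieAlgebra R X) :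
    D.extend φ (FreeLie.map R φ a) = FreeLie.map R φ (D a) := by
  let p : FreeLieAlgebra R X →ₗ[R] FreeLieAlgebra R Y := FreeLie.map R φ
  have := FreeLie.eq_top
    (LinearMap.ker (((D.extend φ : DerL R Y) : FreeLieAlgebra R Y →ₗ[R] FreeLieAlgebra R Y) ∘ₗ p -
      p ∘ₗ (D : FreeLieAlgebra R X →ₗ[R] FreeLieAlgebra R X)))
    (fun x => by
      simp only [LinearMap.mem_ker, LinearMap.sub_apply, sub_eq_zero, LinearMap.comp_apply,
        LieDerivation.coeFn_coe, p]
      change D.extend φ (FreeLie.map R φ (FreeLieAlgebra.of R x)) = _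
      rw [show FreeLie.map R φ (FreeLieAlgebra.of R x) = FreeLieAlgebra.of R (φ x) by
        rw [FreeLie.map, FreeLieAlgebra.lift_of_apply]; rfl]
      exact DerL.extend_gen hφ D x)
    (fun a ha b hb => by
      simp only [LinearMap.mem_ker, LinearMap.sub_apply, sub_eq_zero, LinearMap.comp_apply,
        LieDerivation.coeFn_coe, p] at ha hb ⊢
      change D.extend φ (FreeLie.map R φ a) = FreeLie.map R φ (D a) at ha
      change D.extend φ (FreeLie.map R φ b) = FreeLie.map R φ (D b) at hb
      change D.extend φ (FreeLie.map R φ ⁅a, b⁆) = FreeLie.map R φ (D ⁅a, b⁆)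
      rw [LieHom.map_lie, LieDerivation.apply_lie_eq_add, LieDerivation.apply_lie_eq_add, map_add,
        LieHom.map_lie, LieHom.map_lie, ha, hb])
  exact sub_eq_zero.1 (DFunLike.congr_fun (LinearMap.ker_eq_top.1 this) a)

/-- Extension of derivations along an injection of generators, as a Lie algebra homomorphism. -/
noncomputable def DerL.extendHom (R : Type*) [CommRing R] (φ : X → Y) (hφ : Function.Injective φ) :
    DerL R X →ₗ⁅R⁆ DerL R Y where
  toFun := DerL.extend φ
  map_add' D E := DerL.ext_gen fun y => by
    rw [LieDerivation.add_apply]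
    by_cases hy : ∃ x, φ x = y
    · obtain ⟨x, rfl⟩ := hy
      simp only [DerL.extend_gen hφ, LieDerivation.add_apply, map_add]
    · simp only [DerL.extend_gen_of_notMem _ hy, add_zero]
  map_smul' c D := DerL.ext_gen fun y => by
    rw [RingHom.id_apply, LieDerivation.smul_apply]
    by_cases hy : ∃ x, φ x = y
    · obtain ⟨x, rfl⟩ := hy
      simp only [DerL.extend_gen hφ, LieDerivation.smul_apply, map_smul]
    · simp only [DerL.extend_gen_of_notMem _ hy, smul_zero]
  map_lie' {D E} := DerL.ext_gen fun y => by
    rw [LieDerivation.lie_apply]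
    by_cases hy : ∃ x, φ x = y
    · obtain ⟨x, rfl⟩ := hy
      simp only [DerL.extend_gen hφ, DerL.extend_map hφ, LieDerivation.lie_apply, map_sub]
    · simp only [DerL.extend_gen_of_notMem _ hy, map_zero, sub_zero]

end FreeLie

/-! ### Symplectic derivations -/

section Symplectic

/-- The symplectic class `ω₀ = ∑ (a_i ⊗ b_i - b_i ⊗ a_i)`, where `a_i = inl i`, `b_i = inr i` is
the symplectic basis of `ℚ^{2g}`. -/
noncomputable def omega (g : ℕ) : T ℚ (Fin g ⊕ Fin g) :=
  ∑ i : Fin g, (T.gen ℚ (Sum.inl i) * T.gen ℚ (Sum.inr i) -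
    T.gen ℚ (Sum.inr i) * T.gen ℚ (Sum.inl i))

/-- The Lie algebra `𝔞_g` of symplectic derivations, those which kill `ω₀`. -/
def symp (g : ℕ) : LieSubalgebra ℚ (DerT ℚ (Fin g ⊕ Fin g)) where
  carrier := {D | D.1 (omega g) = 0}
  add_mem' {D E} hD hE := by
    change D.1 _ + E.1 _ = 0
    rw [show D.1 (omega g) = 0 from hD, show E.1 (omega g) = 0 from hE, add_zero]
  zero_mem' := rfl
  smul_mem' c D hD := by
    change c • D.1 _ = 0
    rw [show D.1 (omega g) = 0 from hD, smul_zero]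
  lie_mem' {D E} hD hE := by
    change (⁅D, E⁆ : DerT ℚ _).1 _ = 0
    rw [DerT.lie_apply, show D.1 (omega g) = 0 from hD, show E.1 (omega g) = 0 from hE,
      map_zero, map_zero, sub_zero]

instance (g : ℕ) : LieRing (symp g) := inferInstance

instance (g : ℕ) : LieAlgebra ℚ (symp g) := inferInstance

instance (g : ℕ) : AddCommGroup (symp g) := LieRing.toAddCommGroup

instance (g : ℕ) : Module ℚ (symp g) := LieAlgebra.toModule

/-- The part of the free associative algebra of degree at least `2`. -/
def wordDegGeTwo (R X : Type*) [CommRing R] : Submodule R (FreeAlgebra R X) :=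
  ⨆ i ≥ 2, wordDeg R X i

theorem T_le_iSup {R X : Type*} [CommRing R] (a : T R X) :
    (a : FreeAlgebra R X) ∈ ⨆ i : ℕ, wordDeg R X (i + 1) := by
  have := T.eq_top ((⨆ i : ℕ, wordDeg R X (i + 1)).comap (T R X).toSubmodule.subtype)
    (fun x => Submodule.mem_iSup_of_mem 0 (by
      rw [wordDeg, zero_add, pow_one]; exact Submodule.subset_span ⟨x, rfl⟩))
    (fun a ha b hb => by
      have h : (⨆ i : ℕ, wordDeg R X (i + 1)) * (⨆ i : ℕ, wordDeg R X (i + 1)) ≤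
          ⨆ i : ℕ, wordDeg R X (i + 1) := by
        rw [Submodule.iSup_mul]
        refine iSup_le fun i => ?_
        rw [Submodule.mul_iSup]
        refine iSup_le fun j => ?_
        refine le_trans (le_of_eq ?_) (le_iSup _ (i + j + 1))
        rw [wordDeg, wordDeg, wordDeg, ← pow_add]
        congr 1; ring
      exact h (Submodule.mul_mem_mul ha hb))
  exact (this ▸ Submodule.mem_top : a ∈ Submodule.comap _ _)

theorem wordDeg_le_T {R X : Type*} [CommRing R] (i : ℕ) :
    wordDeg R X (i + 1) ≤ (T R X).toSubmodule := by
  have h1 : Submodule.span R (Set.range (FreeAlgebra.ι R)) ≤ (T R X).toSubmodule := by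
    rw [Submodule.span_le]
    rintro _ ⟨x, rfl⟩
    exact (T.gen R x).2
  induction i with
  | zero => rwa [wordDeg, zero_add, pow_one]
  | succ i ih =>
    rw [wordDeg, pow_succ, Submodule.mul_le]
    intro a ha b hb
    exact (T R X).mul_mem (ih ha) (h1 hb)

theorem mul_mem_geTwo {R X : Type*} [CommRing R] (a b : T R X) :
    (a * b : FreeAlgebra R X) ∈ wordDegGeTwo R X := by
  have h : (⨆ i : ℕ, wordDeg R X (i + 1)) * (⨆ i : ℕ, wordDeg R X (i + 1)) ≤
      wordDegGeTwo R X := by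
    rw [Submodule.iSup_mul]
    refine iSup_le fun i => ?_
    rw [Submodule.mul_iSup]
    refine iSup_le fun j => ?_
    refine le_trans (le_of_eq ?_) (le_iSup₂ (i + 1 + (j + 1)) (by omega))
    rw [wordDeg, wordDeg, wordDeg, ← pow_add]
  exact h (Submodule.mul_mem_mul (T_le_iSup a) (T_le_iSup b))

theorem geTwo_le {R X : Type*} [CommRing R] :
    wordDegGeTwo R X ≤ (T R X).toSubmodule * (T R X).toSubmodule := by
  refine iSup₂_le fun i hi => ?_
  obtain ⟨j, rfl⟩ := Nat.exists_eq_add_of_le' hi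
  have : wordDeg R X (j + 2) = wordDeg R X (j + 1) * wordDeg R X (0 + 1) := by
    rw [wordDeg, wordDeg, wordDeg, ← pow_add]
  rw [this]
  exact mul_le_mul' (wordDeg_le_T j) (wordDeg_le_T 0)

/-- A derivation preserves the part of degree at least `2`. -/
theorem DerT.apply_mem_geTwo {R X : Type*} [CommRing R] (D : DerT R X) (a : T R X)
    (ha : (a : FreeAlgebra R X) ∈ wordDegGeTwo R X) :
    (D.1 a : FreeAlgebra R X) ∈ wordDegGeTwo R X := by
  have key : ∀ b ∈ (T R X).toSubmodule * (T R X).toSubmodule, ∃ hb : b ∈ T R X,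
      (D.1 ⟨b, hb⟩ : FreeAlgebra R X) ∈ wordDegGeTwo R X := by
    intro b hb
    induction hb using Submodule.mul_induction_on' with
    | mem_mul_mem m hm n hn =>
      refine ⟨(T R X).mul_mem hm hn, ?_⟩
      have := D.leibniz ⟨m, hm⟩ ⟨n, hn⟩
      change ((D.1 (⟨m, hm⟩ * ⟨n, hn⟩) : T R X) : FreeAlgebra R X) ∈ _
      rw [this]
      exact add_mem (mul_mem_geTwo _ _) (mul_mem_geTwo _ _)
    | add x hx y hy h1 h2 =>
      obtain ⟨hx', h1⟩ := h1
      obtain ⟨hy', h2⟩ := h2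
      refine ⟨add_mem hx' hy', ?_⟩
      change ((D.1 (⟨x, hx'⟩ + ⟨y, hy'⟩) : T R X) : FreeAlgebra R X) ∈ _
      rw [map_add]
      exact add_mem h1 h2
  obtain ⟨_, h⟩ := key a (geTwo_le ha)
  exact h

/-- The ideal `𝔞_g⁺` of symplectic derivations of positive degree, i.e. those which map the
generators into the part of degree at least `2`. -/
def sympPlus (g : ℕ) : LieIdeal ℚ (symp g) where
  carrier := {D | ∀ x, (D.1.1 (T.gen ℚ x) : FreeAlgebra ℚ _) ∈ wordDegGeTwo ℚ (Fin g ⊕ Fin g)}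
  add_mem' hD hE x := add_mem (hD x) (hE x)
  zero_mem' _ := zero_mem _
  smul_mem' c _ hD x := Submodule.smul_mem _ c (hD x)
  lie_mem {E D} hD x := by
    change ((E.1.1 (D.1.1 _) - D.1.1 (E.1.1 _) : T ℚ (Fin g ⊕ Fin g)) :
      FreeAlgebra ℚ (Fin g ⊕ Fin g)) ∈ _
    refine sub_mem (DerT.apply_mem_geTwo _ _ (hD x)) ?_
    have hle : ∀ a : T ℚ (Fin g ⊕ Fin g),
        (D.1.1 a : FreeAlgebra ℚ _) ∈ wordDegGeTwo ℚ (Fin g ⊕ Fin g) := by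
      intro a
      have := T.eq_top ((wordDegGeTwo ℚ (Fin g ⊕ Fin g)).comap
          ((T ℚ (Fin g ⊕ Fin g)).toSubmodule.subtype ∘ₗ D.1.1)) hD
        (fun a _ b _ => DerT.apply_mem_geTwo _ _ (mul_mem_geTwo a b))
      exact (this ▸ Submodule.mem_top : a ∈ Submodule.comap _ _)
    exact hle _

/-- The Lie subalgebra `𝔞_g(0)` of symplectic derivations of degree `0`. -/
def sympZero (g : ℕ) : LieSubalgebra ℚ (symp g) where
  carrier := {D | D.1 ∈ DerT.deg ℚ (Fin g ⊕ Fin g) 0}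
  add_mem' hD hE := (DerT.deg ℚ (Fin g ⊕ Fin g) 0).add_mem hD hE
  zero_mem' := (DerT.deg ℚ (Fin g ⊕ Fin g) 0).zero_mem
  smul_mem' c _ hD := (DerT.deg ℚ (Fin g ⊕ Fin g) 0).smul_mem c hD
  lie_mem' {D E} hD hE x := by
    have key : ∀ D : symp g, D.1 ∈ DerT.deg ℚ (Fin g ⊕ Fin g) 0 →
        ∀ a : FreeAlgebra ℚ (Fin g ⊕ Fin g), a ∈ wordDeg ℚ (Fin g ⊕ Fin g) (0 + 1) →
        ∃ ha : a ∈ T ℚ _, (D.1.1 ⟨a, ha⟩ : FreeAlgebra ℚ _) ∈ wordDeg ℚ (Fin g ⊕ Fin g) (0 + 1) := by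
      intro D hD a ha
      rw [wordDeg, zero_add, pow_one] at ha
      induction ha using Submodule.span_induction with
      | mem a ha =>
        obtain ⟨x, rfl⟩ := ha
        exact ⟨_, hD x⟩
      | zero => exact ⟨zero_mem _, by
          change ((D.1.1 (0 : T ℚ (Fin g ⊕ Fin g)) : T ℚ (Fin g ⊕ Fin g)) : FreeAlgebra ℚ (Fin g ⊕ Fin g)) ∈ _
          rw [map_zero]; exact zero_mem _⟩
      | add a b _ _ h1 h2 =>
        obtain ⟨ha, h1⟩ := h1
        obtain ⟨hb, h2⟩ := h2
        refine ⟨add_mem ha hb, ?_⟩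
        change ((D.1.1 (⟨a, ha⟩ + ⟨b, hb⟩) : T ℚ (Fin g ⊕ Fin g)) :
          FreeAlgebra ℚ (Fin g ⊕ Fin g)) ∈ _
        rw [map_add]; exact add_mem h1 h2
      | smul c a _ h1 =>
        obtain ⟨ha, h1⟩ := h1
        refine ⟨(T ℚ _).smul_mem c ha, ?_⟩
        change ((D.1.1 (c • ⟨a, ha⟩) : T ℚ (Fin g ⊕ Fin g)) :
          FreeAlgebra ℚ (Fin g ⊕ Fin g)) ∈ _
        rw [map_smul]; exact Submodule.smul_mem _ c h1
    change ((D.1.1 (E.1.1 _) - E.1.1 (D.1.1 _) : T ℚ (Fin g ⊕ Fin g)) :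
          FreeAlgebra ℚ (Fin g ⊕ Fin g)) ∈ _
    exact sub_mem (key D hD _ (hE x)).2 (key E hE _ (hD x)).2

/-- The inclusion of the first `g` pairs `a_i, b_i` into the first `h` pairs. -/
def sympIncl {g h : ℕ} (hgh : g ≤ h) : Fin g ⊕ Fin g → Fin h ⊕ Fin h :=
  Sum.map (Fin.castLE hgh) (Fin.castLE hgh)

theorem sympIncl_injective {g h : ℕ} (hgh : g ≤ h) : Function.Injective (sympIncl hgh) :=
  Function.Injective.sumMap (Fin.castLE_injective hgh) (Fin.castLE_injective hgh)

theorem extend_omega {g h : ℕ} (hgh : g ≤ h) (D : symp g) :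
    (D.1.extend (sympIncl hgh)).1 (omega h) = 0 := by
  have hD : D.1.1 (omega g) = 0 := D.2
  have hinj := sympIncl_injective hgh
  rw [← map_zero (T.map ℚ (sympIncl hgh)), ← hD, ← DerT.extend_map hinj, omega, omega]
  simp only [map_sum]
  symm
  refine Fintype.sum_of_injective (Fin.castLE hgh) (Fin.castLE_injective hgh) _ _ ?_ ?_
  · intro i hi
    have h1 : ¬ ∃ x, sympIncl hgh x = Sum.inl i := by
      rintro ⟨x | x, hx⟩
      · exact hi ⟨x, Sum.inl_injective hx⟩
      · cases hx
    have h2 : ¬ ∃ x, sympIncl hgh x = Sum.inr i := by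
      rintro ⟨x | x, hx⟩
      · cases hx
      · exact hi ⟨x, Sum.inr_injective hx⟩
    rw [map_sub, DerT.leibniz, DerT.leibniz, DerT.extend_gen_of_notMem _ h1,
      DerT.extend_gen_of_notMem _ h2]
    simp
  · intro i
    rw [map_sub (T.map ℚ (sympIncl hgh)), map_mul, map_mul, T.map_gen, T.map_gen]
    rfl

/-- The stabilization homomorphism `𝔞_g → 𝔞_h` for `g ≤ h`. -/
noncomputable def sympStab {g h : ℕ} (hgh : g ≤ h) : symp g →ₗ⁅ℚ⁆ symp h where
  toFun D := ⟨D.1.extend (sympIncl hgh), extend_omega hgh D⟩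
  map_add' D E := Subtype.ext
    ((DerT.extendHom ℚ _ (sympIncl_injective hgh)).map_add D.1 E.1)
  map_smul' c D := Subtype.ext
    ((DerT.extendHom ℚ _ (sympIncl_injective hgh)).map_smul c D.1)
  map_lie' {D E} := Subtype.ext
    ((DerT.extendHom ℚ _ (sympIncl_injective hgh)).map_lie D.1 E.1)

end Symplectic

/-! ### Stable abelianizations -/

/-- The map `H₁(Der T(H_m)) → H₁(Der T(H_n))` induced by the inclusion `H_m ⊆ H_n`. -/
noncomputable def stabT (m n : ℕ) (h : m ≤ n) :
    H1 ℤ (DerT ℤ (Fin m)) →ₗ[ℤ] H1 ℤ (DerT ℤ (Fin n)) :=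
  H1.map ℤ (DerT.extendHom ℤ (Fin.castLE h) (Fin.castLE_injective h))

/-- The map `H₁(Der 𝓛_m) → H₁(Der 𝓛_n)` induced by the inclusion `H_m ⊆ H_n`. -/
noncomputable def stabL (m n : ℕ) (h : m ≤ n) :
    H1 ℤ (DerL ℤ (Fin m)) →ₗ[ℤ] H1 ℤ (DerL ℤ (Fin n)) :=
  H1.map ℤ (DerL.extendHom ℤ (Fin.castLE h) (Fin.castLE_injective h))

/-- The map `H₁(𝔞_g) → H₁(𝔞_h)` induced by the inclusion `H_{2g} ⊆ H_{2h}`. -/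
noncomputable def stabA (g h : ℕ) (hgh : g ≤ h) : H1 ℚ (symp g) →ₗ[ℚ] H1 ℚ (symp h) :=
  H1.map ℚ (sympStab hgh)

/-- `lim_{n → ∞} H₁(Der T(H_n))`. -/
abbrev stableT : Type := Module.DirectLimit (fun n => H1 ℤ (DerT ℤ (Fin n))) stabT

/-- `lim_{n → ∞} H₁(Der 𝓛_n)`. -/
abbrev stableL : Type := Module.DirectLimit (fun n => H1 ℤ (DerL ℤ (Fin n))) stabL

/-- `lim_{g → ∞} H₁(𝔞_g)`. -/
abbrev stableA : Type := Module.DirectLimit (fun g => H1 ℚ (symp g)) stabA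

end StableAb

open StableAb

/-! Free algebras. Let D send the generator j to a monomial w and kill the other generators. The
elementary derivation a ↦ a multiplies D by an integer, the multiplicity of a in w minus δ_{aj}, and
a ↦ b turns occurrences of a into b. So D is a bracket, already over ℤ, if one of these integers is
±1, or if w contains some b ≠ j and misses some a ≠ j. When n ≥ k ≥ 2, counting letters leaves only
w = j^{k+1} and one pattern with n = k = 2, both covered by `DerT.single_replicate_mem`. In degree
one the Euler derivation acts as the identity. For the free Lie algebra, monomials in a single
letter vanish, and k + 2 generators always leave one letter unused in a monomial of length k + 1.
Degree zero is 𝔤𝔩_n with its trace. In the limit every class of positive degree dies at some later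
stage (`exists_directLimit_equiv`).

Symplectic derivations. The symplectic form identifies derivations with tensors, and D kills ω₀
exactly when its tensor is invariant under cyclic rotation (`mem_symp_iff`). Over ℚ such tensors are
averages over rotations, so 𝔞_g is spanned by cyclic words (`mem_span_cyclicDer`). The bracket of
two cyclic words is minus the sum over all ways to contract a letter of one with a letter of the
other and to glue the rest (`lie_cyclicDer`). Let f(w) be the stable class of the cyclic word w.
Bracketing e U with ē V, for a fresh pair e, ē, gives f(U V) = -∑ ω(c,d) f(U₂ e U₁ V₂ ē V₁), summed
over U = U₁ c U₂ and V = V₁ d V₂. Stability enters because a fresh pair is available every time.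
This relation and rotation invariance form `KillsBrackets`.

What remains is combinatorics: such an f vanishes on all words of length at least two
(`KillsBrackets.eq_zero`). Cutting off a single bad letter puts it into a fresh pair, which reduces
the claim to chord diagrams, where every letter and its partner occur once. There f(U V) = 0 if no
chord joins U to V, and f(x y W x̄ ȳ B) = 0 by evaluating one word in two ways
(`KillsBrackets.parallel`). A general diagram begins with a chain q₁ q₂ q̄₁ q₃ q̄₂ ⋯ q_m q̄_{m-1},
at first of length one. A suitable cut replaces a chord of the rest by one more link of the chain,
so the rest gets shorter (`KillsBrackets.eq_zero_of_chain`) until the chain splits off or fills the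
whole word. A closed chain loses two chords at a time (`KillsBrackets.chain_eq_zero`), down to an
isolated chord or a pair x y ⋯ x̄ ȳ.

The formula for H₁(𝔞_g) holds for every semidirect product of an ideal and a subalgebra
(`exists_H1_equiv_of_isCompl`). -/

namespace StableAb

/-! ### Words in symplectic letters -/

section SplitSum

variable {L M : Type*} [AddCommGroup M]

/-- The sum of `F l c r` over all decompositions `w = l ++ c :: r`. -/
def splitSum (F : List L → L → List L → M) : List L → M
  | [] => 0
  | c :: w => F [] c w + splitSum (fun l d r => F (c :: l) d r) w

theorem splitSum_congr {F G : List L → L → List L → M} {w : List L}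
    (h : ∀ l c r, w = l ++ c :: r → F l c r = G l c r) : splitSum F w = splitSum G w := by
  induction w generalizing F G with
  | nil => rfl
  | cons c w ih =>
    rw [splitSum, splitSum, h [] c w rfl, ih fun l d r hw => h (c :: l) d r (by rw [hw]; rfl)]

theorem splitSum_zero (w : List L) : splitSum (fun _ _ _ => (0 : M)) w = 0 := by
  induction w with
  | nil => rfl
  | cons c w ih => rw [splitSum, ih, add_zero]

theorem splitSum_eq_zero {F : List L → L → List L → M} {w : List L}
    (h : ∀ l c r, w = l ++ c :: r → F l c r = 0) : splitSum F w = 0 := by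
  rw [splitSum_congr h, splitSum_zero]

theorem splitSum_append (F : List L → L → List L → M) (v w : List L) :
    splitSum F (v ++ w) =
      splitSum (fun l c r => F l c (r ++ w)) v + splitSum (fun l c r => F (v ++ l) c r) w := by
  induction v generalizing F with
  | nil => simp [splitSum]
  | cons c v ih => rw [List.cons_append, splitSum, splitSum, ih, add_assoc]; rfl

theorem splitSum_eq_single {F : List L → L → List L → M} {l r : List L} {c : L}
    (hl : c ∉ l) (hr : c ∉ r) (h : ∀ l d r, d ≠ c → F l d r = 0) :
    splitSum F (l ++ c :: r) = F l c r := by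
  rw [splitSum_append, splitSum, List.append_nil, splitSum_eq_zero, splitSum_eq_zero, zero_add,
    add_zero]
  · rintro l' d r' rfl
    exact h _ _ _ (by rintro rfl; simp at hr)
  · rintro l' d r' rfl
    exact h _ _ _ (by rintro rfl; simp at hl)

/-- In a word without repetitions the position of a letter is determined. This identifies the pieces
of an abstract contraction with the explicit ones. -/
theorem split_unique {a b a' b' : List L} {c : L} (hn : (a ++ c :: b).Nodup)
    (h : a ++ c :: b = a' ++ c :: b') : a' = a ∧ b' = b := by
  induction a generalizing a' with
  | nil =>
    cases a' with
    | nil => simpa using h.symm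
    | cons d a' =>
      obtain ⟨rfl, rfl⟩ := List.cons.inj h
      simp at hn
  | cons d a ih =>
    cases a' with
    | nil =>
      obtain ⟨rfl, rfl⟩ := List.cons.inj h
      simp at hn
    | cons d' a' =>
      obtain ⟨rfl, h'⟩ := List.cons.inj h
      obtain ⟨rfl, rfl⟩ := ih (List.nodup_cons.1 hn).2 h'
      exact ⟨rfl, rfl⟩

end SplitSum

/-! ### Chord diagrams and the contraction relation. -/

section Chords

/-- The partner of a letter: `(i, false)` stands for `a_i` and `(i, true)` for `b_i`. -/
def bar {I : Type*} (x : I × Bool) : I × Bool := (x.1, !x.2)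

@[simp] theorem bar_bar {I : Type*} (x : I × Bool) : bar (bar x) = x := by simp [bar]

@[simp] theorem bar_fst {I : Type*} (x : I × Bool) : (bar x).1 = x.1 := rfl

theorem bar_ne {I : Type*} (x : I × Bool) : bar x ≠ x := by
  rintro h; have := congrArg Prod.snd h; simp [bar] at this

theorem bar_inj {I : Type*} {x y : I × Bool} : bar x = bar y ↔ x = y :=
  ⟨fun h => by rw [← bar_bar x, h, bar_bar], congrArg bar⟩

theorem eq_or_eq_bar {I : Type*} {x y : I × Bool} (h : x.1 = y.1) : x = y ∨ x = bar y := by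
  obtain ⟨i, s⟩ := x
  obtain ⟨j, t⟩ := y
  obtain rfl : i = j := h
  cases s <;> cases t <;> simp [bar]

/-- The symplectic form on letters. -/
def omegaCoeff {I : Type*} [DecidableEq I] (x y : I × Bool) : ℚ :=
  if y = bar x then (if x.2 then -1 else 1) else 0

theorem omegaCoeff_of_ne {I : Type*} [DecidableEq I] {x y : I × Bool} (h : y ≠ bar x) :
    omegaCoeff x y = 0 := if_neg h

theorem omegaCoeff_bar {I : Type*} [DecidableEq I] (x : I × Bool) :
    omegaCoeff x (bar x) = if x.2 then -1 else 1 := if_pos rfl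

theorem omegaCoeff_bar_ne_zero {I : Type*} [DecidableEq I] (x : I × Bool) :
    omegaCoeff x (bar x) ≠ 0 := by
  rw [omegaCoeff_bar]; split_ifs <;> simp

/-- A letter of the infinite symplectic alphabet. -/
abbrev Letter : Type := ℕ × Bool

/-- A word in which every letter occurs at most once, and its partner occurs whenever it does. -/
def IsChordDiagram (w : List Letter) : Prop := w.Nodup ∧ ∀ x ∈ w, bar x ∈ w

theorem IsChordDiagram.perm {v w : List Letter} (h : IsChordDiagram v) (p : v.Perm w) :
    IsChordDiagram w :=
  ⟨p.nodup_iff.1 h.1, fun x hx => p.mem_iff.1 (h.2 x (p.mem_iff.2 hx))⟩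

theorem isChordDiagram_cons_cons {c : Letter} {w : List Letter} :
    IsChordDiagram (c :: bar c :: w) ↔ IsChordDiagram w ∧ ∀ x ∈ w, x.1 ≠ c.1 := by
  constructor
  · rintro ⟨h1, h2⟩
    simp only [List.nodup_cons, List.mem_cons, not_or] at h1
    obtain ⟨⟨-, h3⟩, h4, h5⟩ := h1
    have key : ∀ x ∈ w, x ≠ c ∧ x ≠ bar c := fun x hx =>
      ⟨by rintro rfl; exact h3 hx, by rintro rfl; exact h4 hx⟩
    refine ⟨⟨h5, fun x hx => ?_⟩, fun x hx h => ?_⟩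
    · have := h2 x (by simp [hx])
      simp only [List.mem_cons] at this
      rcases this with h | h | h
      · exact absurd (by rw [← h, bar_bar]) (key x hx).2
      · exact absurd (bar_inj.1 h) (key x hx).1
      · exact h
    · rcases eq_or_eq_bar h with h | h
      · exact (key x hx).1 h
      · exact (key x hx).2 h
  · rintro ⟨⟨h1, h2⟩, h3⟩
    refine ⟨?_, fun x hx => ?_⟩
    · simp only [List.nodup_cons, List.mem_cons, not_or]
      exact ⟨⟨(bar_ne c).symm, fun h => h3 _ h rfl⟩, fun h => h3 _ h rfl, h1⟩
    · simp only [List.mem_cons] at hx ⊢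
      rcases hx with rfl | rfl | hx
      · simp
      · simp
      · exact Or.inr (Or.inr (h2 x hx))

theorem exists_fresh (w : List Letter) : ∃ e : ℕ, ∀ x ∈ w, x.1 ≠ e := by
  obtain ⟨e, he⟩ := Infinite.exists_notMem_finset (w.map Prod.fst).toFinset
  exact ⟨e, fun x hx h => he (List.mem_toFinset.2 (h ▸ List.mem_map_of_mem hx))⟩

/-- A contraction removes one chord, inserts a fresh one and only permutes the other letters, so the
right-hand side of the relation stays within chord diagrams. -/
theorem IsChordDiagram.contract {U1 U2 V1 V2 : List Letter} {c : Letter} {e : ℕ}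
    (h : IsChordDiagram ((U1 ++ c :: U2) ++ (V1 ++ bar c :: V2)))
    (he : ∀ x ∈ (U1 ++ c :: U2) ++ (V1 ++ bar c :: V2), x.1 ≠ e) :
    IsChordDiagram ((U2 ++ (e, false) :: U1) ++ (V2 ++ (e, true) :: V1)) := by
  have p1 : ((U1 ++ c :: U2) ++ (V1 ++ bar c :: V2)).Perm
      (c :: bar c :: (U1 ++ U2 ++ (V1 ++ V2))) := by
    rw [← Multiset.coe_eq_coe]
    simp only [← Multiset.coe_add, ← Multiset.cons_coe, ← Multiset.singleton_add]
    abel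
  have p2 : ((U2 ++ (e, false) :: U1) ++ (V2 ++ (e, true) :: V1)).Perm
      ((e, false) :: bar (e, false) :: (U1 ++ U2 ++ (V1 ++ V2))) := by
    rw [← Multiset.coe_eq_coe]
    simp only [← Multiset.coe_add, ← Multiset.cons_coe, ← Multiset.singleton_add]
    change _ = _ + (({(e, true)} : Multiset Letter) + _)
    abel
  refine IsChordDiagram.perm ?_ p2.symm
  refine isChordDiagram_cons_cons.2 ⟨(isChordDiagram_cons_cons.1 (h.perm p1)).1, fun x hx => ?_⟩
  exact he x (p1.mem_iff.2 (by simp only [List.mem_cons]; exact Or.inr (Or.inr hx)))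

/-- The word `q₂ q̄₁ q₃ q̄₂ ⋯ q_m q̄_{m-1}` of a chain `q₁, …, q_m`. -/
def chainWord : List Letter → List Letter
  | [] => []
  | [_] => []
  | a :: b :: l => b :: bar a :: chainWord (b :: l)

/-- The recursion of `chainWord` peels off the first link; this is the recursion at the other end,
where chains are extended and shortened. -/
theorem chainWord_append (s : List Letter) (x y : Letter) :
    chainWord (s ++ [x, y]) = chainWord (s ++ [x]) ++ [y, bar x] := by
  induction s with
  | nil => rfl
  | cons a s ih =>
    cases s with
    | nil => rfl
    | cons b s =>
      simp only [List.cons_append] at ih ⊢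
      rw [chainWord, ih, chainWord]; rfl

/-- A chain with its initial letter contains every qᵢ and every q̄ᵢ except the partner of the last
one. Hence only the last link can be joined to the outside. -/
theorem mem_chainWord (s : List Letter) (a x y : Letter) (l : List Letter) (h : s ++ [x] = a :: l) :
    y ∈ a :: chainWord (a :: l) ↔ y ∈ s ∨ bar y ∈ s ∨ y = x := by
  induction s generalizing a l with
  | nil =>
    obtain ⟨rfl, rfl⟩ := List.cons.inj h
    simp [chainWord]
  | cons b s ih =>
    obtain ⟨rfl, rfl⟩ := List.cons.inj h
    rcases hs : s ++ [x] with _ | ⟨d, l⟩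
    · simp at hs
    · have := ih d l hs
      change y ∈ b :: chainWord (b :: (s ++ [x])) ↔ _
      rw [hs]
      simp only [chainWord, List.mem_cons] at this ⊢
      have hb : y = bar b ↔ bar y = b := by rw [← bar_inj, bar_bar]
      rw [hb]
      tauto

variable {M : Type*} [AddCommGroup M] [Module ℚ M]

/-- The relations satisfied by the classes of cyclic words modulo brackets. -/
structure KillsBrackets (f : List Letter → M) : Prop where
  rot : ∀ u v, f (u ++ v) = f (v ++ u)
  rel : ∀ U V e, U ≠ [] → V ≠ [] → (∀ x ∈ U ++ V, x.1 ≠ e) →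
    f (U ++ V) + splitSum (fun U1 c U2 => splitSum (fun V1 d V2 =>
      omegaCoeff c d • f ((U2 ++ (e, false) :: U1) ++ (V2 ++ (e, true) :: V1))) V) U = 0

namespace KillsBrackets

variable {f : List Letter → M}


/-- Terms of the relation with d ≠ c̄ have coefficient zero, so only genuine contractions need to be
examined. -/
theorem eq_zero_of_contract (hf : KillsBrackets f) {U V : List Letter} {e : ℕ} (hU : U ≠ [])
    (hV : V ≠ [])
    (he : ∀ x ∈ U ++ V, x.1 ≠ e)
    (h : ∀ U1 c U2 V1 V2, U = U1 ++ c :: U2 → V = V1 ++ bar c :: V2 →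
      f ((U2 ++ (e, false) :: U1) ++ (V2 ++ (e, true) :: V1)) = 0) : f (U ++ V) = 0 := by
  have := hf.rel U V e hU hV he
  rwa [splitSum_eq_zero, add_zero] at this
  intro U1 c U2 hU'
  refine splitSum_eq_zero fun V1 d V2 hV' => ?_
  by_cases hd : d = bar c
  · subst hd
    rw [h U1 c U2 V1 V2 hU' hV', smul_zero]
  · rw [omegaCoeff_of_ne hd, zero_smul]

theorem eq_zero_of_disjoint (hf : KillsBrackets f) {U V : List Letter} (hU : U ≠ []) (hV : V ≠ [])
    (h : ∀ c ∈ U, bar c ∉ V) : f (U ++ V) = 0 := by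
  obtain ⟨e, he⟩ := exists_fresh (U ++ V)
  refine hf.eq_zero_of_contract hU hV he fun U1 c U2 V1 V2 h1 h2 => ?_
  exact absurd (by simp [h2]) (h c (by simp [h1]))

/-- With V a single letter there is only one contraction. Up to rotation the new word has ē and e in
the places of c̄ and c, so this renames a chord in place, up to sign. -/
theorem replace (hf : KillsBrackets f) {U1 U2 : List Letter} {c : Letter} {e : ℕ}
    (h1 : bar c ∉ U1) (h2 : bar c ∉ U2) (he : ∀ x ∈ (U1 ++ bar c :: U2) ++ [c], x.1 ≠ e) :
    f ((U1 ++ bar c :: U2) ++ [c]) =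
      -(omegaCoeff (bar c) c • f ((U2 ++ (e, false) :: U1) ++ [(e, true)])) := by
  have := hf.rel (U1 ++ bar c :: U2) [c] e (by simp) (by simp) he
  rw [splitSum_eq_single h1 h2] at this
  · simp only [splitSum, add_zero, List.nil_append] at this
    exact eq_neg_of_add_eq_zero_left this
  · intro l d r hd
    simp only [splitSum, add_zero]
    rw [omegaCoeff_of_ne, zero_smul]
    rintro rfl
    exact hd (bar_bar d).symm

/-- The word W j̄ B x j x̄, with a fresh j = (j, false), is evaluated in two ways: by cutting off j
x̄, and by renaming the chord x. The first yields two contractions; one of them cancels against the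
renaming, and the other is the word in question. -/
theorem parallel_false (hf : KillsBrackets f) {x : Letter} {i : ℕ} {W B : List Letter}
    (hn : (x :: (i, false) :: (W ++ bar x :: (i, true) :: B)).Nodup) :
    f (x :: (i, false) :: (W ++ bar x :: (i, true) :: B)) = 0 := by
  obtain ⟨j, hj⟩ := exists_fresh (x :: (i, false) :: (W ++ bar x :: (i, true) :: B))
  have hmem : ∀ y ∈ x :: (W ++ bar x :: B), y.1 ≠ i := by
    intro y hy h
    have h' : y = (i, false) ∨ y = (i, true) := eq_or_eq_bar (x := y) (y := (i, false)) h
    simp only [List.nodup_cons, List.mem_cons, List.mem_append, List.nodup_append] at hn hy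
    rcases h' with rfl | rfl <;> grind
  have hxW : x ∉ W ∧ x ∉ B ∧ bar x ∉ W ∧ bar x ∉ B := by
    simp only [List.nodup_cons, List.mem_cons, List.mem_append, List.nodup_append] at hn
    grind
  have hji : j ≠ i := fun h => hj (i, false) (by simp) h.symm
  have hjx : x.1 ≠ j := hj x (by simp)
  have hjW : ∀ s, (j, s) ∉ W := fun s h => hj (j, s) (by simp [h]) rfl
  have hjB : ∀ s, (j, s) ∉ B := fun s h => hj (j, s) (by simp [h]) rfl
  have he : ∀ y ∈ (W ++ (j, true) :: (B ++ [x])) ++ [(j, false), bar x], y.1 ≠ i := by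
    intro y hy
    simp only [List.mem_append, List.mem_cons, List.not_mem_nil, or_false] at hy
    rcases hy with (h | rfl | h | rfl) | rfl | rfl
    · exact hmem y (by simp [h])
    · exact hji
    · exact hmem y (by simp [h])
    · exact hmem y (by simp)
    · exact hji
    · exact hmem (bar x) (by simp)
  -- The index i does not occur in the auxiliary word, so it may serve as the fresh index.
  -- Contracting j then creates the chord i of the word in question.
  have hrel := hf.rel _ _ i (by simp) (by simp) he
  have hrep := hf.replace (U1 := W ++ (j, true) :: B) (U2 := [(j, false)]) (c := bar x) (e := i)
    (by rw [bar_bar]; simp only [List.mem_append, List.mem_cons, not_or]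
        exact ⟨hxW.1, fun h => hjx (by rw [h]), hxW.2.1⟩)
    (by rw [bar_bar]; simp only [List.mem_cons, List.not_mem_nil, or_false]
        exact fun h => hjx (by rw [h]))
    (fun y hy => he y (by rw [bar_bar] at hy; simpa using hy))
  have hx1 : x ≠ (j, true) := fun h => hjx (by rw [h])
  have hx2 : x ≠ (j, false) := fun h => hjx (by rw [h])
  have hz : ∀ c : Letter, c ≠ (j, true) → omegaCoeff c (j, false) = 0 := fun c hc =>
    omegaCoeff_of_ne fun h => hc (by rw [← bar_bar c, ← h]; rfl)
  have hb : ∀ c : Letter, c ≠ x → omegaCoeff c (bar x) = 0 := fun c hc =>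
    omegaCoeff_of_ne fun h => hc (bar_inj.1 h).symm
  simp only [splitSum, add_zero, List.nil_append] at hrel
  rw [splitSum_append, splitSum, splitSum_append, splitSum_eq_zero, splitSum_eq_zero] at hrel
  · simp only [splitSum, hz x hx1, hb (j, true) hx1.symm, zero_smul, zero_add, add_zero,
      List.append_nil, List.nil_append] at hrel
    have e1 : W ++ (j, true) :: (B ++ [x]) ++ [(j, false), bar x] =
        (W ++ (j, true) :: B) ++ bar (bar x) :: [(j, false)] ++ [bar x] := by simp
    rw [e1, hrep, bar_bar, List.append_assoc, hf.rot [(j, false)]] at hrel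
    have e2 : (i, false) :: (W ++ (j, true) :: B) ++ [(i, true)] ++ [(j, false)] =
      (i, false) :: (W ++ ((j, true) :: B ++ [])) ++ [(i, true), (j, false)] := by simp
    have e3 : (B ++ [x] ++ (i, false) :: W) ++ [bar x, (i, true)] =
      B ++ (x :: (i, false) :: (W ++ [bar x, (i, true)])) := by simp
    have e4 : x :: (i, false) :: (W ++ [bar x, (i, true)]) ++ B =
      x :: (i, false) :: (W ++ bar x :: (i, true) :: B) := by simp
    -- After rotation the contraction of x agrees with the renamed word; only a nonzero multiple of
    -- the wanted value is left.
    rw [← e4, hf.rot _ B, ← e3]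
    have hj' : omegaCoeff (j, true) (j, false) ≠ 0 := omegaCoeff_bar_ne_zero (j, true)
    simp only [List.append_assoc, List.cons_append, List.nil_append] at hrel ⊢
    rw [add_comm (_ • _) (_ • _), neg_add_cancel_left] at hrel
    exact (smul_eq_zero.1 hrel).resolve_left hj'
  · rintro l c r rfl
    rw [hz c (by rintro rfl; exact hjB true (by simp)), hb c (by rintro rfl; simp at hxW)]
    simp
  · rintro l c r rfl
    rw [hz c (by rintro rfl; exact hjW true (by simp)), hb c (by rintro rfl; simp at hxW)]
    simp

/-- Renaming the chord y = (i, true) through `replace` reverses its orientation and reduces to the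
case already done. -/
theorem parallel (hf : KillsBrackets f) {x y : Letter} {W B : List Letter}
    (hn : (x :: y :: (W ++ bar x :: bar y :: B)).Nodup) :
    f (x :: y :: (W ++ bar x :: bar y :: B)) = 0 := by
  obtain ⟨i, _ | _⟩ := y
  · exact hf.parallel_false hn
  obtain ⟨j, hj⟩ := exists_fresh (x :: (i, true) :: (W ++ bar x :: bar (i, true) :: B))
  have hrep := hf.replace (U1 := W ++ [bar x]) (U2 := B ++ [x]) (c := (i, true)) (e := j)
    (by simp only [List.nodup_cons, List.mem_cons, List.mem_append, List.nodup_append] at hn ⊢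
        grind)
    (by simp only [List.nodup_cons, List.mem_cons, List.mem_append, List.nodup_append] at hn ⊢
        grind)
    (fun y hy => hj y (by simp only [List.mem_append, List.mem_cons] at hy ⊢; tauto))
  have e1 : (W ++ [bar x]) ++ bar (i, true) :: (B ++ [x]) ++ [(i, true)] =
    (W ++ bar x :: bar (i, true) :: B) ++ [x, (i, true)] := by simp
  have e2 : (B ++ [x] ++ (j, false) :: (W ++ [bar x])) ++ [(j, true)] =
    B ++ (x :: (j, false) :: (W ++ [bar x, (j, true)])) := by simp
  have e3 : x :: (j, false) :: (W ++ [bar x, (j, true)]) ++ B =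
    x :: (j, false) :: (W ++ bar x :: (j, true) :: B) := by simp
  have e4 : [x, (i, true)] ++ (W ++ bar x :: bar (i, true) :: B) =
    x :: (i, true) :: (W ++ bar x :: bar (i, true) :: B) := by simp
  rw [e1, e2, hf.rot, hf.rot B, e3, e4, hf.parallel_false, smul_zero, neg_zero] at hrep
  · exact hrep
  · have h1 : ∀ s, (j, s) ∉ W := fun s h => hj (j, s) (by simp [h]) rfl
    have h2 : ∀ s, (j, s) ∉ B := fun s h => hj (j, s) (by simp [h]) rfl
    have h3 : ∀ s, (j, s) ≠ x := fun s h => hj x (by simp) (by rw [← h])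
    have h4 : ∀ s, (j, s) ≠ bar x := fun s h => hj (bar x) (by simp) (by rw [← h])
    have h5 : ∀ s, ∀ b ∈ W, b ≠ (j, s) := fun s b hb h => h1 s (h ▸ hb)
    clear hrep e1 e2 e3 e4 hj
    simp only [List.nodup_cons, List.mem_cons, List.mem_append, List.nodup_append, not_or] at hn ⊢
    obtain ⟨⟨-, a2, a3, a4, a5⟩, ⟨a6, a7, a8, a9⟩, a10, ⟨⟨a11, a12⟩, a13, a14⟩, a15⟩ := hn
    refine ⟨⟨(h3 _).symm, a2, a3, (h3 _).symm, a5⟩, ⟨h1 _, h4 _, by simp, h2 _⟩, a10,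
      ⟨⟨(h4 _).symm, a12⟩, h2 _, a14⟩, fun a ha b hb => ?_⟩
    rcases hb with rfl | rfl | hb
    · exact a15 a ha _ (Or.inl rfl)
    · exact h5 _ a ha
    · exact a15 a ha _ (Or.inr (Or.inr hb))

end KillsBrackets
end Chords
-- Vanishing on chord diagrams and on all words.
namespace KillsBrackets

variable {M : Type*} [AddCommGroup M] [Module ℚ M] {f : List Letter → M}

theorem isChordDiagram_rotate {u v : List Letter} (h : IsChordDiagram (u ++ v)) :
    IsChordDiagram (v ++ u) := h.perm List.perm_append_comm

theorem notMem_right_of_mem_left {u v : List Letter} (h : IsChordDiagram (u ++ v)) {c : Letter}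
    (hc : c ∈ u) : c ∉ v := fun hv => (List.disjoint_of_nodup_append h.1) hc hv

/-- Words `Y q̄_m q₁ Y' q₂ q̄₁ q₃ q̄₂ ⋯ q_m q̄_{m-1}` vanish. -/
theorem chain_eq_zero (hf : KillsBrackets f) (m : ℕ) :
    ∀ (s l : List Letter) (x a : Letter) (Y Y' : List Letter), s.length + 1 = m →
      s ++ [x] = a :: l → (s = [] → Y ++ Y' ≠ []) →
      IsChordDiagram (Y ++ bar x :: a :: (Y' ++ chainWord (a :: l))) →
      f (Y ++ bar x :: a :: (Y' ++ chainWord (a :: l))) = 0 := by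
  induction m using Nat.strong_induction_on with
  | _ m ih =>
  intro s l x a Y Y' hm hs hne hd
  -- bring the pair `q̄_m q₁` to the end
  have e1 : Y ++ bar x :: a :: (Y' ++ chainWord (a :: l)) =
      (Y ++ [bar x, a]) ++ (Y' ++ chainWord (a :: l)) := by simp
  have e2 : (Y' ++ chainWord (a :: l)) ++ (Y ++ [bar x, a]) =
      (Y' ++ chainWord (a :: l) ++ Y) ++ [bar x, a] := by simp
  have hd' := hd
  rw [e1] at hd'
  replace hd' := isChordDiagram_rotate hd'
  rw [e2] at hd'
  rw [e1, hf.rot, e2]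
  rcases s with _ | ⟨a', s⟩
  · obtain ⟨rfl, rfl⟩ := List.cons.inj hs
    have hU : Y' ++ chainWord [x] ++ Y ≠ [] := by
      simp only [chainWord, List.append_nil]
      intro h
      simp only [List.append_eq_nil_iff] at h
      exact hne rfl (by simp [h])
    -- A chain of one link is an adjacent pair x̄ x, which no chord joins to the nonempty rest.
    refine hf.eq_zero_of_disjoint hU (by simp) fun c hc hc' => ?_
    have := notMem_right_of_mem_left hd' hc
    simp only [List.mem_cons, List.not_mem_nil, or_false, not_or] at this hc'
    rcases hc' with h | h
    · exact this.2 (bar_inj.1 h)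
    · exact this.1 (by rw [← h, bar_bar])
  obtain ⟨rfl, hs'⟩ := List.cons.inj hs
  rcases s with _ | ⟨b, s⟩
  · -- two chords: a parallel pair
    obtain rfl : l = [x] := hs'.symm
    have e3 : (Y' ++ chainWord [a', x] ++ Y) ++ [bar x, a'] =
      (Y' ++ x :: bar a' :: Y) ++ [bar x, a'] := by simp [chainWord]
    have e4 : [bar x, a'] ++ (Y' ++ x :: bar a' :: Y) =
      bar x :: a' :: (Y' ++ bar (bar x) :: bar a' :: Y) := by simp
    rw [e3] at hd' ⊢
    replace hd' := isChordDiagram_rotate hd'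
    rw [hf.rot]
    rw [e4] at hd' ⊢
    exact hf.parallel hd'.1
  obtain ⟨l', rfl⟩ : ∃ l', l = b :: l' := ⟨_, hs'.symm⟩
  obtain ⟨e, he⟩ := exists_fresh ((Y' ++ chainWord (a' :: b :: l') ++ Y) ++ [bar x, a'])
  -- The pair q̄_m q₁ is cut off, so the only possible contractions use q_m or q̄₁ in the remaining
  -- word.
  refine hf.eq_zero_of_contract (by simp [chainWord]) (by simp) he fun U1 c U2 V1 V2 hU hV => ?_
  have hdc := (hV ▸ hU ▸ hd').contract (hV ▸ hU ▸ he)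
  have hcases : (V1 = [] ∧ bar c = bar x ∧ V2 = [a']) ∨ (V1 = [bar x] ∧ bar c = a' ∧ V2 = []) := by
    rcases V1 with _ | ⟨v, V1⟩
    · simp only [List.nil_append, List.cons.injEq] at hV
      exact Or.inl ⟨rfl, hV.1.symm, hV.2.symm⟩
    · rcases V1 with _ | ⟨v', V1⟩
      · simp only [List.cons_append, List.nil_append, List.cons.injEq] at hV
        exact Or.inr ⟨by rw [hV.1], hV.2.1.symm, hV.2.2.symm⟩
      · simp only [List.cons_append, List.cons.injEq] at hV
        simp at hV
  have hnU : (Y' ++ chainWord (a' :: b :: l') ++ Y).Nodup := hd'.1.of_append_left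
  rcases hcases with ⟨rfl, hc, rfl⟩ | ⟨rfl, hc, rfl⟩
  · -- contraction of `q_m`
    obtain rfl := bar_inj.1 hc
    obtain ⟨s0, z, hs0⟩ : ∃ s0 z, a' :: b :: s = s0 ++ [z] :=
      ⟨_, _, (List.dropLast_append_getLast (by simp)).symm⟩
    obtain ⟨s1, y, rfl⟩ : ∃ s1 y, s0 = s1 ++ [y] := by
      refine ⟨_, _, (List.dropLast_append_getLast ?_).symm⟩
      rintro rfl
      simp at hs0
    have hchain : a' :: b :: l' = s1 ++ [y] ++ [z, c] := by
      rw [← hs, hs0]; simp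
    obtain ⟨l0, hl0⟩ : ∃ l0, s1 ++ [y] = a' :: l0 := by
      rcases s1 with _ | ⟨w, s1⟩
      · simp only [List.nil_append, List.cons_append, List.cons.injEq] at hchain ⊢
        exact ⟨[], hchain.1.symm, rfl⟩
      · simp only [List.cons_append, List.cons.injEq] at hchain ⊢
        exact ⟨_, hchain.1.symm, rfl⟩
    have hsplit : Y' ++ chainWord (a' :: b :: l') ++ Y =
        (Y' ++ chainWord (s1 ++ [y] ++ [z])) ++ c :: (bar z :: Y) := by
      rw [hchain, chainWord_append]; simp
    rw [hsplit] at hU hnU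
    obtain ⟨rfl, rfl⟩ := split_unique hnU hU
    have e3 : (bar z :: Y ++ (e, false) :: (Y' ++ chainWord (s1 ++ [y] ++ [z]))) ++
        ([a'] ++ [(e, true)]) = (bar z :: Y ++ (e, false) :: Y') ++
          ((chainWord (s1 ++ [y] ++ [z]) ++ [a']) ++ [(e, true)]) := by simp
    rw [e3] at hdc ⊢
    have e4 : (bar z :: Y ++ (e, false) :: Y') ++
          ((chainWord (s1 ++ [y] ++ [z]) ++ [a']) ++ [(e, true)]) =
        (bar z :: Y ++ (e, false) :: Y' ++ (chainWord (s1 ++ [y] ++ [z]) ++ [a'])) ++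
          [(e, true)] := by simp
    rw [e4] at hdc ⊢
    replace hdc := isChordDiagram_rotate hdc
    rw [hf.rot]
    have e5 : [(e, true)] ++ (bar z :: Y ++ (e, false) :: Y' ++
        (chainWord (s1 ++ [y] ++ [z]) ++ [a'])) =
      ([(e, true)] ++ bar z :: (Y ++ (e, false) :: Y')) ++
        (chainWord (s1 ++ [y] ++ [z]) ++ [a']) := by simp
    rw [e5] at hdc ⊢
    obtain ⟨h, hh⟩ := exists_fresh (([(e, true)] ++ bar z :: (Y ++ (e, false) :: Y')) ++
        (chainWord (s1 ++ [y] ++ [z]) ++ [a']))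
    -- This term is not yet a closed chain, so it is cut a second time. The part q₂ q̄₁ ⋯ q_{m-1}
    -- q̄_{m-2} q₁ is closed under partners except for q_{m-1}, and a single contraction remains.
    refine hf.eq_zero_of_contract (by simp) (by simp) hh fun U1 d U2 V1 V2 hU' hV' => ?_
    have hdd := (hV' ▸ hU' ▸ hdc).contract (hV' ▸ hU' ▸ hh)
    have hmem : ∀ w, w ∈ chainWord (s1 ++ [y] ++ [z]) ++ [a'] ↔
        w ∈ s1 ++ [y] ∨ bar w ∈ s1 ++ [y] ∨ w = z := by
      intro w
      rw [← mem_chainWord (s1 ++ [y]) a' z w (l0 ++ [z]) (by rw [hl0]; rfl), hl0]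
      simp only [List.mem_append, List.mem_cons, List.not_mem_nil, or_false, List.cons_append]
      tauto
    have hd1 : d ∉ chainWord (s1 ++ [y] ++ [z]) ++ [a'] :=
      notMem_right_of_mem_left hdc (by rw [hU']; simp)
    have hd2 : bar d ∈ chainWord (s1 ++ [y] ++ [z]) ++ [a'] := by rw [hV']; simp
    rw [hmem] at hd1 hd2
    rw [bar_bar] at hd2
    obtain rfl : bar d = z := by tauto
    have hV2 : chainWord (s1 ++ [y] ++ [bar d]) ++ [a'] =
        chainWord (s1 ++ [y]) ++ bar d :: [bar y, a'] := by
      rw [List.append_assoc, List.singleton_append, chainWord_append]; simp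
    have hnV := hdc.1.of_append_right
    have hnU := hdc.1.of_append_left
    rw [hV2] at hV' hnV
    rw [bar_bar] at hU' hnU
    obtain ⟨rfl, rfl⟩ := split_unique hnV hV'
    obtain ⟨rfl, rfl⟩ := split_unique hnU hU'
    have hlen : (s1 ++ [y]).length + 2 = m := by
      have h1 := congrArg List.length hs0
      simp only [List.length_cons, List.length_append, List.length_nil] at h1 hm ⊢
      omega
    -- What is left is the closed chain q₁, …, q_{m-2}; the fresh letters belong to the parts Y and
    -- Y'.
    have e6 : (Y ++ (e, false) :: Y' ++ (h, false) :: [(e, true)]) ++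
        ([bar y, a'] ++ (h, true) :: chainWord (s1 ++ [y])) =
      (Y ++ (e, false) :: Y' ++ [(h, false), (e, true)]) ++ bar y :: a' ::
        ([(h, true)] ++ chainWord (a' :: l0)) := by rw [hl0]; simp
    rw [e6] at hdd ⊢
    exact ih _ (by simp at hlen; omega) s1 l0 y a' _ _ rfl hl0 (fun _ => by simp) hdd
  · -- contraction of `q₁`
    obtain rfl : a' = bar c := hc.symm
    rcases l' with _ | ⟨d, l'⟩
    · simp at hs'
    have hsplit : Y' ++ chainWord (bar c :: b :: d :: l') ++ Y =
        (Y' ++ [b]) ++ c :: (chainWord (b :: d :: l') ++ Y) := by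
      simp [chainWord]
    rw [hsplit] at hU hnU
    obtain ⟨rfl, rfl⟩ := split_unique hnU hU
    have e3 : (chainWord (b :: d :: l') ++ Y ++ (e, false) :: (Y' ++ [b])) ++
        ([] ++ [(e, true), bar x]) = (d :: bar b :: chainWord (d :: l')) ++
        ((Y ++ (e, false) :: (Y' ++ [b]) ++ [(e, true)]) ++ [bar x]) := by simp [chainWord]
    rw [e3] at hdc ⊢
    replace hdc := isChordDiagram_rotate hdc
    rw [hf.rot]
    -- This is the closed chain q₃, …, q_m: the chord q₂ has left the chain, with q₂ in the new Y
    -- and q̄₂ as the new Y'.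
    have e4 : ((Y ++ (e, false) :: (Y' ++ [b]) ++ [(e, true)]) ++ [bar x]) ++
        (d :: bar b :: chainWord (d :: l')) =
      (Y ++ (e, false) :: (Y' ++ [b]) ++ [(e, true)]) ++ bar x :: d ::
        ([bar b] ++ chainWord (d :: l')) := by simp
    rw [e4] at hdc ⊢
    simp only [List.length_cons] at hm
    exact ih (s.length + 1) (by omega) s l' x d _ _ rfl (by simpa using hs')
      (fun _ => by simp) hdc

/-- Words beginning with a chain `q₁ q₂ q̄₁ q₃ q̄₂ ⋯ q_m q̄_{m-1}` vanish. -/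
theorem eq_zero_of_chain (hf : KillsBrackets f) (n : ℕ) :
    ∀ (s l : List Letter) (x a : Letter) (G G' : List Letter), G.length + G'.length = n →
      s ++ [x] = a :: l → (s = [] → G ++ G' ≠ []) →
      IsChordDiagram (a :: chainWord (a :: l) ++ (G ++ bar x :: G')) →
      f (a :: chainWord (a :: l) ++ (G ++ bar x :: G')) = 0 := by
  induction n using Nat.strong_induction_on with
  | _ n ih =>
  intro s l x a G G' hn hs hne hd
  have hmem : ∀ w, w ∈ a :: chainWord (a :: l) ↔ w ∈ s ∨ bar w ∈ s ∨ w = x := fun w =>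
    mem_chainWord s a x w l hs
  rcases eq_or_ne G [] with rfl | hG
  · rcases eq_or_ne G' [] with rfl | hG'
    · have e1 : [bar x] ++ (a :: chainWord (a :: l)) =
        [] ++ bar x :: a :: ([] ++ chainWord (a :: l)) := by simp
      rw [List.nil_append] at hd ⊢
      replace hd := isChordDiagram_rotate hd
      rw [hf.rot]
      rw [e1] at hd ⊢
      exact hf.chain_eq_zero _ s l x a [] [] rfl hs (fun h => by simpa using hne h) hd
    · have e1 : a :: chainWord (a :: l) ++ ([] ++ bar x :: G') =
        (a :: chainWord (a :: l) ++ [bar x]) ++ G' := by simp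
      rw [e1] at hd ⊢
      -- Followed directly by q̄_m, the chain is closed under partners, so no chord joins it to G'.
      refine hf.eq_zero_of_disjoint (by simp) hG' fun c hc => ?_
      refine notMem_right_of_mem_left hd ?_
      simp only [List.mem_append, List.mem_singleton, hmem, bar_bar] at hc ⊢
      rcases hc with (h | h | h) | h
      · exact Or.inl (Or.inr (Or.inl h))
      · exact Or.inl (Or.inl h)
      · exact Or.inr (by rw [h])
      · exact Or.inl (Or.inr (Or.inr (by rw [h, bar_bar])))
  · have e1 : a :: chainWord (a :: l) ++ (G ++ bar x :: G') =
      (a :: chainWord (a :: l) ++ G) ++ bar x :: G' := by simp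
    have e2 : bar x :: G' ++ (a :: chainWord (a :: l) ++ G) =
      (bar x :: G' ++ a :: chainWord (a :: l)) ++ G := by simp
    rw [e1] at hd ⊢
    replace hd := isChordDiagram_rotate hd
    rw [hf.rot]
    rw [e2] at hd ⊢
    obtain ⟨e, he⟩ := exists_fresh ((bar x :: G' ++ a :: chainWord (a :: l)) ++ G)
    -- The letters G between the chain and q̄_m are cut off.
    refine hf.eq_zero_of_contract (by simp) hG he fun U1 c U2 V1 V2 hU hV => ?_
    have hdc := (hV ▸ hU ▸ hd).contract (hV ▸ hU ▸ he)
    have hcG : bar c ∈ G := by rw [hV]; simp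
    have hnot : ∀ w ∈ G, w ∉ bar x :: G' ++ a :: chainWord (a :: l) := fun w hw hw' =>
      notMem_right_of_mem_left hd hw' hw
    have hcU : c ∈ bar x :: G' ++ a :: chainWord (a :: l) := by rw [hU]; simp
    have hc1 := hnot _ hcG
    simp only [List.mem_append, List.mem_cons (a := c) (b := bar x),
      List.mem_cons (a := bar c) (b := bar x), hmem, bar_bar] at hcU hc1
    -- Partners of chain letters lie in the chain, apart from q̄_m, whose own partner is in the
    -- chain; hence every chord that leaves G ends in G'.
    have hc2 : c ∈ G' := by
      rcases hcU with (h | h) | h | h | h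
      · exact absurd (by rw [h, bar_bar]; tauto) hc1
      · exact h
      · tauto
      · tauto
      · exact absurd (by rw [h]; tauto) hc1
    obtain ⟨G1, G2, rfl⟩ := List.append_of_mem hc2
    have hsplit : bar x :: (G1 ++ c :: G2) ++ a :: chainWord (a :: l) =
      (bar x :: G1) ++ c :: (G2 ++ a :: chainWord (a :: l)) := by simp
    have hnU := hd.1.of_append_left
    rw [hsplit] at hU hnU
    obtain ⟨rfl, rfl⟩ := split_unique hnU hU
    subst hV
    -- The fresh letter e lands between the chain and q̄_m and becomes the link q_{m+1}. The letters
    -- c and c̄ disappear, so the rest is shorter by two.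
    have hchain : a :: chainWord (a :: (l ++ [(e, false)])) =
        a :: chainWord (a :: l) ++ [(e, false), bar x] := by
      have : a :: (l ++ [(e, false)]) = s ++ [x, (e, false)] := by
        rw [← List.cons_append, ← hs]; simp
      rw [this, chainWord_append, hs]; rfl
    have e3 : G2 ++ a :: chainWord (a :: l) ++ (e, false) :: (bar x :: G1) ++
        (V2 ++ (e, true) :: V1) =
      G2 ++ (a :: chainWord (a :: (l ++ [(e, false)])) ++ ((G1 ++ V2) ++ (e, true) :: V1)) := by
      rw [hchain]; simp
    rw [e3] at hdc ⊢
    replace hdc := isChordDiagram_rotate hdc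
    rw [hf.rot]
    have e4 : (a :: chainWord (a :: (l ++ [(e, false)])) ++ ((G1 ++ V2) ++ (e, true) :: V1)) ++ G2 =
      a :: chainWord (a :: (l ++ [(e, false)])) ++ ((G1 ++ V2) ++ bar (e, false) :: (V1 ++ G2)) := by
      simp [bar]
    rw [e4] at hdc ⊢
    refine ih _ ?_ (s ++ [x]) (l ++ [(e, false)]) (e, false) a _ _ rfl (by rw [hs]; rfl)
      (fun h => by simp at h) hdc
    simp only [List.length_append, List.length_cons] at hn ⊢
    omega

/-- The first letter alone is a chain of one link, and length above two ensures that something lies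
outside its chord. -/
theorem eq_zero_of_isChordDiagram (hf : KillsBrackets f) {w : List Letter}
    (hw : IsChordDiagram w) (hlen : 2 < w.length) : f w = 0 := by
  rcases w with _ | ⟨x, w⟩
  · simp at hlen
  have hx : bar x ∈ w := by
    have := hw.2 x (by simp)
    rcases List.mem_cons.1 this with h | h
    · exact absurd h (bar_ne x)
    · exact h
  obtain ⟨G, G', rfl⟩ := List.append_of_mem hx
  refine hf.eq_zero_of_chain _ [] [] x x G G' rfl rfl (fun _ h => ?_) hw
  simp only [List.append_eq_nil_iff] at h
  obtain ⟨rfl, rfl⟩ := h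
  simp at hlen

/-- Renaming the index of the word a_i b_i changes its sign. Three renamings around three distinct
indices give f = -f, and 2 is invertible. -/
theorem pair_eq_zero (hf : KillsBrackets f) (x : Letter) : f [bar x, x] = 0 := by
  have key : ∀ (x : Letter) (e : ℕ), x.1 ≠ e →
      f [bar x, x] = -(omegaCoeff (bar x) x • f [(e, false), (e, true)]) := by
    intro x e h
    exact hf.replace (U1 := []) (U2 := []) (c := x) (e := e) (by simp) (by simp) (by simpa using h)
  have hw : ∀ i : ℕ, omegaCoeff (i, false) (i, true) = 1 := fun i => by
    have := omegaCoeff_bar (i, false)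
    simpa [bar] using this
  have h2 : ∀ i j : ℕ, i ≠ j → f [(i, false), (i, true)] = -f [(j, false), (j, true)] := by
    intro i j h
    have := key (i, true) j h
    simpa [bar, hw] using this
  have h3 : f [(0, false), (0, true)] = -f [(0, false), (0, true)] := by
    conv_lhs => rw [h2 0 1 (by simp), h2 1 2 (by simp), h2 2 0 (by simp)]
    simp
  have h4 : f [(0, false), (0, true)] = 0 := by
    have : (2 : ℚ) • f [(0, false), (0, true)] = 0 := by
      rw [two_smul]; nth_rewrite 1 [h3]; simp
    exact (smul_eq_zero.1 this).resolve_left two_ne_zero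
  have h5 : ∀ i, f [(i, false), (i, true)] = 0 := fun i => by
    rcases eq_or_ne i 0 with rfl | h
    · exact h4
    · rw [h2 i 0 h, h4, neg_zero]
  obtain ⟨e, he⟩ := exists_fresh [x]
  rw [key x e (he x (by simp)), h5, smul_zero, neg_zero]

/-- A letter of a word is good if it and its partner occur exactly once. -/
def IsGood (w : List Letter) (x : Letter) : Prop := w.count x = 1 ∧ w.count (bar x) = 1

instance (w : List Letter) : DecidablePred (IsGood w) := fun _ => inferInstanceAs (Decidable (_ ∧ _))

/-- All words of length at least two vanish. -/
theorem eq_zero (hf : KillsBrackets f) (w : List Letter) (hlen : 2 ≤ w.length) : f w = 0 := by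
  induction hn : w.countP (fun x => ¬ IsGood w x) using Nat.strong_induction_on generalizing w with
  | _ n ih =>
  by_cases hgood : ∀ x ∈ w, IsGood w x
  · have hw : IsChordDiagram w := by
      refine ⟨List.nodup_iff_count_le_one.2 fun x => ?_, fun x hx => ?_⟩
      · by_cases hx : x ∈ w
        · exact (hgood x hx).1.le
        · rw [List.count_eq_zero_of_not_mem hx]; omega
      · exact List.count_pos_iff.1 (by rw [(hgood x hx).2]; omega)
    rcases hlen.lt_or_eq with h | h
    · exact hf.eq_zero_of_isChordDiagram hw h
    · obtain ⟨x, y, rfl⟩ := List.length_eq_two.1 h.symm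
      have := hw.2 y (by simp)
      simp only [List.mem_cons, List.not_mem_nil, or_false] at this
      rcases this with h | h
      · rw [← h]; exact hf.pair_eq_zero y
      · exact absurd h (bar_ne y)
  · push Not at hgood
    obtain ⟨c, hc, hbad⟩ := hgood
    obtain ⟨A, B, rfl⟩ := List.append_of_mem hc
    have e1 : A ++ c :: B = (A ++ [c]) ++ B := by simp
    rw [e1, hf.rot, ← List.append_assoc]
    obtain ⟨e, he⟩ := exists_fresh ((B ++ A) ++ [c])
    -- A bad letter c is rotated to the end and cut off alone, so each contraction removes c
    -- together with one copy of its partner and adds a fresh pair.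
    refine hf.eq_zero_of_contract ?_ (by simp) he fun U1 d U2 V1 V2 hU hV => ?_
    · intro h
      simp only [List.append_eq_nil_iff] at h
      obtain ⟨rfl, rfl⟩ := h
      simp at hlen
    have hV' : V1 = [] ∧ c = bar d ∧ V2 = [] := by
      rcases V1 with _ | ⟨v, V1⟩
      · simp only [List.nil_append, List.cons.injEq] at hV
        exact ⟨rfl, hV.1, hV.2.symm⟩
      · simp at hV
    obtain ⟨rfl, rfl, rfl⟩ := hV'
    have hp : (A ++ bar d :: B).Perm (d :: bar d :: (U1 ++ U2)) := by
      have h1 : (A ++ bar d :: B).Perm (bar d :: (B ++ A)) := by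
        exact List.perm_middle.trans (List.perm_append_comm.cons _)
      rw [hU] at h1
      refine h1.trans ?_
      exact ((List.perm_middle).cons (bar d)).trans (List.Perm.swap _ _ _)
    have hp2 : ((U2 ++ (e, false) :: U1) ++ ([] ++ (e, true) :: [])).Perm
        ((e, false) :: (e, true) :: (U1 ++ U2)) := by
      rw [← Multiset.coe_eq_coe]
      simp only [← Multiset.coe_add, ← Multiset.cons_coe, ← Multiset.singleton_add,
        Multiset.coe_nil]
      abel
    have hfr : ∀ y ∈ U1 ++ U2, y.1 ≠ e := fun y hy => he y (by
      rw [hU]; simp only [List.mem_append, List.mem_cons] at hy ⊢; tauto)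
    refine ih _ ?_ _ (by simp; omega) rfl
    subst hn
    rw [hp2.countP_eq, hp.countP_eq]
    have hcnt : ∀ y, ((U2 ++ (e, false) :: U1) ++ ([] ++ (e, true) :: [])).count y =
      ((e, false) :: (e, true) :: (U1 ++ U2)).count y := fun y => hp2.count_eq y
    have hcnt' : ∀ y, (A ++ bar d :: B).count y = (d :: bar d :: (U1 ++ U2)).count y :=
      fun y => hp.count_eq y
    have hfresh : ∀ s, (U1 ++ U2).count (e, s) = 0 := fun s =>
      List.count_eq_zero_of_not_mem fun h => hfr _ h rfl
    have hgood_e : ∀ s, IsGood ((U2 ++ (e, false) :: U1) ++ ([] ++ (e, true) :: [])) (e, s) := by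
      intro s
      refine ⟨?_, ?_⟩ <;> rw [hcnt] <;> cases s <;> simp [hfresh, bar]
    -- Good letters stay good: a good letter that survives, being unique, differs from the removed c
    -- and its partner, and so does its own partner. With the fresh pair good and c gone, the number
    -- of bad letters drops.
    have hmono : ∀ y ∈ U1 ++ U2, IsGood (A ++ bar d :: B) y →
        IsGood ((U2 ++ (e, false) :: U1) ++ ([] ++ (e, true) :: [])) y := by
      rintro y hy ⟨h1, h2⟩
      rw [hcnt', List.count_cons, List.count_cons] at h1 h2
      have hpos := List.count_pos_iff.2 hy
      have hy1 : d ≠ y := by rintro rfl; simp only [beq_self_eq_true, if_true] at h1; omega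
      have hy2 : bar d ≠ y := by rintro rfl; simp only [beq_self_eq_true, if_true] at h1; omega
      have hy3 : d ≠ bar y := by rintro rfl; simp at hy2
      have hy4 : bar d ≠ bar y := fun h => hy1 (bar_inj.1 h)
      have hye : ∀ s, (e, s) ≠ y := fun s h => hfr y hy (by rw [← h])
      have hye' : ∀ s, (e, s) ≠ bar y := fun s h => hfr y hy (by rw [← bar_fst, ← h])
      simp only [beq_iff_eq, hy1, hy2, hy3, hy4, if_false, add_zero] at h1 h2
      refine ⟨?_, ?_⟩ <;> rw [hcnt, List.count_cons, List.count_cons] <;>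
        simp only [beq_iff_eq, hye, hye', if_false, add_zero, h1, h2]
    have hle := List.countP_mono_left (l := U1 ++ U2)
      (p := fun x => decide ¬IsGood ((U2 ++ (e, false) :: U1) ++ ([] ++ (e, true) :: [])) x)
      (q := fun x => decide ¬IsGood (A ++ bar d :: B) x)
      (fun y hy h => by
        simp only [decide_eq_true_eq] at h ⊢
        exact fun h' => h (hmono y hy h'))
    rw [List.countP_cons_of_neg (by simpa using hgood_e false),
      List.countP_cons_of_neg (by simpa using hgood_e true), List.countP_cons,
      List.countP_cons_of_pos (by simpa using hbad)]
    omega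

end KillsBrackets

/-! ### Generalities on abelianizations -/

section General

variable {R L : Type*} [CommRing R] [LieRing L] [LieAlgebra R L]

theorem lie_mem_bracketSpan {P Q : Submodule R L} {x y : L} (hx : x ∈ P) (hy : y ∈ Q) :
    ⁅x, y⁆ ∈ bracketSpan R P Q := Submodule.subset_span ⟨x, hx, y, hy, rfl⟩

theorem bracketSpan_le {P Q N : Submodule R L} :
    bracketSpan R P Q ≤ N ↔ ∀ x ∈ P, ∀ y ∈ Q, ⁅x, y⁆ ∈ N := by
  rw [bracketSpan, Submodule.span_le]
  constructor
  · exact fun h x hx y hy => h ⟨x, hx, y, hy, rfl⟩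
  · rintro h _ ⟨x, hx, y, hy, rfl⟩
    exact h x hx y hy

theorem bracketSpan_mono {P Q P' Q' : Submodule R L} (h : P ≤ P') (h' : Q ≤ Q') :
    bracketSpan R P Q ≤ bracketSpan R P' Q' :=
  bracketSpan_le.2 fun _ hx _ hy => lie_mem_bracketSpan (h hx) (h' hy)

theorem H1.mk_eq_zero {x : L} : H1.mk R x = 0 ↔ x ∈ bracketSpan R (⊤ : Submodule R L) ⊤ :=
  Submodule.Quotient.mk_eq_zero _

theorem H1.mk_lie (x y : L) : H1.mk R ⁅x, y⁆ = 0 :=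
  H1.mk_eq_zero.2 (lie_mem_bracketSpan trivial trivial)

variable (R L) in
/-- The class map as a linear map. -/
def H1.mkHom : L →ₗ[R] H1 R L := Submodule.mkQ _

theorem H1.mkHom_apply (x : L) : H1.mkHom R L x = H1.mk R x := rfl

theorem H1.mk_surjective (z : H1 R L) : ∃ x, H1.mk R x = z := Submodule.Quotient.mk_surjective _ z

/-- The sum of all `[gr i, gr j]` with `i + j = k`. -/
def gradedBracketSpan (gr : ℕ → Submodule R L) (k : ℕ) : Submodule R L :=
  ⨆ p ∈ Finset.HasAntidiagonal.antidiagonal k, bracketSpan R (gr p.1) (gr p.2)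

theorem lie_mem_gradedBracketSpan {gr : ℕ → Submodule R L} {i j k : ℕ} (h : i + j = k) {x y : L}
    (hx : x ∈ gr i) (hy : y ∈ gr j) : ⁅x, y⁆ ∈ gradedBracketSpan gr k :=
  (le_iSup₂_of_le (f := fun (p : ℕ × ℕ) (_ : p ∈ Finset.HasAntidiagonal.antidiagonal k) =>
    bracketSpan R (gr p.1) (gr p.2)) (i, j) (by simpa using h) le_rfl) (lie_mem_bracketSpan hx hy)

theorem gradedBracketSpan_le (gr : ℕ → Submodule R L) (k : ℕ) :
    gradedBracketSpan gr k ≤ bracketSpan R ⊤ ⊤ :=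
  iSup₂_le fun _ _ => bracketSpan_mono le_top le_top

theorem bracketSpan_zero_le (gr : ℕ → Submodule R L) :
    bracketSpan R (gr 0) (gr 0) ≤ gradedBracketSpan gr 0 :=
  bracketSpan_le.2 fun _ hx _ hy => lie_mem_gradedBracketSpan (by simp) hx hy

theorem subsingleton_H1wt {gr : ℕ → Submodule R L} {k : ℕ} (h : gr k ≤ gradedBracketSpan gr k) :
    Subsingleton (H1wt R gr k) := by
  refine ⟨fun a b => ?_⟩
  obtain ⟨x, rfl⟩ := Submodule.Quotient.mk_surjective _ a
  obtain ⟨y, rfl⟩ := Submodule.Quotient.mk_surjective _ b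
  exact (Submodule.Quotient.eq _).2 (h (x - y).2)

/-- The weight zero part of the abelianization is detected by a functional `t`. -/
theorem exists_H1wt_zero_equiv {gr : ℕ → Submodule R L} (t : L →ₗ[R] R)
    (ht : ∀ x y : L, t ⁅x, y⁆ = 0) (hker : ∀ x ∈ gr 0, t x = 0 → x ∈ gradedBracketSpan gr 0)
    (hone : ∃ x ∈ gr 0, t x = 1) :
    ∃ e : H1wt R gr 0 ≃ₗ[R] R, ∀ x : gr 0, e (Submodule.Quotient.mk x) = t x.1 := by
  have hle : gradedBracketSpan gr 0 ≤ LinearMap.ker t :=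
    (gradedBracketSpan_le gr 0).trans (bracketSpan_le.2 fun x _ y _ => ht x y)
  let f : H1wt R gr 0 →ₗ[R] R := Submodule.liftQ _ (t ∘ₗ (gr 0).subtype) fun x hx => hle hx
  refine ⟨LinearEquiv.ofBijective f ⟨?_, fun r => ?_⟩, fun x => rfl⟩
  · refine (injective_iff_map_eq_zero f).2 fun z hz => ?_
    obtain ⟨x, rfl⟩ := Submodule.Quotient.mk_surjective _ z
    exact (Submodule.Quotient.mk_eq_zero _).2 (hker x.1 x.2 hz)
  · obtain ⟨x, hx, hx1⟩ := hone
    refine ⟨r • Submodule.Quotient.mk ⟨x, hx⟩, ?_⟩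
    rw [map_smul]
    change r • t x = r
    rw [hx1, smul_eq_mul, mul_one]

/-- In the span of matrix units, elements of trace zero are sums of brackets. -/
theorem mem_bracketSpan_of_trace_eq_zero {X : Type*} [DecidableEq X] [Nonempty X]
    {N : Submodule R L} (E : X → X → L) (hE : ∀ i j, E i j ∈ N)
    (hspan : N ≤ Submodule.span R (Set.range fun p : X × X => E p.1 p.2))
    (h1 : ∀ i j, i ≠ j → ⁅E i i, E i j⁆ = E i j)
    (h2 : ∀ i j, i ≠ j → ⁅E i j, E j i⁆ = E i i - E j j)
    (t : L →ₗ[R] R) (ht : ∀ i j, t (E i j) = if i = j then 1 else 0)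
    {x : L} (hx : x ∈ N) (htx : t x = 0) : x ∈ bracketSpan R N N := by
  obtain ⟨o⟩ := ‹Nonempty X›
  -- Subtracting t(x) E_oo corrects every element to trace zero, so the claim becomes linear and
  -- need only be checked on matrix units. No division is used, hence any commutative ring is
  -- allowed.
  have key : ∀ x ∈ Submodule.span R (Set.range fun p : X × X => E p.1 p.2),
      x - t x • E o o ∈ bracketSpan R N N := by
    intro x hx
    induction hx using Submodule.span_induction with
    | mem x hx =>
      obtain ⟨⟨i, j⟩, rfl⟩ := hx
      change E i j - t (E i j) • E o o ∈ _
      rw [ht]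
      split_ifs with h
      · subst h
        rw [one_smul]
        by_cases ho : i = o
        · subst ho; rw [sub_self]; exact zero_mem _
        · rw [← h2 i o ho]; exact lie_mem_bracketSpan (hE _ _) (hE _ _)
      · rw [zero_smul, sub_zero, ← h1 i j h]
        exact lie_mem_bracketSpan (hE _ _) (hE _ _)
    | zero => simp
    | add x y _ _ hx hy =>
      have : x + y - t (x + y) • E o o = (x - t x • E o o) + (y - t y • E o o) := by
        rw [map_add, add_smul]; abel
      rw [this]; exact add_mem hx hy
    | smul c x _ hx =>
      have : c • x - t (c • x) • E o o = c • (x - t x • E o o) := by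
        rw [map_smul, smul_sub, smul_smul, smul_eq_mul]
      rw [this]; exact Submodule.smul_mem _ c hx
  have := key x (hspan hx)
  rwa [htx, zero_smul, sub_zero] at this

end General

/-! ### Direct limits detected by a trace in degree zero. -/

section Limit

variable {R : Type} [CommRing R] {G H : ℕ → Type} [∀ n, LieRing (G n)] [∀ n, LieAlgebra R (G n)]
  [∀ n, AddCommGroup (H n)] [∀ n, Module R (H n)]

/-- A family of traces on a direct system of graded Lie algebras `G n` which detects the limit of
the abelianizations `H n`. -/
theorem exists_directLimit_equiv (mk : ∀ n, G n →ₗ[R] H n)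
    (hmk : ∀ n, Function.Surjective (mk n))
    (hker : ∀ n x, mk n x = 0 ↔ x ∈ bracketSpan R (⊤ : Submodule R (G n)) ⊤)
    (φ : ∀ m n : ℕ, m ≤ n → H m →ₗ[R] H n) (ψ : ∀ m n : ℕ, m ≤ n → G m →ₗ⁅R⁆ G n)
    (hφ : ∀ m n h x, φ m n h (mk m x) = mk n (ψ m n h x))
    (gr : ∀ n, ℕ → Submodule R (G n)) (t : ∀ n, G n →ₗ[R] R)
    (hgr : ∀ n (x : G n), x ∈ ⨆ k, gr n k)
    (hψ : ∀ m n h k, ∀ x ∈ gr m k, ψ m n h x ∈ gr n k)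
    (ht : ∀ n (x y : G n), t n ⁅x, y⁆ = 0)
    (htψ : ∀ m n h x, t n (ψ m n h x) = t m x)
    (hpos : ∀ k, k ≠ 0 → ∃ N, ∀ n ≥ N, gr n k ≤ bracketSpan R ⊤ ⊤)
    (hzero : ∃ N, ∀ n ≥ N, ∀ x ∈ gr n 0, t n x = 0 → x ∈ bracketSpan R (⊤ : Submodule R (G n)) ⊤)
    (hone : ∃ n x, t n x = 1) :
    ∃ e : Module.DirectLimit H φ ≃ₗ[R] R,
      ∀ n (x : G n), e (Module.DirectLimit.of R ℕ _ φ n (mk n x)) = t n x := by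
  have hτ : ∀ n, ∃ τ : H n →ₗ[R] R, ∀ x, τ (mk n x) = t n x := by
    intro n
    have hle : LinearMap.ker (mk n) ≤ LinearMap.ker (t n) := fun x hx =>
      (bracketSpan_le.2 fun x _ y _ => ht n x y : bracketSpan R ⊤ ⊤ ≤ LinearMap.ker (t n))
        ((hker n x).1 hx)
    refine ⟨(Submodule.liftQ _ (t n) hle) ∘ₗ
      ((mk n).quotKerEquivOfSurjective (hmk n)).symm.toLinearMap, fun x => ?_⟩
    have : ((mk n).quotKerEquivOfSurjective (hmk n)).symm (mk n x) = Submodule.Quotient.mk x := by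
      rw [LinearEquiv.symm_apply_eq]; rfl
    rw [LinearMap.comp_apply, LinearEquiv.coe_coe, this]
    rfl
  choose τ hτ using hτ
  let of := fun n => Module.DirectLimit.of R ℕ H φ n
  let F : Module.DirectLimit H φ →ₗ[R] R :=
    Module.DirectLimit.lift R ℕ _ _ τ fun m n h z => by
      obtain ⟨x, rfl⟩ := hmk m z
      rw [hφ, hτ, hτ, htψ]
  have hF : ∀ n (x : G n), F (of n (mk n x)) = t n x := fun n x => by
    simp only [F, of]
    rw [Module.DirectLimit.lift_of, hτ]
  have hof : ∀ m n (h : m ≤ n) (x : G m), of n (mk n (ψ m n h x)) = of m (mk m x) :=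
    fun m n h x => by rw [← hφ]; exact Module.DirectLimit.of_f
  -- Every class in the limit has a representative of degree zero.
  have key : ∀ z, ∃ n, ∃ x ∈ gr n 0, z = of n (mk n x) := by
    intro z
    obtain ⟨n, z, rfl⟩ := Module.DirectLimit.exists_of z
    obtain ⟨x, rfl⟩ := hmk n z
    refine Submodule.iSup_induction (gr n)
      (motive := fun x => ∃ n', ∃ y ∈ gr n' 0, of n (mk n x) = of n' (mk n' y))
      (hgr n x) ?_ ?_ ?_
    · intro k x hx
      rcases eq_or_ne k 0 with rfl | hk
      · exact ⟨n, x, hx, rfl⟩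
      -- A component of positive degree k becomes a bracket once it is pushed into the stable range
      -- of k.
      · obtain ⟨N, hN⟩ := hpos k hk
        refine ⟨n, 0, zero_mem _, ?_⟩
        rw [← hof n (max n N) (le_max_left _ _), map_zero, map_zero,
          (hker _ _).2 (hN _ (le_max_right _ _) (hψ _ _ _ _ _ hx)), map_zero]
    · exact ⟨n, 0, zero_mem _, rfl⟩
    · rintro x y ⟨p, a, ha, h1⟩ ⟨q, b, hb, h2⟩
      refine ⟨max p q, ψ p _ (le_max_left _ _) a + ψ q _ (le_max_right _ _) b,
        add_mem (hψ _ _ _ _ _ ha) (hψ _ _ _ _ _ hb), ?_⟩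
      rw [map_add, map_add, map_add, map_add, h1, h2, hof, hof]
  refine ⟨LinearEquiv.ofBijective F ⟨?_, fun r => ?_⟩, hF⟩
  · refine (injective_iff_map_eq_zero F).2 fun z hz => ?_
    obtain ⟨n, x, hx, rfl⟩ := key z
    rw [hF] at hz
    obtain ⟨N, hN⟩ := hzero
    rw [← hof n (max n N) (le_max_left _ _), (hker _ _).2, map_zero]
    exact hN _ (le_max_right _ _) _ (hψ _ _ _ _ _ hx) (by rw [htψ, hz])
  · obtain ⟨n, x, hx⟩ := hone
    refine ⟨r • of n (mk n x), ?_⟩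
    rw [map_smul, hF, hx, smul_eq_mul, mul_one]

end Limit

/-! ### Words and derivations of the free associative algebra -/

section Word

variable {R X : Type*} [CommRing R]

variable (R) in
/-- The product of the letters of a word in the free associative algebra. -/
def word (w : List X) : FreeAlgebra R X := (w.map (FreeAlgebra.ι R)).prod

@[simp] theorem word_nil : word R ([] : List X) = 1 := rfl

theorem word_cons (x : X) (w : List X) : word R (x :: w) = FreeAlgebra.ι R x * word R w := by
  simp [word]

theorem word_singleton (x : X) : word R [x] = FreeAlgebra.ι R x := by simp [word]

theorem word_append (v w : List X) : word R (v ++ w) = word R v * word R w := by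
  simp [word]

theorem ι_mem_T (x : X) : FreeAlgebra.ι R x ∈ T R X := (T.gen R x).2

theorem mem_T {a : FreeAlgebra R X} : a ∈ T R X ↔ FreeAlgebra.algebraMapInv a = 0 := Iff.rfl

theorem word_mem_T {w : List X} (hw : w ≠ []) : word R w ∈ T R X := by
  obtain ⟨x, w, rfl⟩ := List.exists_cons_of_ne_nil hw
  have : FreeAlgebra.algebraMapInv (FreeAlgebra.ι R x) = (0 : R) := ι_mem_T (R := R) x
  rw [mem_T, word_cons, map_mul, this, zero_mul]

theorem wordDeg_eq_span (i : ℕ) :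
    wordDeg R X i = Submodule.span R {a | ∃ w : List X, w.length = i ∧ a = word R w} := by
  induction i with
  | zero =>
    rw [wordDeg, pow_zero, Submodule.one_eq_span]
    congr 1
    ext a
    simp only [Set.mem_singleton_iff, Set.mem_ofPred_eq, List.length_eq_zero_iff]
    constructor
    · rintro rfl; exact ⟨[], rfl, rfl⟩
    · rintro ⟨w, rfl, rfl⟩; rfl
  | succ i ih =>
    have h : wordDeg R X (i + 1) = Submodule.span R (Set.range (FreeAlgebra.ι R)) * wordDeg R X i :=
      pow_succ' _ _
    rw [h, ih, Submodule.span_mul_span]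
    congr 1
    ext a
    rw [Set.mem_mul]
    constructor
    · rintro ⟨_, ⟨x, rfl⟩, _, ⟨w, hw, rfl⟩, rfl⟩
      exact ⟨x :: w, by simp [hw], (word_cons x w).symm⟩
    · rintro ⟨w, hw, rfl⟩
      obtain ⟨x, w, rfl⟩ := List.exists_cons_of_ne_nil (List.ne_nil_of_length_eq_add_one hw)
      exact ⟨_, ⟨x, rfl⟩, _, ⟨w, by simpa using hw, rfl⟩, (word_cons x w).symm⟩

theorem word_mem_wordDeg {w : List X} {i : ℕ} (h : w.length = i) : word R w ∈ wordDeg R X i := by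
  rw [wordDeg_eq_span]; exact Submodule.subset_span ⟨w, h, rfl⟩

theorem splitSum_map {A : Type*} {L M N : Type*} [AddCommGroup M] [AddCommGroup N] [FunLike A M N]
    [AddMonoidHomClass A M N] (φ : A) (F : List L → L → List L → M) (w : List L) :
    φ (splitSum F w) = splitSum (fun l c r => φ (F l c r)) w := by
  induction w generalizing F with
  | nil => exact map_zero φ
  | cons c w ih => rw [splitSum, splitSum, map_add, ih]

end Word

namespace DerT

variable {R X : Type*} [CommRing R]

/-- The extension of a derivation to the free associative algebra with unit. -/
noncomputable def toEnd (D : DerT R X) : FreeAlgebra R X →ₗ[R] FreeAlgebra R X where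
  toFun a := (derAux (fun x => D.1 (T.gen R x)) a).snd
  map_add' a b := by simp
  map_smul' c a := by simp

theorem toEnd_mul (D : DerT R X) (a b : FreeAlgebra R X) :
    D.toEnd (a * b) = D.toEnd a * b + a * D.toEnd b := derAux_snd_mul _ a b

theorem toEnd_coe (D : DerT R X) (a : T R X) :
    D.toEnd (a : FreeAlgebra R X) = (D.1 a : FreeAlgebra R X) := by
  have : DerT.ofGen (fun x => D.1 (T.gen R x)) = D := DerT.ext_gen fun x => by
    rw [DerT.ofGen_gen]
  conv_rhs => rw [← this]
  rfl

theorem toEnd_ι (D : DerT R X) (x : X) :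
    D.toEnd (FreeAlgebra.ι R x) = (D.1 (T.gen R x) : FreeAlgebra R X) := D.toEnd_coe (T.gen R x)

theorem toEnd_one (D : DerT R X) : D.toEnd 1 = 0 := by
  have := D.toEnd_mul 1 1
  simpa using this

theorem toEnd_mem_T (D : DerT R X) (a : FreeAlgebra R X) : D.toEnd a ∈ T R X :=
  derAux_snd_mem _ a

theorem ext_ι {D E : DerT R X}
    (h : ∀ x, D.toEnd (FreeAlgebra.ι R x) = E.toEnd (FreeAlgebra.ι R x)) : D = E :=
  DerT.ext_gen fun x => Subtype.ext (by rw [← toEnd_ι, ← toEnd_ι, h x])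

theorem toEnd_lie (D E : DerT R X) (x : X) : ⁅D, E⁆.toEnd (FreeAlgebra.ι R x) =
    D.toEnd (E.toEnd (FreeAlgebra.ι R x)) - E.toEnd (D.toEnd (FreeAlgebra.ι R x)) := by
  rw [toEnd_ι, DerT.lie_apply, toEnd_ι, toEnd_ι, toEnd_coe, toEnd_coe]; rfl

theorem toEnd_add_ι (D E : DerT R X) (x : X) : (D + E).toEnd (FreeAlgebra.ι R x) =
    D.toEnd (FreeAlgebra.ι R x) + E.toEnd (FreeAlgebra.ι R x) := by
  rw [toEnd_ι, toEnd_ι, toEnd_ι]; rfl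

theorem toEnd_sub_ι (D E : DerT R X) (x : X) : (D - E).toEnd (FreeAlgebra.ι R x) =
    D.toEnd (FreeAlgebra.ι R x) - E.toEnd (FreeAlgebra.ι R x) := by
  rw [toEnd_ι, toEnd_ι, toEnd_ι]; rfl

theorem toEnd_smul_ι (c : R) (D : DerT R X) (x : X) : (c • D).toEnd (FreeAlgebra.ι R x) =
    c • D.toEnd (FreeAlgebra.ι R x) := by
  rw [toEnd_ι, toEnd_ι]; rfl

theorem toEnd_zero_ι (x : X) : (0 : DerT R X).toEnd (FreeAlgebra.ι R x) = 0 := by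
  rw [toEnd_ι]; rfl

theorem toEnd_word (D : DerT R X) (w : List X) : D.toEnd (word R w) =
    splitSum (fun l c r => word R l * D.toEnd (FreeAlgebra.ι R c) * word R r) w := by
  induction w with
  | nil => exact D.toEnd_one
  | cons x w ih =>
    rw [word_cons, toEnd_mul, ih, splitSum, word_nil, one_mul]
    congr 1
    have := splitSum_map (LinearMap.mulLeft R (FreeAlgebra.ι R x))
      (fun l c r => word R l * D.toEnd (FreeAlgebra.ι R c) * word R r) w
    simp only [LinearMap.mulLeft_apply] at this
    rw [this]
    simp only [word_cons, mul_assoc]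

theorem mem_deg {D : DerT R X} {k : ℕ} :
    D ∈ DerT.deg R X k ↔ ∀ x, D.toEnd (FreeAlgebra.ι R x) ∈ wordDeg R X (k + 1) := by
  simp only [toEnd_ι]; rfl

/-- The projection to the elements without constant term. -/
noncomputable def _root_.StableAb.toT : FreeAlgebra R X →ₗ[R] T R X where
  toFun a := ⟨a - algebraMap R _ (FreeAlgebra.algebraMapInv a), by
    rw [mem_T, map_sub, FreeAlgebra.algebraMap_leftInverse, sub_self]⟩
  map_add' a b := Subtype.ext (by
    change _ = (a - _) + (b - _)
    simp only [map_add]; abel)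
  map_smul' c a := Subtype.ext (by
    change c • a - _ = c • (a - _)
    rw [map_smul, smul_eq_mul, map_mul, smul_sub, Algebra.smul_def, Algebra.smul_def])

theorem _root_.StableAb.toT_coe {a : FreeAlgebra R X} (ha : a ∈ T R X) :
    (toT a : FreeAlgebra R X) = a := by
  change a - _ = a
  rw [mem_T.1 ha, map_zero, sub_zero]

/-- The derivation with prescribed values on the generators (up to constant terms). -/
noncomputable def ofVal (f : X → FreeAlgebra R X) : DerT R X := DerT.ofGen fun x => toT (f x)

theorem toEnd_ofVal {f : X → FreeAlgebra R X} {x : X} (h : f x ∈ T R X) :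
    (ofVal f).toEnd (FreeAlgebra.ι R x) = f x := by
  rw [toEnd_ι, ofVal, DerT.ofGen_gen, toT_coe h]

variable [DecidableEq X]

/-- The derivation mapping `x_j` to `a` and all other generators to zero. -/
noncomputable def single (j : X) : FreeAlgebra R X →ₗ[R] DerT R X where
  toFun a := ofVal fun x => if x = j then a else 0
  map_add' a b := DerT.ext_gen (R := R) fun x => by
    change _ = (ofVal (R := R) _).1 _ + (ofVal (R := R) _).1 _
    simp only [ofVal, DerT.ofGen_gen, ← map_add]
    split_ifs <;> simp
  map_smul' c a := DerT.ext_gen (R := R) fun x => by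
    change _ = c • (ofVal (R := R) _).1 _
    simp only [ofVal, DerT.ofGen_gen, ← map_smul]
    split_ifs <;> simp

theorem toEnd_single {j : X} {a : FreeAlgebra R X} (ha : a ∈ T R X) (x : X) :
    (single j a).toEnd (FreeAlgebra.ι R x) = if x = j then a else 0 := by
  refine toEnd_ofVal ?_
  split_ifs
  · exact ha
  · exact zero_mem _

theorem lie_single {p q : X} {u v : FreeAlgebra R X} (hu : u ∈ T R X) (hv : v ∈ T R X) :
    ⁅single p u, single q v⁆ =
      single q ((single p u).toEnd v) - single p ((single q v).toEnd u) := by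
  refine ext_ι fun x => ?_
  rw [toEnd_lie, toEnd_sub_ι, toEnd_single hu, toEnd_single hv, toEnd_single (toEnd_mem_T _ _),
    toEnd_single (toEnd_mem_T _ _)]
  split_ifs <;> simp

theorem single_word_mem_deg {j : X} {w : List X} {k : ℕ} (h : w.length = k + 1) :
    single j (word R w) ∈ DerT.deg R X k := by
  rw [mem_deg]
  intro x
  rw [toEnd_single (word_mem_T (by rintro rfl; simp at h))]
  split_ifs
  · exact word_mem_wordDeg h
  · exact zero_mem _

theorem sum_single [Fintype X] (D : DerT R X) :
    ∑ j, single j (D.toEnd (FreeAlgebra.ι R j)) = D := by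
  refine ext_ι fun x => ?_
  have : ∀ s : Finset X, (∑ j ∈ s, single j (D.toEnd (FreeAlgebra.ι R j))).toEnd
      (FreeAlgebra.ι R x) = ∑ j ∈ s, if x = j then D.toEnd (FreeAlgebra.ι R j) else 0 := by
    intro s
    induction s using Finset.induction_on with
    | empty => simp [toEnd_zero_ι]
    | insert a s ha ih =>
      rw [Finset.sum_insert ha, Finset.sum_insert ha, toEnd_add_ι, ih,
        toEnd_single (toEnd_mem_T _ _)]
  rw [this]; simp

theorem deg_le_of_single [Fintype X] {k : ℕ} {N : Submodule R (DerT R X)}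
    (h : ∀ (j : X) (w : List X), w.length = k + 1 → single j (word R w) ∈ N) :
    DerT.deg R X k ≤ N := by
  intro D hD
  rw [← D.sum_single]
  refine Submodule.sum_mem _ fun j _ => ?_
  have := mem_deg.1 hD j
  rw [wordDeg_eq_span] at this
  refine (Submodule.span_le.2 ?_ : _ ≤ N.comap (single j)) this
  rintro _ ⟨w, hw, rfl⟩
  exact h j w hw

theorem mem_iSup_deg [Fintype X] (D : DerT R X) : D ∈ ⨆ k, DerT.deg R X k := by
  rw [← D.sum_single]
  refine Submodule.sum_mem _ fun j _ => ?_
  have h : D.toEnd (FreeAlgebra.ι R j) ∈ ⨆ i, wordDeg R X (i + 1) := by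
    rw [toEnd_ι]; exact T_le_iSup _
  refine (iSup_le fun i => ?_ : _ ≤ (⨆ k, DerT.deg R X k).comap (single j)) h
  rw [wordDeg_eq_span, Submodule.span_le]
  rintro _ ⟨w, hw, rfl⟩
  exact Submodule.mem_iSup_of_mem i (single_word_mem_deg hw)

end DerT

/-! ### Coefficients of words, the matrix and the trace. -/

section Coeff

variable {R X : Type*} [CommRing R]

theorem equiv_word (w : List X) :
    FreeAlgebra.equivMonoidAlgebraFreeMonoid (word R w) =
      MonoidAlgebra.single (FreeMonoid.ofList w) 1 := by
  induction w with
  | nil => exact map_one _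
  | cons x w ih =>
    rw [word_cons, map_mul, ih]
    have : FreeAlgebra.equivMonoidAlgebraFreeMonoid (FreeAlgebra.ι R x) =
      MonoidAlgebra.single (FreeMonoid.of x) (1 : R) := by
      simp [FreeAlgebra.equivMonoidAlgebraFreeMonoid]
    rw [this, MonoidAlgebra.single_mul_single, one_mul]; rfl

variable (R) in
/-- The coefficient of a word, as a linear functional on the free associative algebra. -/
noncomputable def wordCoeff (w : List X) : FreeAlgebra R X →ₗ[R] R where
  toFun a := (FreeAlgebra.equivMonoidAlgebraFreeMonoid a).coeff (FreeMonoid.ofList w)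
  map_add' a b := by simp
  map_smul' c a := by simp

theorem wordCoeff_word [DecidableEq X] (v w : List X) :
    wordCoeff R v (word R w) = if w = v then 1 else 0 := by
  change (FreeAlgebra.equivMonoidAlgebraFreeMonoid (word R w)).coeff _ = _
  rw [equiv_word, MonoidAlgebra.coeff_single]
  by_cases h : w = v
  · rw [h, Finsupp.single_eq_same, if_pos rfl]
  · rw [if_neg h]
    exact Finsupp.single_eq_of_ne' fun h' => h (FreeMonoid.ofList.injective h')

theorem linCoeff_eq (x : X) (a : FreeAlgebra R X) : linCoeff x a = wordCoeff R [x] a := rfl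

theorem linCoeff_ι [DecidableEq X] (i j : X) :
    linCoeff i (FreeAlgebra.ι R j) = if i = j then 1 else 0 := by
  rw [linCoeff_eq, ← word_singleton, wordCoeff_word]
  simp [eq_comm]

theorem span_word_eq_top : Submodule.span R (Set.range (word R : List X → _)) = ⊤ := by
  refine Submodule.eq_top_iff'.2 fun a => ?_
  induction a using FreeAlgebra.induction with
  | grade0 r =>
    rw [Algebra.algebraMap_eq_smul_one]
    exact Submodule.smul_mem _ _ (Submodule.subset_span ⟨[], rfl⟩)
  | grade1 x => exact Submodule.subset_span ⟨[x], word_singleton x⟩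
  | add a b ha hb => exact add_mem ha hb
  | mul a b ha hb =>
    have := Submodule.mul_mem_mul ha hb
    rw [Submodule.span_mul_span] at this
    refine Submodule.span_mono ?_ this
    rintro _ ⟨_, ⟨v, rfl⟩, _, ⟨w, rfl⟩, rfl⟩
    exact ⟨v ++ w, word_append v w⟩

theorem T_le_span_word :
    (T R X).toSubmodule ≤ Submodule.span R {a | ∃ w : List X, w ≠ [] ∧ a = word R w} := by
  intro a ha
  have h := T_le_iSup (⟨a, ha⟩ : T R X)
  refine (iSup_le fun i => ?_ : _ ≤ Submodule.span R {a | ∃ w : List X, w ≠ [] ∧ a = word R w}) h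
  rw [wordDeg_eq_span]
  refine Submodule.span_mono ?_
  rintro _ ⟨w, hw, rfl⟩
  exact ⟨w, by rintro rfl; simp at hw, rfl⟩

/-- A product of two elements without constant term contains only words of length at least two.
Hence the matrix of a derivation sees only linear parts and turns commutators into commutators. -/
theorem linCoeff_mul {x : X} {a b : FreeAlgebra R X} (ha : a ∈ T R X) (hb : b ∈ T R X) :
    linCoeff x (a * b) = 0 := by
  classical
  have h := Submodule.mul_mem_mul (T_le_span_word ha) (T_le_span_word hb)
  rw [Submodule.span_mul_span] at h
  refine (Submodule.span_le.2 ?_ : _ ≤ LinearMap.ker (wordCoeff R [x])) h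
  rintro _ ⟨_, ⟨v, hv, rfl⟩, _, ⟨w, hw, rfl⟩, rfl⟩
  have : word R v * word R w = word R (v ++ w) := (word_append v w).symm
  simp only [SetLike.mem_coe, LinearMap.mem_ker]
  rw [this, wordCoeff_word, if_neg]
  intro h
  have := congrArg List.length h
  have h1 := List.length_pos_iff.2 hv
  have h2 := List.length_pos_iff.2 hw
  simp at this
  omega

variable [Fintype X]

/-- The degree zero part of a derivation acts on linear coefficients through its matrix. -/
theorem DerT.linCoeff_apply (D : DerT R X) (i : X) (a : T R X) :
    linCoeff i (D.1 a : FreeAlgebra R X) = ∑ l, D.mat i l * linCoeff l (a : FreeAlgebra R X) := by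
  classical
  let F : T R X →ₗ[R] R := wordCoeff R [i] ∘ₗ (T R X).toSubmodule.subtype ∘ₗ D.1 -
    ∑ l, D.mat i l • (wordCoeff R [l] ∘ₗ (T R X).toSubmodule.subtype)
  have hF : ∀ a : T R X, F a = linCoeff i (D.1 a : FreeAlgebra R X) -
      ∑ l, D.mat i l * linCoeff l (a : FreeAlgebra R X) := by
    intro a
    simp only [F, LinearMap.sub_apply, LinearMap.sum_apply, LinearMap.smul_apply, smul_eq_mul]
    rfl
  have h := T.eq_top (LinearMap.ker F) (fun x => ?_) (fun a _ b _ => ?_)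
  · rw [← sub_eq_zero, ← hF]
    exact LinearMap.mem_ker.1 (h ▸ Submodule.mem_top)
  · rw [LinearMap.mem_ker, hF]
    have : ∀ l, linCoeff l ((T.gen R x : T R X) : FreeAlgebra R X) = if l = x then 1 else 0 :=
      fun l => linCoeff_ι l x
    simp only [this]
    simp [DerT.mat]
  · rw [LinearMap.mem_ker, hF, D.leibniz]
    have h1 : ∀ (l : X) (a b : T R X), linCoeff l ((a * b : T R X) : FreeAlgebra R X) = 0 :=
      fun l a b => linCoeff_mul a.2 b.2
    have h2 : ∀ a b : T R X, linCoeff i ((a + b : T R X) : FreeAlgebra R X) =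
        linCoeff i (a : FreeAlgebra R X) + linCoeff i (b : FreeAlgebra R X) :=
      fun a b => (wordCoeff R [i]).map_add _ _
    simp only [h2, h1, mul_zero, Finset.sum_const_zero, add_zero, sub_zero]

theorem DerT.mat_lie (D E : DerT R X) : ⁅D, E⁆.mat = D.mat * E.mat - E.mat * D.mat := by
  ext i j
  have h : linCoeff i (⁅D, E⁆.1 (T.gen R j) : FreeAlgebra R X) =
      linCoeff i (D.1 (E.1 (T.gen R j)) : FreeAlgebra R X) -
        linCoeff i (E.1 (D.1 (T.gen R j)) : FreeAlgebra R X) :=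
    (wordCoeff R [i]).map_sub _ _
  rw [D.linCoeff_apply i (E.1 _), E.linCoeff_apply i (D.1 _)] at h
  exact h

/-- The trace of the degree zero part. -/
noncomputable def DerT.traceHom : DerT R X →ₗ[R] R where
  toFun D := D.mat.trace
  map_add' D E := by
    rw [← Matrix.trace_add]; congr 1; ext i j; exact (wordCoeff R [i]).map_add _ _
  map_smul' c D := by
    rw [RingHom.id_apply, ← Matrix.trace_smul]; congr 1; ext i j
    exact (wordCoeff R [i]).map_smul _ _

theorem DerT.traceHom_lie (D E : DerT R X) : DerT.traceHom ⁅D, E⁆ = 0 := by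
  change Matrix.trace _ = 0
  rw [DerT.mat_lie, Matrix.trace_sub, Matrix.trace_mul_comm, sub_self]

theorem DerT.traceHom_single [DecidableEq X] (i j : X) :
    DerT.traceHom (DerT.single j (FreeAlgebra.ι R i)) = if i = j then 1 else 0 := by
  change ∑ l, linCoeff l ((DerT.single j (FreeAlgebra.ι R i)).1 (T.gen R l) : FreeAlgebra R X) = _
  simp only [← DerT.toEnd_ι, DerT.toEnd_single (ι_mem_T i)]
  rw [Finset.sum_eq_single j]
  · rw [if_pos rfl, linCoeff_ι]; simp [eq_comm]
  · intro l _ hl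
    rw [if_neg hl]; exact (wordCoeff R [l]).map_zero
  · simp

end Coeff

/-! ### Degree and trace under extension of the generators. -/

section Stabilization

variable {R X Y : Type*} [CommRing R]

theorem map_word (φ : X → Y) (w : List X) :
    FreeAlgebra.lift R (FreeAlgebra.ι R ∘ φ) (word R w) = word R (w.map φ) := by
  induction w with
  | nil => exact map_one _
  | cons x w ih => rw [word_cons, map_mul, ih, List.map_cons, word_cons]; simp

theorem map_mem_wordDeg (φ : X → Y) {a : FreeAlgebra R X} {i : ℕ} (ha : a ∈ wordDeg R X i) :
    FreeAlgebra.lift R (FreeAlgebra.ι R ∘ φ) a ∈ wordDeg R Y i := by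
  rw [wordDeg_eq_span] at ha
  have h : Submodule.span R {a | ∃ w : List X, w.length = i ∧ a = word R w} ≤
      (wordDeg R Y i).comap (FreeAlgebra.lift R (FreeAlgebra.ι R ∘ φ)).toLinearMap := by
    refine Submodule.span_le.2 ?_
    rintro _ ⟨w, hw, rfl⟩
    change FreeAlgebra.lift R (FreeAlgebra.ι R ∘ φ) (word R w) ∈ wordDeg R Y i
    rw [map_word]
    exact word_mem_wordDeg (by rw [List.length_map, hw])
  exact h ha

theorem linCoeff_map {φ : X → Y} (hφ : Function.Injective φ) (x : X) (a : FreeAlgebra R X) :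
    linCoeff (φ x) (FreeAlgebra.lift R (FreeAlgebra.ι R ∘ φ) a) = linCoeff x a := by
  classical
  have h : a ∈ Submodule.span R (Set.range (word R : List X → FreeAlgebra R X)) :=
    by rw [span_word_eq_top]; exact Submodule.mem_top
  have h' : Submodule.span R (Set.range (word R : List X → FreeAlgebra R X)) ≤ LinearMap.ker
      (wordCoeff R [φ x] ∘ₗ (FreeAlgebra.lift R (FreeAlgebra.ι R ∘ φ)).toLinearMap -
        wordCoeff R [x]) := by
    refine Submodule.span_le.2 ?_
    rintro _ ⟨w, rfl⟩
    change wordCoeff R [φ x] (FreeAlgebra.lift R (FreeAlgebra.ι R ∘ φ) (word R w)) -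
      wordCoeff R [x] (word R w) = 0
    rw [map_word, wordCoeff_word, wordCoeff_word, sub_eq_zero]
    simp only [show [φ x] = [x].map φ from rfl, (List.map_injective_iff.2 hφ).eq_iff]
  exact sub_eq_zero.1 (h' h)

theorem DerT.extend_mem_deg {φ : X → Y} (hφ : Function.Injective φ) {D : DerT R X} {k : ℕ}
    (hD : D ∈ DerT.deg R X k) : D.extend φ ∈ DerT.deg R Y k := by
  intro y
  by_cases hy : ∃ x, φ x = y
  · obtain ⟨x, rfl⟩ := hy
    have h := DerT.extend_gen hφ D x
    rw [h]
    exact map_mem_wordDeg φ (hD x)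
  · rw [DerT.extend_gen_of_notMem D hy]
    exact zero_mem _

theorem DerT.trace_extend [Fintype X] [Fintype Y] {φ : X → Y} (hφ : Function.Injective φ)
    (D : DerT R X) : DerT.traceHom (D.extend φ) = DerT.traceHom D := by
  change ∑ y, linCoeff y ((D.extend φ).1 (T.gen R y) : FreeAlgebra R Y) =
    ∑ x, linCoeff x (D.1 (T.gen R x) : FreeAlgebra R X)
  symm
  refine Fintype.sum_of_injective φ hφ _ _ ?_ ?_
  · intro y hy
    rw [DerT.extend_gen_of_notMem D (by simpa using hy)]
    exact (wordCoeff R [y]).map_zero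
  · intro x
    rw [DerT.extend_gen hφ]
    exact (linCoeff_map hφ x _).symm

end Stabilization

/-! ### Weight computations for derivations of the free associative algebra. -/

theorem splitSum_sub_smul_mem {R L M : Type*} [Ring R] [AddCommGroup M] [Module R M]
    {N : Submodule R M} {F : List L → L → List L → M} {x : M} {w : List L}
    (h : ∀ l c r, w = l ++ c :: r → F l c r - x ∈ N) : splitSum F w - w.length • x ∈ N := by
  induction w generalizing F with
  | nil => simp [splitSum]
  | cons c w ih =>
    have h1 := add_mem (h [] c w rfl) (ih fun l d r hw => h (c :: l) d r (by rw [hw]; rfl))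
    rw [splitSum, List.length_cons, succ_nsmul]
    convert h1 using 1
    abel

theorem splitSum_eq_count_nsmul {L M : Type*} [DecidableEq L] [AddCommGroup M]
    {F : List L → L → List L → M} {x : M} {w : List L} {a : L}
    (h : ∀ l c r, w = l ++ c :: r → F l c r = if c = a then x else 0) :
    splitSum F w = w.count a • x := by
  induction w generalizing F with
  | nil => simp [splitSum]
  | cons c w ih =>
    rw [splitSum, ih fun l d r hw => h (c :: l) d r (by rw [hw]; rfl), h [] c w rfl,
      List.count_cons, add_nsmul, add_comm]
    simp only [beq_iff_eq]
    split_ifs <;> simp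

namespace DerT

section

variable {R X : Type*} [CommRing R] [DecidableEq X]

/-- Monomial derivations are weight vectors for the diagonal torus. -/
theorem lie_single_ι_self (a j : X) {w : List X} (hw : w ≠ []) :
    ⁅single a (FreeAlgebra.ι R a), single j (word R w)⁆ =
      w.count a • single j (word R w) - if a = j then single j (word R w) else 0 := by
  rw [lie_single (ι_mem_T a) (word_mem_T hw), toEnd_word, toEnd_single (word_mem_T hw),
    splitSum_eq_count_nsmul (x := word R w) (a := a), map_nsmul]
  · split_ifs with h
    · rw [h]
    · rw [map_zero]
  · rintro l c r rfl
    rw [toEnd_single (ι_mem_T a)]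
    split_ifs with h
    · rw [h, word_append, word_cons, mul_assoc]
    · simp

/-- The letter a occurs once, so the derivation a ↦ b substitutes b for it; a correction arises only
when b is the generator j itself. -/
theorem lie_single_ι_of_notMem {a b j : X} {l r : List X} (hl : a ∉ l) (hr : a ∉ r) :
    ⁅single a (FreeAlgebra.ι R b), single j (word R (l ++ a :: r))⁆ =
      single j (word R (l ++ b :: r)) -
        if b = j then single a (word R (l ++ a :: r)) else 0 := by
  have hw : l ++ a :: r ≠ [] := by simp
  rw [lie_single (ι_mem_T b) (word_mem_T hw), toEnd_word, toEnd_single (word_mem_T hw),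
    splitSum_eq_single hl hr]
  · rw [toEnd_single (ι_mem_T b), if_pos rfl]
    rw [word_append l (b :: r), word_cons, mul_assoc]
    split_ifs with h
    · rfl
    · rw [map_zero]
  · intro l d r hd
    rw [toEnd_single (ι_mem_T b), if_neg hd]
    simp

theorem single_ι_mem_deg (a b : X) : single a (FreeAlgebra.ι R b) ∈ DerT.deg R X 0 := by
  rw [← word_singleton]
  exact single_word_mem_deg rfl

/-- Write X for j ↦ j^{k+1} and Y for any a ↦ l a r with l, r powers of j. Modulo brackets all Y
agree with X. Bracketing a ↦ j^k with j ↦ j a gives X minus the sum of k such Y, that is (1 - k) X,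
while the weight of j gives k X. The coefficients are coprime, so X itself is a sum of brackets over
ℤ. -/
theorem single_replicate_mem {k : ℕ} (hk : 1 ≤ k) {j a : X} (ha : a ≠ j) :
    single j (word R (List.replicate (k + 1) j)) ∈ gradedBracketSpan (DerT.deg R X) k ∧
      ∀ l r : List X, (∀ x ∈ l ++ r, x = j) → l.length + r.length = k →
        single a (word R (l ++ a :: r)) ∈ gradedBracketSpan (DerT.deg R X) k := by
  have h1 : ∀ l r : List X, (∀ x ∈ l ++ r, x = j) → l.length + r.length = k →
      single a (word R (l ++ a :: r)) - single j (word R (List.replicate (k + 1) j)) ∈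
        gradedBracketSpan (DerT.deg R X) k := by
    intro l r hlr hk
    have hl : a ∉ l := fun h => ha (hlr a (by simp [h]))
    have hr : a ∉ r := fun h => ha (hlr a (by simp [h]))
    have h := lie_mem_gradedBracketSpan (gr := DerT.deg R X) (zero_add k)
      (single_ι_mem_deg (R := R) a j) (single_word_mem_deg (R := R) (j := j) (w := l ++ a :: r)
        (by simp; omega))
    rw [lie_single_ι_of_notMem hl hr, if_pos rfl] at h
    have hw : l ++ j :: r = List.replicate (k + 1) j := by
      refine List.eq_replicate_iff.2 ⟨by simp; omega, fun x hx => ?_⟩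
      simp only [List.mem_append, List.mem_cons] at hx hlr
      rcases hx with hx | hx | hx
      exacts [hlr x (.inl hx), hx, hlr x (.inr hx)]
    rw [hw] at h
    rw [← neg_sub]
    exact neg_mem h
  obtain ⟨m, rfl⟩ := Nat.exists_eq_add_of_le' hk
  have hX : single j (word R (List.replicate (m + 1 + 1) j)) ∈
      gradedBracketSpan (DerT.deg R X) (m + 1) := by
    have hne : List.replicate (m + 1) j ≠ [] := by simp [List.replicate_succ]
    have h2 := lie_mem_gradedBracketSpan (gr := DerT.deg R X) rfl
      (single_word_mem_deg (R := R) (k := m) (j := a) (w := List.replicate (m + 1) j) (by simp))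
      (single_word_mem_deg (R := R) (j := j) (w := [j, a]) (k := 1) rfl)
    rw [lie_single (word_mem_T hne) (word_mem_T (by simp)), toEnd_word, toEnd_word,
      splitSum_map (single j), splitSum_map (single a)] at h2
    simp only [splitSum, toEnd_single (word_mem_T hne), if_neg ha.symm, if_true, word_nil, mul_zero,
      zero_mul, map_zero, zero_add, mul_one, add_zero] at h2
    have h3 := lie_mem_gradedBracketSpan (gr := DerT.deg R X) (zero_add (m + 1))
      (single_ι_mem_deg (R := R) j j) (single_word_mem_deg (R := R) (j := j)
        (w := List.replicate (m + 1 + 1) j) (by simp))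
    rw [lie_single_ι_self j j (by simp [List.replicate_succ]), if_pos rfl,
      List.count_replicate_self, succ_nsmul, add_sub_cancel_right] at h3
    -- The k = m + 1 terms of the second summand are all of type Y, hence each congruent to X.
    have h4 : splitSum (fun l c r => single a (word R l * (single j (word R [j, a])).toEnd
        (FreeAlgebra.ι R c) * word R r)) (List.replicate (m + 1) j) -
        (List.replicate (m + 1) j).length • single j (word R (List.replicate (m + 1 + 1) j)) ∈
          gradedBracketSpan (DerT.deg R X) (m + 1) := by
      refine splitSum_sub_smul_mem fun l c r hw => ?_
      have hall : ∀ x ∈ l ++ c :: r, x = j := by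
        rw [← hw]; exact fun x hx => List.eq_of_mem_replicate hx
      have hlen : l.length + r.length = m := by
        have := congrArg List.length hw
        simp at this; omega
      rw [hall c (by simp), toEnd_single (word_mem_T (by simp)), if_pos rfl]
      have := h1 (l ++ [j]) r (fun x hx => ?_) (by simp; omega)
      · simpa [word_append, word_cons, mul_assoc] using this
      · simp only [List.mem_append, List.mem_cons, List.not_mem_nil, or_false] at hx hall
        rcases hx with (hx | hx) | hx
        exacts [hall x (.inl hx), hx, hall x (.inr (.inr hx))]
    rw [List.length_replicate] at h4
    have h5 := add_mem (add_mem h2 h4) h3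
    have h6 : word R [j] * word R (List.replicate (m + 1) j) =
      word R (List.replicate (m + 1 + 1) j) := (word_append [j] _).symm
    convert h5 using 1
    rw [h6]
    abel
  refine ⟨hX, fun l r hlr hk => ?_⟩
  have := add_mem (h1 l r hlr hk) hX
  rwa [sub_add_cancel] at this

/-- These are cases where the weight of a is a unit: 1 in the first and the last, -1 in the middle
one. -/
theorem single_mem_of_count {k : ℕ} {a j : X} {w : List X} (hw : w.length = k + 1)
    (h : (a ≠ j ∧ w.count a = 1) ∨ (a = j ∧ (w.count a = 0 ∨ w.count a = 2))) :
    single j (word R w) ∈ gradedBracketSpan (DerT.deg R X) k := by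
  have h1 := lie_mem_gradedBracketSpan (gr := DerT.deg R X) (zero_add k)
    (single_ι_mem_deg (R := R) a a) (single_word_mem_deg (R := R) (j := j) hw)
  rw [lie_single_ι_self a j (by rintro rfl; simp at hw)] at h1
  rcases h with ⟨h, hc⟩ | ⟨h, hc | hc⟩
  · rwa [if_neg h, hc, one_smul, sub_zero] at h1
  · rwa [if_pos h, hc, zero_smul, zero_sub, neg_mem_iff] at h1
  · rwa [if_pos h, hc, two_smul, add_sub_cancel_right] at h1

variable [Fintype X]

theorem deg_le_gradedBracketSpan {k : ℕ} (hk : 2 ≤ k) (hX : k ≤ Fintype.card X) :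
    DerT.deg R X k ≤ gradedBracketSpan (DerT.deg R X) k := by
  refine deg_le_of_single fun j w hw => ?_
  obtain ⟨o, hoj⟩ : ∃ o, o ≠ j :=
    have := Fintype.one_lt_card_iff_nontrivial.1 (by omega : 1 < Fintype.card X)
    exists_ne j
  by_cases hA : ∃ a, (a ≠ j ∧ w.count a = 1) ∨ (a = j ∧ (w.count a = 0 ∨ w.count a = 2))
  · obtain ⟨a, ha⟩ := hA
    exact single_mem_of_count hw ha
  by_cases hC : ∀ b ∈ w, b = j
  · rw [List.eq_replicate_iff.2 ⟨hw, hC⟩]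
    exact (single_replicate_mem (by omega) hoj).1
  push Not at hC
  obtain ⟨b, hb, hbj⟩ := hC
  -- A missing letter a ≠ j is put in the place of one b; the derivation a ↦ b then restores w, and
  -- b ≠ j leaves no correction.
  by_cases hB : ∃ a, a ≠ j ∧ a ∉ w
  · obtain ⟨a, haj, ha⟩ := hB
    obtain ⟨l, r, rfl⟩ := List.append_of_mem hb
    simp only [List.mem_append, List.mem_cons, not_or] at ha
    have h := lie_mem_gradedBracketSpan (gr := DerT.deg R X) (zero_add k)
      (single_ι_mem_deg (R := R) a b) (single_word_mem_deg (R := R) (j := j) (w := l ++ a :: r)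
        (by simp at hw ⊢; omega))
    rwa [lie_single_ι_of_notMem ha.1 ha.2.2, if_neg hbj, sub_zero] at h
  have hcount : ∀ a, a ≠ j → 2 ≤ w.count a := by
    intro a ha
    have h1 : w.count a ≠ 1 := fun h => hA ⟨a, .inl ⟨ha, h⟩⟩
    have h2 : 0 < w.count a := List.count_pos_iff.2 (by
      by_contra h; exact hB ⟨a, ha, h⟩)
    omega
  have hj0 : w.count j ≠ 0 := fun h => hA ⟨j, .inr ⟨rfl, .inl h⟩⟩
  have hsum : ∑ a, w.count a = k + 1 := by
    have := Multiset.sum_count_eq_card (s := Finset.univ) (m := (w : Multiset X)) (by simp)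
    simpa [hw] using this
  have hge : 2 * (Fintype.card X - 1) ≤ ∑ a ∈ Finset.univ.erase j, w.count a := by
    rw [← Finset.card_univ, ← Finset.card_erase_of_mem (Finset.mem_univ j), mul_comm,
      ← smul_eq_mul]
    exact Finset.card_nsmul_le_sum _ _ _ fun a ha => hcount a (Finset.ne_of_mem_erase ha)
  rw [← Finset.add_sum_erase _ _ (Finset.mem_univ j)] at hsum
  -- Now j occurs, and each of the other n - 1 letters occurs at least twice, so 2(n - 1) + 1 ≤ k +
  -- 1 ≤ n + 1. This forces n = k = 2, with w made of one j and two copies of b.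
  have hk2 : k = 2 := by omega
  subst hk2
  obtain ⟨l, r, rfl⟩ := List.append_of_mem (List.count_pos_iff.1 (Nat.pos_of_ne_zero hj0))
  -- The surviving case is the second type of `single_replicate_mem`, with b as the repeated letter.
  refine (single_replicate_mem (j := b) one_le_two (Ne.symm hbj)).2 l r (fun x hx => ?_)
    (by simp at hw; omega)
  have hb2 := hcount b hbj
  have hlen : (l ++ r).length = 2 := by simp at hw ⊢; omega
  have h2 : (l ++ r).count b = (l ++ r).length := by
    have h3 : (l ++ j :: r).count b = (l ++ r).count b := by
      simp [List.count_append, Ne.symm hbj]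
    rw [h3] at hb2
    have := List.count_le_length (a := b) (l := l ++ r)
    omega
  exact (List.count_eq_length.1 h2 x hx).symm

/-- The sum of all a ↦ a is the Euler derivation, which acts on degree k as multiplication by k,
here by one. -/
theorem deg_one_le_gradedBracketSpan : DerT.deg R X 1 ≤ gradedBracketSpan (DerT.deg R X) 1 := by
  refine deg_le_of_single fun j w hw => ?_
  have h1 : ∑ a, ⁅single a (FreeAlgebra.ι R a), single j (word R w)⁆ ∈
      gradedBracketSpan (DerT.deg R X) 1 :=
    Submodule.sum_mem _ fun a _ => lie_mem_gradedBracketSpan (gr := DerT.deg R X) (zero_add 1)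
      (single_ι_mem_deg (R := R) a a) (single_word_mem_deg (R := R) (j := j) hw)
  have hsum : ∑ a, w.count a = 2 := by
    have := Multiset.sum_count_eq_card (s := Finset.univ) (m := (w : Multiset X)) (by simp)
    simpa [hw] using this
  simp only [lie_single_ι_self _ j (show w ≠ [] by rintro rfl; simp at hw),
    Finset.sum_sub_distrib, ← Finset.sum_smul, hsum, Finset.sum_ite_eq', Finset.mem_univ, if_true,
    two_smul, add_sub_cancel_right] at h1
  exact h1

theorem mem_bracketSpan_of_trace [Nonempty X] {D : DerT R X} (hD : D ∈ DerT.deg R X 0)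
    (h : traceHom D = 0) : D ∈ bracketSpan R (DerT.deg R X 0) (DerT.deg R X 0) := by
  refine mem_bracketSpan_of_trace_eq_zero (fun i j => single j (FreeAlgebra.ι R i))
    (fun i j => single_ι_mem_deg j i) ?_ ?_ ?_ traceHom traceHom_single hD h
  · refine deg_le_of_single fun j w hw => Submodule.subset_span ?_
    obtain ⟨i, rfl⟩ := List.length_eq_one_iff.1 hw
    exact ⟨(i, j), by rw [word_singleton]⟩
  · intro i j hij
    rw [lie_single (ι_mem_T _) (ι_mem_T _), toEnd_single (ι_mem_T _), toEnd_single (ι_mem_T _),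
      if_pos rfl, if_neg hij, map_zero, sub_zero]
  · intro i j hij
    rw [lie_single (ι_mem_T _) (ι_mem_T _), toEnd_single (ι_mem_T _), toEnd_single (ι_mem_T _),
      if_pos rfl, if_pos rfl]

end

theorem exists_stable_equiv (R : Type) [CommRing R] :
    ∃ e : Module.DirectLimit (fun n => H1 R (DerT R (Fin n)))
        (fun _ _ h => H1.map R (DerT.extendHom R (Fin.castLE h) (Fin.castLE_injective h))) ≃ₗ[R] R,
      ∀ (n : ℕ) (D : DerT R (Fin n)),
        e (Module.DirectLimit.of R ℕ (fun n => H1 R (DerT R (Fin n))) _ n (H1.mk R D)) =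
          traceHom D := by
  refine exists_directLimit_equiv (G := fun n => DerT R (Fin n)) (fun n => H1.mkHom R _)
    (fun n => H1.mk_surjective) (fun n x => H1.mk_eq_zero) _
    (fun _ _ h => DerT.extendHom R (Fin.castLE h) (Fin.castLE_injective h))
    (fun _ _ _ _ => rfl) (fun n => DerT.deg R (Fin n)) (fun n => traceHom)
    (fun n => mem_iSup_deg) (fun _ _ h _ _ hx => extend_mem_deg (Fin.castLE_injective h) hx)
    (fun n => traceHom_lie)
    (fun _ _ h x => trace_extend (Fin.castLE_injective h) x) (fun k hk => ?_) ?_ ?_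
  · refine ⟨k, fun n hn => le_trans ?_ (gradedBracketSpan_le (DerT.deg R (Fin n)) k)⟩
    rcases eq_or_ne k 1 with rfl | hk1
    · exact deg_one_le_gradedBracketSpan
    · exact deg_le_gradedBracketSpan (by omega) (by simpa using hn)
  · refine ⟨1, fun n hn x hx h => ?_⟩
    have : Nonempty (Fin n) := ⟨⟨0, hn⟩⟩
    exact bracketSpan_mono le_top le_top (mem_bracketSpan_of_trace hx h)
  · exact ⟨1, single 0 (FreeAlgebra.ι R 0), by rw [traceHom_single, if_pos rfl]⟩

theorem exists_H1wt_equiv (R : Type*) [CommRing R] (X : Type*) [Fintype X] [Nonempty X] :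
    ∃ e : H1wt R (DerT.deg R X) 0 ≃ₗ[R] R,
      ∀ D : DerT.deg R X 0, e (Submodule.Quotient.mk D) = D.1.mat.trace := by
  classical
  refine exists_H1wt_zero_equiv traceHom traceHom_lie
    (fun D hD h => bracketSpan_zero_le _ (mem_bracketSpan_of_trace hD h)) ?_
  obtain ⟨o⟩ := ‹Nonempty X›
  exact ⟨_, single_ι_mem_deg o o, by rw [traceHom_single, if_pos rfl]⟩

end DerT

/-! ### Bracket monomials as trees in the free Lie algebra. -/

section FreeLieMonomials

variable {R X : Type*} [CommRing R]

variable (R) in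
/-- The iterated bracket of generators with the shape of a given tree. -/
noncomputable def treeBracket : FreeMagma X → FreeLieAlgebra R X
  | .of x => FreeLieAlgebra.of R x
  | .mul s t => ⁅treeBracket s, treeBracket t⁆

/-- The multiset of leaves of a tree. -/
def treeLeaves : FreeMagma X → Multiset X
  | .of x => {x}
  | .mul s t => treeLeaves s + treeLeaves t

theorem treeLeaves_ne_zero (t : FreeMagma X) : treeLeaves t ≠ 0 := by
  induction t using FreeMagma.rec with
  | of x => simp [treeLeaves]
  | mul s t hs _ =>
    intro h
    exact hs (add_eq_zero.1 (h : treeLeaves s + treeLeaves t = 0)).1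

theorem IsBracketMonomial.exists_tree {k : ℕ} {z : FreeLieAlgebra R X}
    (h : IsBracketMonomial R k z) :
    ∃ t : FreeMagma X, (treeLeaves t).card = k ∧ z = treeBracket R t := by
  induction h with
  | of x => exact ⟨.of x, rfl, rfl⟩
  | lie _ _ h1 h2 =>
    obtain ⟨s, rfl, rfl⟩ := h1
    obtain ⟨t, rfl, rfl⟩ := h2
    exact ⟨.mul s t, Multiset.card_add _ _, rfl⟩

theorem isBracketMonomial_treeBracket (t : FreeMagma X) :
    IsBracketMonomial R (treeLeaves t).card (treeBracket R t) := by
  induction t using FreeMagma.rec with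
  | of x => exact .of x
  | mul s t hs ht =>
    have := IsBracketMonomial.lie hs ht
    rwa [← Multiset.card_add] at this

theorem treeBracket_mem_lieDeg {t : FreeMagma X} {k : ℕ} (h : (treeLeaves t).card = k) :
    treeBracket R t ∈ lieDeg R X k :=
  Submodule.subset_span (h ▸ isBracketMonomial_treeBracket t)

theorem of_mem_lieDeg (x : X) : FreeLieAlgebra.of R x ∈ lieDeg R X 1 :=
  Submodule.subset_span (.of x)

theorem lieDeg_le {k : ℕ} {N : Submodule R (FreeLieAlgebra R X)}
    (h : ∀ t : FreeMagma X, (treeLeaves t).card = k → treeBracket R t ∈ N) :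
    lieDeg R X k ≤ N := by
  refine Submodule.span_le.2 fun z hz => ?_
  obtain ⟨t, ht, rfl⟩ := IsBracketMonomial.exists_tree hz
  exact h t ht

theorem mem_iSup_lieDeg (a : FreeLieAlgebra R X) : a ∈ ⨆ k, lieDeg R X (k + 1) := by
  have h := FreeLie.eq_top (Submodule.span R (Set.range (treeBracket R : FreeMagma X → _)))
    (fun x => Submodule.subset_span ⟨.of x, rfl⟩) (fun a ha b hb => by
      induction ha using Submodule.span_induction with
      | zero => rw [zero_lie]; exact zero_mem _
      | add a a' _ _ h h' => rw [add_lie]; exact add_mem h h'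
      | smul c a _ h => rw [smul_lie]; exact Submodule.smul_mem _ c h
      | mem a ha =>
        obtain ⟨s, rfl⟩ := ha
        induction hb using Submodule.span_induction with
        | zero => rw [lie_zero]; exact zero_mem _
        | add a a' _ _ h h' => rw [lie_add]; exact add_mem h h'
        | smul c a _ h => rw [lie_smul]; exact Submodule.smul_mem _ c h
        | mem b hb =>
          obtain ⟨t, rfl⟩ := hb
          exact Submodule.subset_span ⟨.mul s t, rfl⟩)
  have ha : a ∈ Submodule.span R (Set.range (treeBracket R : FreeMagma X → FreeLieAlgebra R X)) := by
    rw [h]; trivial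
  refine Submodule.span_le.2 ?_ ha
  rintro _ ⟨t, rfl⟩
  obtain ⟨k, hk⟩ := Nat.exists_eq_succ_of_ne_zero
    (mt Multiset.card_eq_zero.1 (treeLeaves_ne_zero t))
  exact Submodule.mem_iSup_of_mem k (treeBracket_mem_lieDeg hk)

/-- By induction a tree with all leaves equal to j gives 0 or the generator j, and ⁅j, j⁆ = 0. -/
theorem treeBracket_eq_zero {t : FreeMagma X} {j : X} (h : ∀ x ∈ treeLeaves t, x = j)
    (ht : 2 ≤ (treeLeaves t).card) : treeBracket R t = 0 := by
  have key : ∀ t : FreeMagma X, (∀ x ∈ treeLeaves t, x = j) →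
      treeBracket R t = 0 ∨ treeBracket R t = FreeLieAlgebra.of R j := by
    intro t
    induction t using FreeMagma.rec with
    | of x => intro h; exact .inr (by rw [← h x (by simp [treeLeaves])]; rfl)
    | mul s t hs ht =>
      intro h
      left
      change ⁅treeBracket R s, treeBracket R t⁆ = 0
      rcases hs (fun x hx => h x (Multiset.mem_add.2 (.inl hx))) with hs | hs
      · rw [hs, zero_lie]
      rcases ht (fun x hx => h x (Multiset.mem_add.2 (.inr hx))) with ht | ht
      · rw [ht, lie_zero]
      rw [hs, ht, lie_self]
  cases t with
  | of x => simp [treeLeaves] at ht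
  | mul s t =>
    change ⁅treeBracket R s, treeBracket R t⁆ = 0
    rcases key s (fun x hx => h x (Multiset.mem_add.2 (.inl hx))) with hs | hs
    · rw [hs, zero_lie]
    rcases key t (fun x hx => h x (Multiset.mem_add.2 (.inr hx))) with ht | ht
    · rw [ht, lie_zero]
    rw [hs, ht, lie_self]

end FreeLieMonomials

/-! ### Abelianization of derivations of the free Lie algebra. -/

namespace DerL

section

variable {R X : Type*} [CommRing R]

open Classical in
/-- The derivation of the free Lie algebra sending the generator `j` to `a` and all the other
generators to zero. -/
noncomputable def single (j : X) : FreeLieAlgebra R X →ₗ[R] DerL R X where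
  toFun a := DerL.ofGen fun x => if x = j then a else 0
  map_add' a b := DerL.ext_gen fun x => by
    simp only [LieDerivation.add_apply, DerL.ofGen_gen]; split_ifs <;> simp
  map_smul' c a := DerL.ext_gen fun x => by
    simp only [LieDerivation.smul_apply, DerL.ofGen_gen, RingHom.id_apply]; split_ifs <;> simp

variable [DecidableEq X]

theorem single_of (j x : X) (a : FreeLieAlgebra R X) :
    single j a (FreeLieAlgebra.of R x) = if x = j then a else 0 := by
  refine (DerL.ofGen_gen _ x).trans ?_
  split_ifs <;> rfl

theorem lie_single (p q : X) (u v : FreeLieAlgebra R X) :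
    ⁅single p u, single q v⁆ = single q (single p u v) - single p (single q v u) := by
  refine DerL.ext_gen fun x => ?_
  simp only [LieDerivation.lie_apply, LieDerivation.sub_apply, single_of]
  split_ifs <;> simp

theorem single_mem_deg {j : X} {a : FreeLieAlgebra R X} {k : ℕ} (h : a ∈ lieDeg R X (k + 1)) :
    single j a ∈ DerL.deg R X k := by
  intro x
  rw [single_of]
  split_ifs
  · exact h
  · exact zero_mem _

theorem single_of_treeBracket_self (a : X) (t : FreeMagma X) :
    single a (FreeLieAlgebra.of R a) (treeBracket R t) = (treeLeaves t).count a • treeBracket R t := by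
  induction t using FreeMagma.rec with
  | of x =>
    refine (single_of a x _).trans ?_
    change _ = Multiset.count a {x} • FreeLieAlgebra.of R x
    rw [Multiset.count_singleton]
    by_cases h : x = a
    · subst h; simp
    · simp [h, Ne.symm h]
  | mul s t hs ht =>
    change single a _ ⁅treeBracket R s, treeBracket R t⁆ =
      Multiset.count a (treeLeaves s + treeLeaves t) • ⁅treeBracket R s, treeBracket R t⁆
    rw [LieDerivation.apply_lie_eq_add, hs, ht, Multiset.count_add, add_nsmul, lie_nsmul, nsmul_lie,
      add_comm]

theorem single_treeBracket_of_notMem {a : X} {t : FreeMagma X} (h : a ∉ treeLeaves t)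
    (u : FreeLieAlgebra R X) : single a u (treeBracket R t) = 0 := by
  induction t using FreeMagma.rec with
  | of x =>
    refine (single_of a x _).trans (if_neg ?_)
    rintro rfl
    exact h (Multiset.mem_singleton_self x)
  | mul s t hs ht =>
    change single a u ⁅treeBracket R s, treeBracket R t⁆ = 0
    rw [LieDerivation.apply_lie_eq_add, hs fun h' => h (Multiset.mem_add.2 (.inl h')),
      ht fun h' => h (Multiset.mem_add.2 (.inr h')), lie_zero, zero_lie, add_zero]

/-- A leaf `b` of a tree can be produced by applying the elementary derivation `a ↦ b`. -/
theorem exists_single_treeBracket {a b : X} {t : FreeMagma X} (ha : a ∉ treeLeaves t)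
    (hb : b ∈ treeLeaves t) : ∃ t' : FreeMagma X, (treeLeaves t').card = (treeLeaves t).card ∧
      single a (FreeLieAlgebra.of R b) (treeBracket R t') = treeBracket R t := by
  induction t using FreeMagma.rec with
  | of x =>
    obtain rfl : b = x := Multiset.mem_singleton.1 hb
    exact ⟨.of a, rfl, (single_of a a _).trans (if_pos rfl)⟩
  | mul s t hs ht =>
    have has : a ∉ treeLeaves s := fun h' => ha (Multiset.mem_add.2 (.inl h'))
    have hat : a ∉ treeLeaves t := fun h' => ha (Multiset.mem_add.2 (.inr h'))
    rcases Multiset.mem_add.1 (show b ∈ treeLeaves s + treeLeaves t from hb) with hb | hb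
    · obtain ⟨s', h1, h2⟩ := hs has hb
      refine ⟨.mul s' t, ?_, ?_⟩
      · change (treeLeaves s' + _).card = (treeLeaves s + _).card
        rw [Multiset.card_add, Multiset.card_add, h1]
      · change single a _ ⁅treeBracket R s', treeBracket R t⁆ = ⁅treeBracket R s, treeBracket R t⁆
        rw [LieDerivation.apply_lie_eq_add, h2, single_treeBracket_of_notMem hat, lie_zero, zero_add]
    · obtain ⟨t', h1, h2⟩ := ht hat hb
      refine ⟨.mul s t', ?_, ?_⟩
      · change (_ + treeLeaves t').card = (_ + treeLeaves t).card
        rw [Multiset.card_add, Multiset.card_add, h1]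
      · change single a _ ⁅treeBracket R s, treeBracket R t'⁆ = ⁅treeBracket R s, treeBracket R t⁆
        rw [LieDerivation.apply_lie_eq_add, h2, single_treeBracket_of_notMem has, zero_lie, add_zero]

theorem sum_single [Fintype X] (D : DerL R X) : ∑ j, single j (D (FreeLieAlgebra.of R j)) = D := by
  refine DerL.ext_gen fun x => ?_
  have : ∀ s : Finset X, (∑ j ∈ s, single j (D (FreeLieAlgebra.of R j))) (FreeLieAlgebra.of R x) =
      ∑ j ∈ s, if x = j then D (FreeLieAlgebra.of R j) else 0 := by
    intro s
    induction s using Finset.induction_on with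
    | empty => simp
    | insert a s ha ih =>
      rw [Finset.sum_insert ha, Finset.sum_insert ha, LieDerivation.add_apply, ih, single_of]
  rw [this]; simp

theorem deg_le_of_single [Fintype X] {k : ℕ} {N : Submodule R (DerL R X)}
    (h : ∀ (j : X) (t : FreeMagma X), (treeLeaves t).card = k + 1 →
      single j (treeBracket R t) ∈ N) : DerL.deg R X k ≤ N := by
  intro D hD
  rw [← sum_single D]
  refine Submodule.sum_mem _ fun j _ => ?_
  exact lieDeg_le (N := N.comap (single j)) (h j) (hD j)

theorem mem_iSup_deg [Fintype X] (D : DerL R X) : D ∈ ⨆ k, DerL.deg R X k := by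
  rw [← sum_single D]
  refine Submodule.sum_mem _ fun j _ => ?_
  have h : (⨆ k, lieDeg R X (k + 1)) ≤ (⨆ k, DerL.deg R X k).comap (single j) :=
    iSup_le fun k a ha => Submodule.mem_iSup_of_mem k (single_mem_deg ha)
  exact h (mem_iSup_lieDeg _)

variable [Fintype X]

theorem deg_le_gradedBracketSpan {k : ℕ} (hk : 1 ≤ k) (hX : k + 2 ≤ Fintype.card X) :
    DerL.deg R X k ≤ gradedBracketSpan (DerL.deg R X) k := by
  refine deg_le_of_single fun j t ht => ?_
  by_cases hC : ∀ b ∈ treeLeaves t, b = j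
  · rw [treeBracket_eq_zero hC (by omega), map_zero]
    exact zero_mem _
  push Not at hC
  obtain ⟨b, hb, hbj⟩ := hC
  -- There are k + 1 leaves and at least k + 2 generators. The unused letter may be j itself, since
  -- the correction in the bracket depends only on b ≠ j.
  obtain ⟨a, ha⟩ : ∃ a, a ∉ treeLeaves t := by
    by_contra! h
    have h1 : (Finset.univ : Finset X).card ≤ (treeLeaves t).toFinset.card :=
      Finset.card_le_card fun a _ => Multiset.mem_toFinset.2 (h a)
    have h2 := Multiset.toFinset_card_le (treeLeaves t)
    rw [Finset.card_univ] at h1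
    omega
  obtain ⟨t', h1, h2⟩ := exists_single_treeBracket (R := R) ha hb
  have h := lie_mem_gradedBracketSpan (gr := DerL.deg R X) (zero_add k)
    (single_mem_deg (R := R) (j := a) (of_mem_lieDeg b)) (single_mem_deg (j := j)
      (treeBracket_mem_lieDeg (R := R) (h1.trans ht)))
  rwa [lie_single, h2, single_of, if_neg hbj, map_zero, sub_zero] at h

/-- As in the associative case, the Euler derivation acts on degree one as the identity. -/
theorem deg_one_le_gradedBracketSpan : DerL.deg R X 1 ≤ gradedBracketSpan (DerL.deg R X) 1 := by
  refine deg_le_of_single fun j t ht => ?_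
  have h1 : ∑ a, ⁅single a (FreeLieAlgebra.of R a), single j (treeBracket R t)⁆ ∈
      gradedBracketSpan (DerL.deg R X) 1 :=
    Submodule.sum_mem _ fun a _ => lie_mem_gradedBracketSpan (gr := DerL.deg R X) (zero_add 1)
      (single_mem_deg (R := R) (j := a) (of_mem_lieDeg a)) (single_mem_deg (j := j)
        (treeBracket_mem_lieDeg (R := R) ht))
  have hsum : ∑ a, (treeLeaves t).count a = 2 := by
    rw [Multiset.sum_count_eq_card (by simp), ht]
  have h2 : ∀ a, ⁅single a (FreeLieAlgebra.of R a), single j (treeBracket R t)⁆ =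
      (treeLeaves t).count a • single j (treeBracket R t) -
        if a = j then single j (treeBracket R t) else 0 := by
    intro a
    rw [lie_single, single_of_treeBracket_self, single_of, map_nsmul]
    split_ifs with h
    · rw [h]
    · rw [map_zero]
  simp only [h2, Finset.sum_sub_distrib, ← Finset.sum_smul, hsum, Finset.sum_ite_eq',
    Finset.mem_univ, if_true, two_smul, add_sub_cancel_right] at h1
  exact h1

end

section Trace

variable {R X : Type*} [CommRing R]

section

attribute [local instance 100] LieRing.ofAssociativeRing

theorem lieToAssoc_of (x : X) : lieToAssoc R X (FreeLieAlgebra.of R x) = FreeAlgebra.ι R x := by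
  rw [lieToAssoc, FreeLieAlgebra.lift_of_apply]

theorem lieToAssoc_lie (a b : FreeLieAlgebra R X) : lieToAssoc R X ⁅a, b⁆ =
    lieToAssoc R X a * lieToAssoc R X b - lieToAssoc R X b * lieToAssoc R X a :=
  LieHom.map_lie _ _ _

theorem lieToAssoc_mem_T (a : FreeLieAlgebra R X) : lieToAssoc R X a ∈ T R X := by
  have h := FreeLie.eq_top ((T R X).toSubmodule.comap
      (lieToAssoc R X : FreeLieAlgebra R X →ₗ[R] FreeAlgebra R X))
    (fun x => by
      change lieToAssoc R X _ ∈ T R X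
      rw [lieToAssoc_of]; exact ι_mem_T x)
    (fun a ha b hb => by
      change lieToAssoc R X _ ∈ T R X
      rw [lieToAssoc_lie]
      exact sub_mem ((T R X).mul_mem ha hb) ((T R X).mul_mem hb ha))
  have ha : a ∈ (T R X).toSubmodule.comap
      (lieToAssoc R X : FreeLieAlgebra R X →ₗ[R] FreeAlgebra R X) := by
    rw [h]; trivial
  exact ha

variable (R) in
/-- The coefficient of a generator in an element of the free Lie algebra. -/
noncomputable def linPart (x : X) : FreeLieAlgebra R X →ₗ[R] R :=
  wordCoeff R [x] ∘ₗ (lieToAssoc R X : FreeLieAlgebra R X →ₗ[R] FreeAlgebra R X)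

theorem linPart_eq (x : X) (a : FreeLieAlgebra R X) :
    linPart R x a = linCoeff x (lieToAssoc R X a) := rfl

end

theorem linPart_lie (x : X) (a b : FreeLieAlgebra R X) : linPart R x ⁅a, b⁆ = 0 := by
  rw [linPart_eq, lieToAssoc_lie, linCoeff_eq, map_sub, ← linCoeff_eq, ← linCoeff_eq,
    linCoeff_mul (lieToAssoc_mem_T _) (lieToAssoc_mem_T _),
    linCoeff_mul (lieToAssoc_mem_T _) (lieToAssoc_mem_T _), sub_zero]

theorem linPart_of [DecidableEq X] (i j : X) :
    linPart R i (FreeLieAlgebra.of R j) = if i = j then 1 else 0 := by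
  rw [linPart_eq, lieToAssoc_of, linCoeff_ι]

theorem linPart_map {Y : Type*} {φ : X → Y} (hφ : Function.Injective φ) (x : X)
    (a : FreeLieAlgebra R X) : linPart R (φ x) (FreeLie.map R φ a) = linPart R x a := by
  classical
  have h := FreeLie.eq_top (LinearMap.ker
      (linPart R (φ x) ∘ₗ (FreeLie.map R φ : FreeLieAlgebra R X →ₗ[R] FreeLieAlgebra R Y) -
        linPart R x))
    (fun y => by
      change linPart R (φ x) (FreeLie.map R φ (FreeLieAlgebra.of R y)) - linPart R x _ = 0
      rw [FreeLie.map, FreeLieAlgebra.lift_of_apply, Function.comp_apply, linPart_of, linPart_of,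
        sub_eq_zero]
      simp only [hφ.eq_iff])
    (fun a _ b _ => by
      change linPart R (φ x) (FreeLie.map R φ ⁅a, b⁆) - linPart R x _ = 0
      rw [LieHom.map_lie, linPart_lie, linPart_lie, sub_zero])
  exact sub_eq_zero.1 (DFunLike.congr_fun (LinearMap.ker_eq_top.1 h) a)

theorem map_treeBracket {Y : Type*} (φ : X → Y) (t : FreeMagma X) :
    IsBracketMonomial R (treeLeaves t).card (FreeLie.map R φ (treeBracket R t)) := by
  induction t using FreeMagma.rec with
  | of x =>
    change IsBracketMonomial R 1 (FreeLie.map R φ (FreeLieAlgebra.of R x))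
    rw [FreeLie.map, FreeLieAlgebra.lift_of_apply]
    exact .of _
  | mul s t hs ht =>
    have := IsBracketMonomial.lie hs ht
    rwa [← Multiset.card_add, ← LieHom.map_lie] at this

theorem linPart_apply [Fintype X] (D : DerL R X) (i : X) (a : FreeLieAlgebra R X) :
    linPart R i (D a) = ∑ l, D.mat i l * linPart R l a := by
  classical
  let F : FreeLieAlgebra R X →ₗ[R] R :=
    linPart R i ∘ₗ (D : FreeLieAlgebra R X →ₗ[R] FreeLieAlgebra R X) -
      ∑ l, D.mat i l • linPart R l
  have hF : ∀ a, F a = linPart R i (D a) - ∑ l, D.mat i l * linPart R l a := by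
    intro a
    simp only [F, LinearMap.sub_apply, LinearMap.sum_apply, LinearMap.smul_apply, smul_eq_mul]
    rfl
  have h := FreeLie.eq_top (LinearMap.ker F) (fun x => ?_) (fun a _ b _ => ?_)
  · rw [← sub_eq_zero, ← hF]
    exact DFunLike.congr_fun (LinearMap.ker_eq_top.1 h) a
  · rw [LinearMap.mem_ker, hF]
    simp only [linPart_of]
    simp [DerL.mat, linPart_eq]
  · rw [LinearMap.mem_ker, hF, LieDerivation.apply_lie_eq_add, map_add]
    simp only [linPart_lie, mul_zero, Finset.sum_const_zero, add_zero, sub_zero]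

variable [Fintype X]

/-- The trace of the degree zero part. -/
noncomputable def traceHom : DerL R X →ₗ[R] R where
  toFun D := D.mat.trace
  map_add' D E := by
    rw [← Matrix.trace_add]; congr 1; ext i j; exact (linPart R i).map_add _ _
  map_smul' c D := by
    rw [RingHom.id_apply, ← Matrix.trace_smul]; congr 1; ext i j
    exact (linPart R i).map_smul _ _

theorem traceHom_lie (D E : DerL R X) : traceHom ⁅D, E⁆ = 0 := by
  have h : ⁅D, E⁆.mat = D.mat * E.mat - E.mat * D.mat := by
    ext i j
    have h : linPart R i (⁅D, E⁆ (FreeLieAlgebra.of R j)) =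
        linPart R i (D (E (FreeLieAlgebra.of R j))) -
          linPart R i (E (D (FreeLieAlgebra.of R j))) := by
      rw [LieDerivation.lie_apply, map_sub]
    rw [linPart_apply D, linPart_apply E] at h
    exact h
  change Matrix.trace _ = 0
  rw [h, Matrix.trace_sub, Matrix.trace_mul_comm, sub_self]

theorem traceHom_single [DecidableEq X] (i j : X) :
    traceHom (single j (FreeLieAlgebra.of R i)) = if i = j then 1 else 0 := by
  change ∑ l, linPart R l (single j (FreeLieAlgebra.of R i) (FreeLieAlgebra.of R l)) = _
  simp only [single_of]
  rw [Finset.sum_eq_single j]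
  · rw [if_pos rfl, linPart_of]; simp [eq_comm]
  · intro l _ hl
    rw [if_neg hl, map_zero]
  · simp

theorem extend_mem_deg {Y : Type*} {φ : X → Y} (hφ : Function.Injective φ) {D : DerL R X} {k : ℕ}
    (hD : D ∈ DerL.deg R X k) : D.extend φ ∈ DerL.deg R Y k := by
  intro y
  by_cases hy : ∃ x, φ x = y
  · obtain ⟨x, rfl⟩ := hy
    rw [DerL.extend_gen hφ]
    refine lieDeg_le (N := (lieDeg R Y (k + 1)).comap
      (FreeLie.map R φ : FreeLieAlgebra R X →ₗ[R] FreeLieAlgebra R Y)) (fun t ht => ?_) (hD x)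
    exact Submodule.subset_span (ht ▸ map_treeBracket φ t)
  · rw [DerL.extend_gen_of_notMem D hy]
    exact zero_mem _

theorem trace_extend {Y : Type*} [Fintype Y] {φ : X → Y} (hφ : Function.Injective φ)
    (D : DerL R X) : traceHom (D.extend φ) = traceHom D := by
  change ∑ y, linPart R y (D.extend φ (FreeLieAlgebra.of R y)) =
    ∑ x, linPart R x (D (FreeLieAlgebra.of R x))
  symm
  refine Fintype.sum_of_injective φ hφ _ _ ?_ ?_
  · intro y hy
    rw [DerL.extend_gen_of_notMem D (by simpa using hy), map_zero]
  · intro x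
    rw [DerL.extend_gen hφ, linPart_map hφ]

theorem mem_bracketSpan_of_trace [Nonempty X] {D : DerL R X} (hD : D ∈ DerL.deg R X 0)
    (h : traceHom D = 0) : D ∈ bracketSpan R (DerL.deg R X 0) (DerL.deg R X 0) := by
  classical
  refine mem_bracketSpan_of_trace_eq_zero (fun i j => single j (FreeLieAlgebra.of R i))
    (fun i j => single_mem_deg (of_mem_lieDeg i)) ?_ ?_ ?_ traceHom traceHom_single hD h
  · refine deg_le_of_single fun j t ht => Submodule.subset_span ?_
    cases t with
    | of i => exact ⟨(i, j), rfl⟩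
    | mul s t =>
      have h1 : (treeLeaves s).card ≠ 0 := mt Multiset.card_eq_zero.1 (treeLeaves_ne_zero s)
      have h2 : (treeLeaves t).card ≠ 0 := mt Multiset.card_eq_zero.1 (treeLeaves_ne_zero t)
      have h3 : (treeLeaves s + treeLeaves t).card = 1 := ht
      rw [Multiset.card_add] at h3
      omega
  · intro i j hij
    rw [lie_single, single_of, single_of, if_pos rfl, if_neg hij, map_zero, sub_zero]
  · intro i j hij
    rw [lie_single, single_of, single_of, if_pos rfl, if_pos rfl]

end Trace

theorem exists_stable_equiv (R : Type) [CommRing R] :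
    ∃ e : Module.DirectLimit (fun n => H1 R (DerL R (Fin n)))
        (fun _ _ h => H1.map R (DerL.extendHom R (Fin.castLE h) (Fin.castLE_injective h))) ≃ₗ[R] R,
      ∀ (n : ℕ) (D : DerL R (Fin n)),
        e (Module.DirectLimit.of R ℕ (fun n => H1 R (DerL R (Fin n))) _ n (H1.mk R D)) =
          traceHom D := by
  refine exists_directLimit_equiv (G := fun n => DerL R (Fin n)) (fun n => H1.mkHom R _)
    (fun n => H1.mk_surjective) (fun n x => H1.mk_eq_zero) _
    (fun _ _ h => DerL.extendHom R (Fin.castLE h) (Fin.castLE_injective h))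
    (fun _ _ _ _ => rfl) (fun n => DerL.deg R (Fin n)) (fun n => traceHom)
    (fun n => mem_iSup_deg) (fun _ _ h _ _ hx => extend_mem_deg (Fin.castLE_injective h) hx)
    (fun n => traceHom_lie)
    (fun _ _ h x => trace_extend (Fin.castLE_injective h) x) (fun k hk => ?_) ?_ ?_
  · refine ⟨k + 2, fun n hn => le_trans ?_ (gradedBracketSpan_le (DerL.deg R (Fin n)) k)⟩
    exact deg_le_gradedBracketSpan (by omega) (by simpa using hn)
  · refine ⟨1, fun n hn x hx h => ?_⟩
    have : Nonempty (Fin n) := ⟨⟨0, hn⟩⟩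
    exact bracketSpan_mono le_top le_top (mem_bracketSpan_of_trace hx h)
  · exact ⟨1, single 0 (FreeLieAlgebra.of R 0), by rw [traceHom_single, if_pos rfl]⟩

theorem exists_H1wt_equiv (R : Type*) [CommRing R] (X : Type*) [Fintype X] [Nonempty X] :
    ∃ e : H1wt R (DerL.deg R X) 0 ≃ₗ[R] R,
      ∀ D : DerL.deg R X 0, e (Submodule.Quotient.mk D) = D.1.mat.trace := by
  classical
  refine exists_H1wt_zero_equiv (traceHom (R := R) (X := X)) traceHom_lie
    (fun D hD h => bracketSpan_zero_le _ (mem_bracketSpan_of_trace hD h)) ?_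
  obtain ⟨o⟩ := ‹Nonempty X›
  exact ⟨_, single_mem_deg (of_mem_lieDeg o), by rw [traceHom_single, if_pos rfl]⟩

end DerL

/-! ### Sums over positions in cyclic words. -/

section SplitSums

variable {L M : Type*} [AddCommGroup M]

theorem splitSum_add (F G : List L → L → List L → M) (w : List L) :
    splitSum (fun l c r => F l c r + G l c r) w = splitSum F w + splitSum G w := by
  induction w generalizing F G with
  | nil => simp [splitSum]
  | cons c w ih => rw [splitSum, splitSum, splitSum, ih]; abel

theorem splitSum_sum {ι : Type*} (s : Finset ι) (F : ι → List L → L → List L → M) (w : List L) :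
    splitSum (fun l c r => ∑ i ∈ s, F i l c r) w = ∑ i ∈ s, splitSum (F i) w := by
  induction w generalizing F with
  | nil => simp [splitSum]
  | cons c w ih => simp only [splitSum, ih, Finset.sum_add_distrib]

theorem splitSum_comm {L' : Type*} (F : List L → L → List L → List L' → L' → List L' → M)
    (v : List L) (w : List L') :
    splitSum (fun l c r => splitSum (fun l' c' r' => F l c r l' c' r') w) v =
      splitSum (fun l' c' r' => splitSum (fun l c r => F l c r l' c' r') v) w := by
  induction v generalizing F with
  | nil => simp only [splitSum]; exact (splitSum_zero w).symm
  | cons c v ih => simp only [splitSum, ih, splitSum_add]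

theorem splitSum_right_eq_left (F : List L → L → List L → L → List L → M) (w : List L) :
    splitSum (fun l c r => splitSum (fun p d q => F l c p d q) r) w =
      splitSum (fun l d q => splitSum (fun l c p => F l c p d q) l) w := by
  induction w generalizing F with
  | nil => rfl
  | cons x w ih => simp only [splitSum, ih, splitSum_add, zero_add]

/-- Summation over ordered pairs of distinct positions of a cyclic word. -/
theorem splitSum_cyclic_swap (F : L → List L → L → List L → M) (w : List L) :
    splitSum (fun l c r => splitSum (fun p d q => F c p d q) (r ++ l)) w =
      splitSum (fun l d r => splitSum (fun p c q => F c q d p) (r ++ l)) w := by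
  simp only [splitSum_append, splitSum_add]
  rw [splitSum_right_eq_left (fun l c p d q => F c p d (q ++ l)),
    splitSum_right_eq_left (fun l d p c q => F c (q ++ l) d p), add_comm]

/-- Choosing a position and reading the cyclic word from there gives each rotation once, which links
contractions to cyclic averages. -/
theorem splitSum_eq_sum_rotate (G : List L → M) (w : List L) :
    splitSum (fun l c r => G (c :: (r ++ l))) w = ∑ k ∈ Finset.range w.length, G (w.rotate k) := by
  have key : ∀ v p : List L, splitSum (fun l c r => G (c :: (r ++ (p ++ l)))) v =
      ∑ k ∈ Finset.range v.length, G ((v ++ p).rotate k) := by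
    intro v
    induction v with
    | nil => intro p; rfl
    | cons c v ih =>
      intro p
      have := ih (p ++ [c])
      simp only [List.append_assoc, List.cons_append, List.nil_append] at this
      rw [splitSum, this, List.length_cons, Finset.sum_range_succ', add_comm]
      simp only [List.cons_append, List.rotate_cons_succ, List.append_nil, List.append_assoc,
        List.rotate_zero]
  simpa using key w []

end SplitSums

/-! ### Linear maps defined on words, and cyclic rotation. -/

section WordLift

variable {R X M : Type*} [CommRing R] [AddCommGroup M] [Module R M]

variable (R) in
/-- The linear map on the free associative algebra with prescribed values on words. -/
noncomputable def wordLift (G : List X → M) : FreeAlgebra R X →ₗ[R] M where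
  toFun a := Finsupp.linearCombination R (fun w : FreeMonoid X => G w.toList)
    (FreeAlgebra.equivMonoidAlgebraFreeMonoid a).coeff
  map_add' a b := by simp
  map_smul' c a := by simp

theorem wordLift_word (G : List X → M) (w : List X) : wordLift R G (word R w) = G w := by
  change Finsupp.linearCombination R _ (FreeAlgebra.equivMonoidAlgebraFreeMonoid _).coeff = _
  rw [equiv_word, MonoidAlgebra.coeff_single, Finsupp.linearCombination_single, one_smul]
  rfl

theorem ext_word {f g : FreeAlgebra R X →ₗ[R] M} (h : ∀ w, f (word R w) = g (word R w)) : f = g :=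
  LinearMap.ext_on span_word_eq_top (by rintro _ ⟨w, rfl⟩; exact h w)

theorem ext_word_of_mem {f g : FreeAlgebra R X →ₗ[R] M} {P : List X → Prop}
    (h : ∀ w, P w → f (word R w) = g (word R w)) {a : FreeAlgebra R X}
    (ha : a ∈ Submodule.span R {a | ∃ w, P w ∧ a = word R w}) : f a = g a := by
  refine LinearMap.eqOn_span ?_ ha
  rintro _ ⟨w, hw, rfl⟩
  exact h w hw

variable (R X) in
/-- Cyclic rotation of words. -/
noncomputable def rotateHom : FreeAlgebra R X →ₗ[R] FreeAlgebra R X :=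
  wordLift R fun w => word R (w.rotate 1)

theorem rotateHom_ι_mul (x : X) (a : FreeAlgebra R X) :
    rotateHom R X (FreeAlgebra.ι R x * a) = a * FreeAlgebra.ι R x := by
  have : rotateHom R X ∘ₗ LinearMap.mulLeft R (FreeAlgebra.ι R x) =
      LinearMap.mulRight R (FreeAlgebra.ι R x) := ext_word fun w => by
    rw [LinearMap.comp_apply, LinearMap.mulLeft_apply, LinearMap.mulRight_apply, ← word_cons,
      rotateHom, wordLift_word, ← word_singleton, ← word_append]
    simp
  exact DFunLike.congr_fun this a

theorem ι_mul_mem_span {x : X} {a : FreeAlgebra R X} (ha : a ∈ T R X) : FreeAlgebra.ι R x * a ∈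
    Submodule.span R {a | ∃ w : List X, 2 ≤ w.length ∧ a = word R w} := by
  have h : Submodule.span R {a | ∃ w : List X, w ≠ [] ∧ a = word R w} ≤
      (Submodule.span R {a | ∃ w : List X, 2 ≤ w.length ∧ a = word R w}).comap
        (LinearMap.mulLeft R (FreeAlgebra.ι R x)) := by
    refine Submodule.span_le.2 ?_
    rintro _ ⟨w, hw, rfl⟩
    refine Submodule.subset_span ⟨x :: w, ?_, (word_cons x w).symm⟩
    have := List.length_pos_iff.2 hw
    simp; omega
  exact h (T_le_span_word ha)

end WordLift

/-! ### Rotation-invariant tensors. -/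

section CyclicAverage

variable {X : Type*}

/-- The average of all cyclic rotations of a word. -/
noncomputable def cyclicAverage : FreeAlgebra ℚ X →ₗ[ℚ] FreeAlgebra ℚ X :=
  wordLift ℚ fun w => (w.length : ℚ)⁻¹ • ∑ k ∈ Finset.range w.length, word ℚ (w.rotate k)

/-- An element without constant term which is invariant under rotation is its own average. -/
theorem cyclicAverage_eq_self {a : FreeAlgebra ℚ X}
    (ha : a ∈ Submodule.span ℚ {a | ∃ w : List X, 2 ≤ w.length ∧ a = word ℚ w})
    (h : rotateHom ℚ X a = a) : cyclicAverage a = a := by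
  -- On words of length at least two, average minus identity is K ∘ (rotation - 1), by telescoping.
  -- This handles all lengths at once, without splitting the tensor into homogeneous parts.
  let K : FreeAlgebra ℚ X →ₗ[ℚ] FreeAlgebra ℚ X := wordLift ℚ fun w =>
    (w.length : ℚ)⁻¹ • ∑ k ∈ Finset.range w.length, ∑ j ∈ Finset.range k, word ℚ (w.rotate j)
  have key := ext_word_of_mem (f := cyclicAverage - LinearMap.id) (g := K ∘ₗ rotateHom ℚ X - K)
    (P := fun w : List X => 2 ≤ w.length) (fun w hw => ?_) ha
  · rw [LinearMap.sub_apply, LinearMap.sub_apply, LinearMap.comp_apply, h, sub_self,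
      LinearMap.id_apply, sub_eq_zero] at key
    exact key
  · simp only [LinearMap.sub_apply, LinearMap.comp_apply, rotateHom, wordLift_word, K,
      cyclicAverage, LinearMap.id_apply, List.length_rotate, ← smul_sub, ← Finset.sum_sub_distrib,
      List.rotate_rotate]
    have h0 : (w.length : ℚ) ≠ 0 := by
      have : w.length ≠ 0 := by omega
      exact_mod_cast this
    have h1 : ∀ k, ∑ j ∈ Finset.range k, (word ℚ (w.rotate (1 + j)) - word ℚ (w.rotate j)) =
        word ℚ (w.rotate k) - word ℚ w := by
      intro k
      have := Finset.sum_range_sub (fun j => word ℚ (w.rotate j)) k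
      simp only [List.rotate_zero] at this
      rw [← this]
      exact Finset.sum_congr rfl fun j _ => by rw [add_comm]
    simp only [h1, Finset.sum_sub_distrib, smul_sub, Finset.sum_const, Finset.card_range]
    rw [← Nat.cast_smul_eq_nsmul ℚ, smul_smul, inv_mul_cancel₀ h0, one_smul]

end CyclicAverage


/-! ### Derivations attached to cyclic words. -/

section CyclicDer

/-- The symplectic form on the letters `a_i = inl i`, `b_i = inr i`. -/
def symPair {I : Type*} [DecidableEq I] : I ⊕ I → I ⊕ I → ℚ
  | .inl i, .inr j => if i = j then 1 else 0
  | .inr i, .inl j => if i = j then -1 else 0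
  | _, _ => 0

variable {I : Type*} [DecidableEq I]

theorem symPair_comm (x y : I ⊕ I) : symPair x y = -symPair y x := by
  rcases x with i | i <;> rcases y with j | j <;> simp only [symPair, neg_zero]
  all_goals
    by_cases h : i = j
    · simp [h]
    · simp [h, Ne.symm h]

/-- The sum of all contractions of a cyclic word with the letter `x`. -/
noncomputable def cyclicContract (x : I ⊕ I) (w : List (I ⊕ I)) : FreeAlgebra ℚ (I ⊕ I) :=
  splitSum (fun l c r => symPair x c • word ℚ (r ++ l)) w

theorem cyclicContract_append_comm (x : I ⊕ I) (u v : List (I ⊕ I)) :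
    cyclicContract x (u ++ v) = cyclicContract x (v ++ u) := by
  simp only [cyclicContract, splitSum_append, List.append_assoc]
  rw [add_comm]

/-- The derivation given by the contractions with a cyclic word. -/
noncomputable def cyclicDer (w : List (I ⊕ I)) : DerT ℚ (I ⊕ I) :=
  DerT.ofVal fun x => cyclicContract x w

theorem cyclicDer_append_comm (u v : List (I ⊕ I)) : cyclicDer (u ++ v) = cyclicDer (v ++ u) := by
  simp only [cyclicDer, cyclicContract_append_comm _ u v]

theorem splitSum_mem {L M : Type*} [AddCommGroup M] [Module ℚ M] {N : Submodule ℚ M}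
    {F : List L → L → List L → M} {w : List L} (h : ∀ l c r, w = l ++ c :: r → F l c r ∈ N) :
    splitSum F w ∈ N := by
  induction w generalizing F with
  | nil => exact zero_mem _
  | cons c w ih =>
    exact add_mem (h [] c w rfl) (ih fun l d r hw => h (c :: l) d r (by rw [hw]; rfl))

theorem cyclicContract_mem_wordDeg {k : ℕ} {w : List (I ⊕ I)} (hw : w.length = k + 1) (x : I ⊕ I) :
    cyclicContract x w ∈ wordDeg ℚ (I ⊕ I) k := by
  refine splitSum_mem fun l c r h => Submodule.smul_mem _ _ (word_mem_wordDeg ?_)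
  rw [h] at hw
  simp at hw ⊢
  omega

theorem cyclicContract_mem_T {w : List (I ⊕ I)} (hw : 2 ≤ w.length) (x : I ⊕ I) :
    cyclicContract x w ∈ T ℚ (I ⊕ I) := by
  obtain ⟨k, hk⟩ := Nat.exists_eq_add_of_le' hw
  exact wordDeg_le_T k (cyclicContract_mem_wordDeg hk x)

theorem cyclicDer_toEnd_ι {w : List (I ⊕ I)} (hw : 2 ≤ w.length) (x : I ⊕ I) :
    (cyclicDer w).toEnd (FreeAlgebra.ι ℚ x) = cyclicContract x w :=
  DerT.toEnd_ofVal (cyclicContract_mem_T hw x)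

theorem cyclicDer_mem_deg {k : ℕ} {w : List (I ⊕ I)} (hw : w.length = k + 2) :
    cyclicDer w ∈ DerT.deg ℚ (I ⊕ I) k :=
  DerT.mem_deg.2 fun x => by
    rw [cyclicDer_toEnd_ι (by omega)]
    exact cyclicContract_mem_wordDeg hw x

/-- Evaluation of derivations at a generator, as a linear map. -/
noncomputable def evalι (x : I ⊕ I) : DerT ℚ (I ⊕ I) →ₗ[ℚ] FreeAlgebra ℚ (I ⊕ I) where
  toFun D := D.toEnd (FreeAlgebra.ι ℚ x)
  map_add' D E := DerT.toEnd_add_ι D E x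
  map_smul' c D := DerT.toEnd_smul_ι c D x

/-- The value at x is reorganised as a sum over contracted pairs (e in u, c in v), followed by the
contraction of x with a remaining letter d of v. In this form both halves of a commutator can be
compared term by term. -/
theorem toEnd_cyclicContract {u v : List (I ⊕ I)} (hu : 2 ≤ u.length) (x : I ⊕ I) :
    (cyclicDer u).toEnd (cyclicContract x v) =
      splitSum (fun l e r => splitSum (fun l' c r' => symPair c e •
        splitSum (fun p d q => symPair x d • word ℚ (q ++ (r ++ l) ++ p)) (r' ++ l')) v) u := by
  rw [cyclicContract, splitSum_map (cyclicDer u).toEnd]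
  simp only [map_smul, DerT.toEnd_word, cyclicDer_toEnd_ι hu]
  have h1 : ∀ (d : I ⊕ I) (m : List (I ⊕ I)), symPair x d • splitSum (fun p c q =>
      word ℚ p * cyclicContract c u * word ℚ q) m = splitSum (fun p c q =>
        symPair x d • (word ℚ p * cyclicContract c u * word ℚ q)) m := fun d m =>
    splitSum_map (DistribSMul.toAddMonoidHom _ (symPair x d)) _ m
  simp only [h1]
  -- The letter contracted with x was chosen before the letter hit by the derivation; here the order
  -- of choice is exchanged.
  rw [splitSum_cyclic_swap (fun d p c q => symPair x d •
    (word ℚ p * cyclicContract c u * word ℚ q)), splitSum_comm]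
  refine splitSum_congr fun l c r _ => ?_
  have h2 : ∀ (e : I ⊕ I) (A m : List (I ⊕ I)), symPair c e • splitSum (fun p d q =>
      symPair x d • word ℚ (q ++ A ++ p)) m = splitSum (fun p d q =>
        symPair c e • symPair x d • word ℚ (q ++ A ++ p)) m := fun e A m =>
    splitSum_map (DistribSMul.toAddMonoidHom _ (symPair c e)) _ m
  simp only [h2]
  rw [splitSum_comm]
  refine splitSum_congr fun p d q _ => ?_
  have h3 : symPair x d • (word ℚ q * cyclicContract c u * word ℚ p) =
      (LinearMap.mulRight ℚ (word ℚ p) ∘ₗ LinearMap.mulLeft ℚ (symPair x d • word ℚ q))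
        (cyclicContract c u) := by
    simp
  rw [h3, cyclicContract, splitSum_map (LinearMap.mulRight ℚ (word ℚ p) ∘ₗ _)]
  refine splitSum_congr fun l' e r' _ => ?_
  simp only [LinearMap.comp_apply, LinearMap.mulLeft_apply, LinearMap.mulRight_apply, word_append,
    mul_smul_comm, smul_mul_assoc, mul_assoc]

/-- The bracket of two cyclic derivations is the sum over all pairs of contracted letters. -/
theorem lie_cyclicDer {u v : List (I ⊕ I)} (hu : 2 ≤ u.length) (hv : 2 ≤ v.length) :
    ⁅cyclicDer u, cyclicDer v⁆ = -splitSum (fun (l : List (I ⊕ I)) e (r : List (I ⊕ I)) =>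
      splitSum (fun (l' : List (I ⊕ I)) c (r' : List (I ⊕ I)) =>
        symPair e c • cyclicDer ((r ++ l) ++ (r' ++ l'))) v) u := by
  refine DerT.ext_ι fun x => ?_
  rw [DerT.toEnd_lie, cyclicDer_toEnd_ι hu, cyclicDer_toEnd_ι hv, toEnd_cyclicContract hu,
    toEnd_cyclicContract hv]
  rw [splitSum_comm (v := v)]
  change _ = evalι x (-splitSum _ u)
  rw [map_neg, splitSum_map (evalι x), eq_neg_iff_add_eq_zero, sub_add_eq_add_sub, sub_eq_zero,
    ← splitSum_add]
  refine splitSum_congr fun l e r h => ?_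
  rw [splitSum_map (evalι x), ← splitSum_add]
  refine splitSum_congr fun l' c r' h' => ?_
  have h3 : 2 ≤ ((r ++ l) ++ (r' ++ l')).length := by
    subst h h'
    simp at hu hv ⊢
    omega
  -- In the glued word, x is contracted with a letter either from u or from v. The two halves of the
  -- commutator supply these two kinds of terms, and antisymmetry of the form gives them the same
  -- sign.
  rw [map_smul, symPair_comm c e]
  change _ + _ • (cyclicDer _).toEnd _ = _
  rw [cyclicDer_toEnd_ι h3, cyclicContract,
    splitSum_append _ (r ++ l) (r' ++ l'), smul_add]
  simp only [List.append_assoc, neg_smul]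
  abel

end CyclicDer

/-! ### Symplectic derivations as cyclic words. -/

section Symplectic

variable {I : Type*} [DecidableEq I]

theorem sum_symPair [Fintype I] {M : Type*} [AddCommGroup M] [Module ℚ M] (c : I ⊕ I)
    (G : I ⊕ I → M) :
    ∑ i, (symPair (.inl i) c • G (.inr i) - symPair (.inr i) c • G (.inl i)) = G c := by
  rcases c with j | j <;> simp [symPair, Finset.sum_ite_eq']

variable {g : ℕ}

theorem toEnd_omega (D : DerT ℚ (Fin g ⊕ Fin g)) : ((D.1 (omega g) : T ℚ (Fin g ⊕ Fin g)) :
    FreeAlgebra ℚ (Fin g ⊕ Fin g)) = ∑ i : Fin g,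
      (D.toEnd (FreeAlgebra.ι ℚ (.inl i)) * FreeAlgebra.ι ℚ (.inr i) -
        D.toEnd (FreeAlgebra.ι ℚ (.inr i)) * FreeAlgebra.ι ℚ (.inl i)) -
      ∑ i : Fin g, (FreeAlgebra.ι ℚ (.inr i) * D.toEnd (FreeAlgebra.ι ℚ (.inl i)) -
        FreeAlgebra.ι ℚ (.inl i) * D.toEnd (FreeAlgebra.ι ℚ (.inr i))) := by
  rw [omega, ← DerT.toEnd_coe, ← Finset.sum_sub_distrib]
  have h : ((∑ i : Fin g, (T.gen ℚ (Sum.inl i) * T.gen ℚ (Sum.inr i) -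
      T.gen ℚ (Sum.inr i) * T.gen ℚ (Sum.inl i)) : T ℚ (Fin g ⊕ Fin g)) :
        FreeAlgebra ℚ (Fin g ⊕ Fin g)) = ∑ i : Fin g,
      (FreeAlgebra.ι ℚ (.inl i) * FreeAlgebra.ι ℚ (.inr i) -
        FreeAlgebra.ι ℚ (.inr i) * FreeAlgebra.ι ℚ (.inl i)) :=
    map_sum (T ℚ (Fin g ⊕ Fin g)).toSubmodule.subtype _ _
  rw [h, map_sum]
  refine Finset.sum_congr rfl fun i _ => ?_
  rw [map_sub, DerT.toEnd_mul, DerT.toEnd_mul]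
  abel

/-- The tensor corresponding to a derivation under the symplectic duality. -/
noncomputable def dualTensor (D : DerT ℚ (Fin g ⊕ Fin g)) : FreeAlgebra ℚ (Fin g ⊕ Fin g) :=
  ∑ i : Fin g, (FreeAlgebra.ι ℚ (.inr i) * D.toEnd (FreeAlgebra.ι ℚ (.inl i)) -
    FreeAlgebra.ι ℚ (.inl i) * D.toEnd (FreeAlgebra.ι ℚ (.inr i)))

/-- The Leibniz rule gives D(ω₀) = rot(t) - t for the dual tensor t of D. -/
theorem mem_symp_iff {D : DerT ℚ (Fin g ⊕ Fin g)} :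
    D ∈ symp g ↔ rotateHom ℚ _ (dualTensor D) = dualTensor D := by
  have h : D ∈ symp g ↔
      ((D.1 (omega g) : T ℚ (Fin g ⊕ Fin g)) : FreeAlgebra ℚ (Fin g ⊕ Fin g)) = 0 :=
    (ZeroMemClass.coe_eq_zero (x := D.1 (omega g))).symm
  rw [h, toEnd_omega, sub_eq_zero]
  simp only [dualTensor, map_sum, map_sub, rotateHom_ι_mul]

theorem dualTensor_cyclicDer {w : List (Fin g ⊕ Fin g)} (hw : 2 ≤ w.length) :
    dualTensor (cyclicDer w) = ∑ k ∈ Finset.range w.length, word ℚ (w.rotate k) := by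
  rw [← splitSum_eq_sum_rotate, dualTensor]
  simp only [cyclicDer_toEnd_ι hw]
  have h2 : ∀ (x y : Fin g ⊕ Fin g), FreeAlgebra.ι ℚ y * cyclicContract x w =
      splitSum (fun l c r => symPair x c • word ℚ (y :: (r ++ l))) w := by
    intro x y
    have := splitSum_map (LinearMap.mulLeft ℚ (FreeAlgebra.ι ℚ y))
      (fun l c r => symPair x c • word ℚ (r ++ l)) w
    simp only [LinearMap.mulLeft_apply, mul_smul_comm, ← word_cons] at this
    exact this
  simp only [h2]
  have h3 : ∀ i : Fin g, splitSum (fun l c r => symPair (.inl i) c • word ℚ (.inr i :: (r ++ l))) w -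
      splitSum (fun l c r => symPair (.inr i) c • word ℚ (.inl i :: (r ++ l))) w =
      splitSum (fun l c r => symPair (.inl i) c • word ℚ (.inr i :: (r ++ l)) -
        symPair (.inr i) c • word ℚ (.inl i :: (r ++ l))) w := by
    intro i
    rw [sub_eq_iff_eq_add, ← splitSum_add]
    simp only [sub_add_cancel]
  simp only [h3, ← splitSum_sum]
  exact splitSum_congr fun l c r _ => sum_symPair c fun x => word ℚ (x :: (r ++ l))

theorem cyclicDer_mem_symp {w : List (Fin g ⊕ Fin g)} (hw : 2 ≤ w.length) :
    cyclicDer w ∈ symp g := by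
  rw [mem_symp_iff, dualTensor_cyclicDer hw, map_sum]
  simp only [rotateHom, wordLift_word, List.rotate_rotate]
  rw [← sub_eq_zero, ← Finset.sum_sub_distrib, Finset.sum_range_sub (fun k => word ℚ (w.rotate k)),
    List.rotate_length, List.rotate_zero, sub_self]

/-- Contraction of the first letter of a tensor. -/
noncomputable def contractFirst (x : I ⊕ I) : FreeAlgebra ℚ (I ⊕ I) →ₗ[ℚ] FreeAlgebra ℚ (I ⊕ I) :=
  wordLift ℚ fun w => match w with
    | [] => 0
    | c :: w => symPair x c • word ℚ w

theorem contractFirst_ι_mul (x c : I ⊕ I) (a : FreeAlgebra ℚ (I ⊕ I)) :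
    contractFirst x (FreeAlgebra.ι ℚ c * a) = symPair x c • a := by
  have : contractFirst x ∘ₗ LinearMap.mulLeft ℚ (FreeAlgebra.ι ℚ c) =
      LinearMap.lsmul ℚ _ (symPair x c) := ext_word fun w => by
    rw [LinearMap.comp_apply, LinearMap.mulLeft_apply, ← word_cons, contractFirst, wordLift_word]
    rfl
  exact DFunLike.congr_fun this a

/-- Nondegeneracy of the form: the dual tensor determines the derivation. -/
theorem contractFirst_dualTensor (D : DerT ℚ (Fin g ⊕ Fin g)) (x : Fin g ⊕ Fin g) :
    contractFirst x (dualTensor D) = D.toEnd (FreeAlgebra.ι ℚ x) := by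
  rw [dualTensor, map_sum, ← sum_symPair x fun y => D.toEnd (FreeAlgebra.ι ℚ y)]
  refine Finset.sum_congr rfl fun i _ => ?_
  rw [map_sub, contractFirst_ι_mul, contractFirst_ι_mul, symPair_comm x, symPair_comm x]
  simp only [neg_smul]
  abel

/-- The dual tensor of a symplectic derivation equals its cyclic average, and the average of a word
w is the dual tensor of the derivation of w divided by its length. -/
theorem mem_span_cyclicDer {D : DerT ℚ (Fin g ⊕ Fin g)} (hD : D ∈ symp g) :
    D ∈ Submodule.span ℚ {E | ∃ w : List (Fin g ⊕ Fin g), 2 ≤ w.length ∧ E = cyclicDer w} := by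
  let A : FreeAlgebra ℚ (Fin g ⊕ Fin g) →ₗ[ℚ] DerT ℚ (Fin g ⊕ Fin g) :=
    wordLift ℚ fun w => (w.length : ℚ)⁻¹ • cyclicDer w
  have ht : dualTensor D ∈ Submodule.span ℚ
      {a | ∃ w : List (Fin g ⊕ Fin g), 2 ≤ w.length ∧ a = word ℚ w} :=
    Submodule.sum_mem _ fun i _ => sub_mem (ι_mul_mem_span (D.toEnd_mem_T _))
      (ι_mul_mem_span (D.toEnd_mem_T _))
  -- On words, evaluating A at x is the cyclic average followed by contraction of the first letter.
  -- The dual tensor is its own average, and contracting it recovers D.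
  have h1 : D = A (dualTensor D) := by
    refine DerT.ext_ι fun x => ?_
    change _ = evalι x (A _)
    have h2 := ext_word_of_mem (f := evalι x ∘ₗ A) (g := contractFirst x ∘ₗ cyclicAverage)
      (P := fun w : List (Fin g ⊕ Fin g) => 2 ≤ w.length) (fun w hw => ?_) ht
    · rw [LinearMap.comp_apply, LinearMap.comp_apply,
        cyclicAverage_eq_self ht (mem_symp_iff.1 hD), contractFirst_dualTensor] at h2
      rw [h2]
    · simp only [LinearMap.comp_apply, A, cyclicAverage, wordLift_word, map_smul, map_sum]
      change _ • (cyclicDer w).toEnd _ = _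
      rw [cyclicDer_toEnd_ι hw, ← map_sum, ← splitSum_eq_sum_rotate, splitSum_map (contractFirst x)]
      simp only [word_cons, contractFirst_ι_mul]
      rfl
  rw [h1]
  have h3 : Submodule.span ℚ {a | ∃ w : List (Fin g ⊕ Fin g), 2 ≤ w.length ∧ a = word ℚ w} ≤
      (Submodule.span ℚ {E | ∃ w : List (Fin g ⊕ Fin g), 2 ≤ w.length ∧ E = cyclicDer w}).comap
        A := by
    refine Submodule.span_le.2 ?_
    rintro _ ⟨w, hw, rfl⟩
    change A (word ℚ w) ∈
      Submodule.span ℚ {E | ∃ w : List (Fin g ⊕ Fin g), 2 ≤ w.length ∧ E = cyclicDer w}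
    simp only [A, wordLift_word]
    exact Submodule.smul_mem _ _ (Submodule.subset_span ⟨w, hw, rfl⟩)
  exact h3 ht

end Symplectic

theorem splitSum_list_map {L L' M : Type*} [AddCommGroup M] (φ : L → L')
    (F : List L' → L' → List L' → M) (w : List L) :
    splitSum F (w.map φ) = splitSum (fun l c r => F (l.map φ) (φ c) (r.map φ)) w := by
  induction w generalizing F with
  | nil => rfl
  | cons c w ih => rw [List.map_cons, splitSum, splitSum, ih]; rfl

section

variable {I J : Type*} [DecidableEq I] [DecidableEq J]

theorem symPair_map {φ : I → J} (hφ : Function.Injective φ) (x y : I ⊕ I) :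
    symPair (Sum.map φ φ x) (Sum.map φ φ y) = symPair x y := by
  rcases x with x | x <;> rcases y with y | y <;> simp [symPair, hφ.eq_iff]

/-- A new generator pairs to zero with every letter of an old word, so extension by zero merely
relabels the cyclic word. -/
theorem cyclicDer_extend {φ : I → J} (hφ : Function.Injective φ) {w : List (I ⊕ I)}
    (hw : 2 ≤ w.length) :
    (cyclicDer w).extend (Sum.map φ φ) = cyclicDer (w.map (Sum.map φ φ)) := by
  have hinj : Function.Injective (Sum.map φ φ) := hφ.sumMap hφ
  refine DerT.ext_ι fun y => ?_
  rw [cyclicDer_toEnd_ι (by simpa using hw), cyclicContract, splitSum_list_map]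
  by_cases hy : ∃ x, Sum.map φ φ x = y
  · obtain ⟨x, rfl⟩ := hy
    rw [DerT.toEnd_ι, DerT.extend_gen hinj]
    change FreeAlgebra.lift ℚ (FreeAlgebra.ι ℚ ∘ Sum.map φ φ) ((cyclicDer w).1 (T.gen ℚ x) :
      FreeAlgebra ℚ (I ⊕ I)) = _
    rw [← DerT.toEnd_ι, cyclicDer_toEnd_ι hw, cyclicContract,
      splitSum_map (FreeAlgebra.lift ℚ (FreeAlgebra.ι ℚ ∘ Sum.map φ φ))]
    simp only [map_smul, map_word, symPair_map hφ, List.map_append]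
  · rw [DerT.toEnd_ι, DerT.extend_gen_of_notMem _ hy]
    symm
    refine splitSum_eq_zero fun l c r _ => ?_
    have : symPair y (Sum.map φ φ c) = 0 := by
      rcases y with y | y <;> rcases c with c | c <;> simp only [symPair, Sum.map_inl, Sum.map_inr]
      all_goals
        refine if_neg ?_
        rintro rfl
      · exact hy ⟨.inl c, rfl⟩
      · exact hy ⟨.inr c, rfl⟩
    rw [this, zero_smul]

end

/-! ### Classes of cyclic words in the stable abelianization. -/

/-- The symplectic derivation given by a cyclic word (zero for words of length less than two). -/
noncomputable def sympCyclic {g : ℕ} (w : List (Fin g ⊕ Fin g)) : symp g :=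
  if h : 2 ≤ w.length then ⟨cyclicDer w, cyclicDer_mem_symp h⟩ else 0

variable {g : ℕ}

theorem sympCyclic_coe {w : List (Fin g ⊕ Fin g)} (hw : 2 ≤ w.length) :
    (sympCyclic w : symp g).1 = cyclicDer w := by
  rw [sympCyclic, dif_pos hw]

theorem sympCyclic_append_comm (u v : List (Fin g ⊕ Fin g)) :
    sympCyclic (u ++ v) = sympCyclic (v ++ u) := by
  simp only [sympCyclic, List.length_append, add_comm u.length, cyclicDer_append_comm u v]

theorem span_sympCyclic : Submodule.span ℚ {D : symp g | ∃ w : List (Fin g ⊕ Fin g),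
    2 ≤ w.length ∧ D = sympCyclic w} = ⊤ := by
  refine Submodule.eq_top_iff'.2 fun D => ?_
  have h : Submodule.span ℚ {E | ∃ w : List (Fin g ⊕ Fin g), 2 ≤ w.length ∧ E = cyclicDer w} ≤
      (Submodule.span ℚ {D : symp g | ∃ w : List (Fin g ⊕ Fin g),
        2 ≤ w.length ∧ D = sympCyclic w}).map (symp g).toSubmodule.subtype := by
    refine Submodule.span_le.2 ?_
    rintro _ ⟨w, hw, rfl⟩
    exact ⟨sympCyclic w, Submodule.subset_span ⟨w, hw, rfl⟩, sympCyclic_coe hw⟩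
  obtain ⟨E, hE, hED⟩ := h (mem_span_cyclicDer D.2)
  rwa [← (Subtype.ext hED : E = D)]

theorem sympStab_sympCyclic {h : ℕ} (hgh : g ≤ h) (w : List (Fin g ⊕ Fin g)) :
    sympStab hgh (sympCyclic w) = sympCyclic (w.map (sympIncl hgh)) := by
  by_cases hw : 2 ≤ w.length
  · refine Subtype.ext ?_
    rw [sympCyclic_coe (by simpa using hw)]
    change (sympCyclic w : symp g).1.extend (sympIncl hgh) = _
    rw [sympCyclic_coe hw]
    exact cyclicDer_extend (Fin.castLE_injective hgh) hw
  · rw [sympCyclic, dif_neg hw, map_zero, sympCyclic, dif_neg (by simpa using hw)]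

theorem lie_sympCyclic {u v : List (Fin g ⊕ Fin g)} (hu : 2 ≤ u.length) (hv : 2 ≤ v.length) :
    (⁅sympCyclic u, sympCyclic v⁆ : symp g) =
      -splitSum (fun (l : List (Fin g ⊕ Fin g)) e (r : List (Fin g ⊕ Fin g)) =>
        splitSum (fun (l' : List (Fin g ⊕ Fin g)) c (r' : List (Fin g ⊕ Fin g)) =>
          symPair e c • sympCyclic ((r ++ l) ++ (r' ++ l'))) v) u := by
  refine Subtype.ext ?_
  change ⁅(sympCyclic u : symp g).1, (sympCyclic v : symp g).1⁆ =
    (symp g).toSubmodule.subtype (-splitSum _ u)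
  rw [sympCyclic_coe hu, sympCyclic_coe hv, lie_cyclicDer hu hv, map_neg,
    splitSum_map (symp g).toSubmodule.subtype]
  congr 1
  refine splitSum_congr fun l e r h => ?_
  rw [splitSum_map (symp g).toSubmodule.subtype]
  refine splitSum_congr fun l' c r' h' => ?_
  have h3 : 2 ≤ ((r ++ l) ++ (r' ++ l')).length := by
    subst h h'
    simp at hu hv ⊢
    omega
  rw [map_smul, ← sympCyclic_coe h3]
  rfl

/-- The class of a symplectic derivation in the stable abelianization. -/
noncomputable def stableClass (g : ℕ) : symp g →ₗ[ℚ] stableA :=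
  Module.DirectLimit.of ℚ ℕ _ stabA g ∘ₗ H1.mkHom ℚ (symp g)

theorem stableClass_sympStab {h : ℕ} (hgh : g ≤ h) (D : symp g) :
    stableClass h (sympStab hgh D) = stableClass g D :=
  Module.DirectLimit.of_f (f := stabA) (hij := hgh) (x := H1.mk ℚ D)

theorem stableClass_lie (D E : symp g) : stableClass g ⁅D, E⁆ = 0 := by
  rw [stableClass, LinearMap.comp_apply, H1.mkHom_apply, H1.mk_lie, map_zero]

/-- The generators indexed by `0, …, n` as a quotient of all letters. -/
def truncLetter (n : ℕ) (x : Letter) : Fin (n + 1) ⊕ Fin (n + 1) :=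
  if x.2 then .inr (Fin.ofNat (n + 1) x.1) else .inl (Fin.ofNat (n + 1) x.1)

theorem ofNat_inj {n i j : ℕ} (hi : i ≤ n) (hj : j ≤ n) :
    Fin.ofNat (n + 1) i = Fin.ofNat (n + 1) j ↔ i = j := by
  rw [Fin.ext_iff]
  simp only [Fin.ofNat]
  rw [Nat.mod_eq_of_lt (by omega), Nat.mod_eq_of_lt (by omega)]

/-- Truncation reduces indices modulo n + 1, so the bounds are what keeps distinct indices apart. -/
theorem symPair_truncLetter {n : ℕ} {x y : Letter} (hx : x.1 ≤ n) (hy : y.1 ≤ n) :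
    symPair (truncLetter n x) (truncLetter n y) = omegaCoeff x y := by
  obtain ⟨i, a⟩ := x
  obtain ⟨j, b⟩ := y
  have h := ofNat_inj hx hy
  dsimp only at h
  simp only [truncLetter]
  generalize Fin.ofNat (n + 1) i = p at h ⊢
  generalize Fin.ofNat (n + 1) j = q at h ⊢
  cases a <;> cases b <;>
    simp [ symPair, omegaCoeff, bar, h, Prod.ext_iff, eq_comm (a := j)]

theorem sympIncl_truncLetter {m n : ℕ} (h : m ≤ n) {x : Letter} (hx : x.1 ≤ m) :
    sympIncl (Nat.succ_le_succ h) (truncLetter m x) = truncLetter n x := by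
  obtain ⟨i, a⟩ := x
  have : Fin.castLE (Nat.succ_le_succ h) (Fin.ofNat (m + 1) i) = Fin.ofNat (n + 1) i := by
    rw [Fin.ext_iff]
    simp only [Fin.ofNat, Fin.val_castLE]
    rw [Nat.mod_eq_of_lt (by simp at hx; omega), Nat.mod_eq_of_lt (by simp at hx; omega)]
  cases a
  · exact congrArg Sum.inl this
  · exact congrArg Sum.inr this

/-- The class of the derivation given by a cyclic word, for all sufficiently large genera. -/
noncomputable def stableWord (w : List Letter) : stableA :=
  stableClass (w.toFinset.sup Prod.fst + 1)
    (sympCyclic (w.map (truncLetter (w.toFinset.sup Prod.fst))))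

/-- Stabilization relabels cyclic words, so any genus large enough to contain the letters gives the
same class. -/
theorem stableWord_eq {w : List Letter} {n : ℕ} (h : ∀ x ∈ w, x.1 ≤ n) :
    stableWord w = stableClass (n + 1) (sympCyclic (w.map (truncLetter n))) := by
  have hle : w.toFinset.sup Prod.fst ≤ n := Finset.sup_le fun x hx => h x (List.mem_toFinset.1 hx)
  rw [stableWord, ← stableClass_sympStab (Nat.succ_le_succ hle), sympStab_sympCyclic, List.map_map]
  congr 2
  refine List.map_congr_left fun x hx => ?_
  exact sympIncl_truncLetter hle (Finset.le_sup (f := Prod.fst) (List.mem_toFinset.2 hx))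

theorem splitSum_stableWord {u v : List Letter} (hu : 2 ≤ u.length) (hv : 2 ≤ v.length) :
    splitSum (fun l e r => splitSum (fun l' c r' =>
      omegaCoeff e c • stableWord ((r ++ l) ++ (r' ++ l'))) v) u = 0 := by
  obtain ⟨n, hn⟩ : ∃ n, ∀ x ∈ u ++ v, x.1 ≤ n :=
    ⟨(u ++ v).toFinset.sup Prod.fst, fun x hx =>
      Finset.le_sup (f := Prod.fst) (List.mem_toFinset.2 hx)⟩
  have h := stableClass_lie (sympCyclic (u.map (truncLetter n))) (sympCyclic (v.map (truncLetter n)))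
  rw [lie_sympCyclic (by simpa using hu) (by simpa using hv), map_neg, neg_eq_zero,
    splitSum_map (stableClass (n + 1)), splitSum_list_map] at h
  rw [← h]
  refine splitSum_congr fun l e r h1 => ?_
  rw [splitSum_map (stableClass (n + 1)), splitSum_list_map]
  refine splitSum_congr fun l' c r' h2 => ?_
  subst h1 h2
  rw [map_smul, symPair_truncLetter (hn e (by simp)) (hn c (by simp)), stableWord_eq (n := n)]
  · simp only [List.map_append]
  · intro x hx
    refine hn x ?_
    simp only [List.mem_append, List.mem_cons] at hx ⊢
    tauto

/-- The relation is the bracket of the cyclic words e U and ē V. Nonemptiness of U and V makes both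
of length at least two, so both define derivations. -/
theorem killsBrackets_stableWord : KillsBrackets stableWord where
  rot u v := by
    have hn : ∀ x ∈ u ++ v, x.1 ≤ (u ++ v).toFinset.sup Prod.fst := fun x hx =>
      Finset.le_sup (f := Prod.fst) (List.mem_toFinset.2 hx)
    rw [stableWord_eq hn, stableWord_eq (w := v ++ u) fun x hx => hn x (by
      simp only [List.mem_append] at hx ⊢; tauto), List.map_append, List.map_append,
      sympCyclic_append_comm]
  rel U V e hU hV he := by
    have hU' := List.length_pos_iff.2 hU
    have hV' := List.length_pos_iff.2 hV
    have h := splitSum_stableWord (u := (e, false) :: U) (v := (e, true) :: V)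
      (by simp; omega) (by simp; omega)
    have h0 : ∀ c : Letter, c ∈ U ++ V → ∀ b, omegaCoeff (e, b) c = 0 ∧ omegaCoeff c (e, b) = 0 :=
      fun c hc b => ⟨omegaCoeff_of_ne fun h => he c hc (by rw [h]; rfl),
        omegaCoeff_of_ne fun h => he c hc (congrArg Prod.fst h).symm⟩
    rw [splitSum, splitSum] at h
    simp only [splitSum, List.append_nil] at h
    -- Since e is fresh, it contracts only with ē, which glues U to V with coefficient 1; all other
    -- terms contract U with V.
    rw [splitSum_eq_zero (w := V), add_zero] at h
    · rw [show omegaCoeff (e, false) (e, true) = 1 from omegaCoeff_bar (e, false), one_smul] at h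
      refine Eq.trans ?_ h
      congr 1
      refine splitSum_congr fun l c r hc => ?_
      rw [(h0 c (by rw [hc]; simp) true).2, zero_smul, zero_add]
    · intro l c r hc
      rw [(h0 c (by rw [hc]; simp) false).1, zero_smul]

theorem subsingleton_stableA : Subsingleton stableA := by
  refine ⟨fun a b => ?_⟩
  have key : ∀ a : stableA, a = 0 := by
    intro a
    obtain ⟨g, z, rfl⟩ := Module.DirectLimit.exists_of a
    obtain ⟨D, rfl⟩ := H1.mk_surjective z
    change stableClass g D = 0
    have hD : D ∈ Submodule.span ℚ {D : symp g | ∃ w : List (Fin g ⊕ Fin g),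
        2 ≤ w.length ∧ D = sympCyclic w} := by
      rw [span_sympCyclic]; trivial
    refine (Submodule.span_le.2 ?_ : _ ≤ LinearMap.ker (stableClass g)) hD
    rintro _ ⟨w, hw, rfl⟩
    change stableClass g (sympCyclic w) = 0
    -- One stabilization brings the genus to the form n + 1 on which `truncLetter` is defined,
    -- including g = 0.
    rw [← stableClass_sympStab (Nat.le_succ g), sympStab_sympCyclic]
    let toLetter : Fin g ⊕ Fin g → Letter := Sum.elim (fun i => (i, false)) (fun i => (i, true))
    have h : w.map (sympIncl (Nat.le_succ g)) = (w.map toLetter).map (truncLetter g) := by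
      rw [List.map_map]
      refine List.map_congr_left fun x _ => ?_
      rcases x with i | i <;>
        simp [toLetter, truncLetter, sympIncl, Fin.ext_iff]
    rw [h, ← stableWord_eq, killsBrackets_stableWord.eq_zero _ (by simpa using hw)]
    intro x hx
    obtain ⟨y, -, rfl⟩ := List.mem_map.1 hx
    rcases y with i | i <;> simp [toLetter, i.2.le]
  rw [key a, key b]


/-! ### Coefficients of short words. -/

section Coefficients

variable {R X : Type*} [CommRing R]

theorem eq_zero_of_wordCoeff {a : FreeAlgebra R X} (h : ∀ w, wordCoeff R w a = 0) : a = 0 := by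
  refine FreeAlgebra.equivMonoidAlgebraFreeMonoid.injective ?_
  rw [map_zero]
  refine MonoidAlgebra.coeff_injective (Finsupp.ext fun w => ?_)
  exact h w.toList

theorem wordCoeff_of_mem_wordDeg {i : ℕ} {a : FreeAlgebra R X} (ha : a ∈ wordDeg R X i)
    {w : List X} (hw : w.length ≠ i) : wordCoeff R w a = 0 := by
  classical
  rw [wordDeg_eq_span] at ha
  refine ext_word_of_mem (g := 0) (P := fun w : List X => w.length = i) (fun v hv => ?_) ha
  rw [wordCoeff_word, if_neg (by rintro rfl; exact hw hv), LinearMap.zero_apply]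

theorem wordCoeff_pair_ι_mul [DecidableEq X] (x y z : X) (a : FreeAlgebra R X) :
    wordCoeff R [x, y] (FreeAlgebra.ι R z * a) = if x = z then linCoeff y a else 0 := by
  have : wordCoeff R [x, y] ∘ₗ LinearMap.mulLeft R (FreeAlgebra.ι R z) =
      if x = z then wordCoeff R [y] else 0 := ext_word fun w => by
    rw [LinearMap.comp_apply, LinearMap.mulLeft_apply, ← word_cons, wordCoeff_word]
    split_ifs with h1 h2 h2
    · rw [wordCoeff_word, if_pos (List.cons.inj h1).2]
    · exact absurd (List.cons.inj h1).1.symm h2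
    · rw [wordCoeff_word, if_neg fun h => h1 (by rw [h, h2])]
    · rfl
  have h := DFunLike.congr_fun this a
  split_ifs at h ⊢ <;> exact h

theorem wordCoeff_pair_mul_ι [DecidableEq X] (x y z : X) (a : FreeAlgebra R X) :
    wordCoeff R [x, y] (a * FreeAlgebra.ι R z) = if y = z then linCoeff x a else 0 := by
  have : wordCoeff R [x, y] ∘ₗ LinearMap.mulRight R (FreeAlgebra.ι R z) =
      if y = z then wordCoeff R [x] else 0 := ext_word fun w => by
    rw [LinearMap.comp_apply, LinearMap.mulRight_apply, ← word_singleton, ← word_append,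
      wordCoeff_word]
    have h0 : w ++ [z] = [x, y] ↔ w = [x] ∧ z = y := by
      rw [show [x, y] = [x] ++ [y] from rfl]
      constructor
      · intro h
        have := List.append_inj' h rfl
        simpa using this
      · rintro ⟨rfl, rfl⟩; rfl
    simp only [h0]
    by_cases h : y = z
    · simp [h, wordCoeff_word]
    · simp [h, Ne.symm h]
  have h := DFunLike.congr_fun this a
  split_ifs at h ⊢ <;> exact h

theorem eq_zero_of_mem_wordDeg_one {a : FreeAlgebra R X} (ha : a ∈ wordDeg R X 1)
    (h : ∀ x, linCoeff x a = 0) : a = 0 := by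
  refine eq_zero_of_wordCoeff fun w => ?_
  by_cases hw : w.length = 1
  · obtain ⟨x, rfl⟩ := List.length_eq_one_iff.1 hw
    exact h x
  · exact wordCoeff_of_mem_wordDeg ha hw

theorem linCoeff_of_mem_geTwo {a : FreeAlgebra R X} (ha : a ∈ wordDegGeTwo R X) (x : X) :
    linCoeff x a = 0 := by
  have h : wordDegGeTwo R X ≤ LinearMap.ker (wordCoeff R [x]) :=
    iSup₂_le fun i hi a ha => wordCoeff_of_mem_wordDeg ha (by simp; omega)
  exact h ha

end Coefficients

/-! ### The degree zero part and the symplectic Lie algebra. -/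

section Matrices

variable {g : ℕ}

/-- The coefficient matrix of ω₀ is -J, and the linear part A of D acts on both tensor factors,
giving -(A J + J Aᵀ). -/
theorem wordCoeff_omega (D : DerT ℚ (Fin g ⊕ Fin g)) (x y : Fin g ⊕ Fin g) :
    wordCoeff ℚ [x, y] ((D.1 (omega g) : T ℚ (Fin g ⊕ Fin g)) : FreeAlgebra ℚ (Fin g ⊕ Fin g)) =
      -(D.mat * Matrix.J (Fin g) ℚ + Matrix.J (Fin g) ℚ * D.mat.transpose) x y := by
  have hm : ∀ i j, linCoeff i (D.toEnd (FreeAlgebra.ι ℚ j)) = D.mat i j := fun i j => by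
    rw [DerT.toEnd_ι]; rfl
  rw [toEnd_omega, map_sub, map_sum, map_sum]
  simp only [map_sub, wordCoeff_pair_ι_mul, wordCoeff_pair_mul_ι, hm]
  have h1 : ∑ i : Fin g, ((if y = .inr i then D.mat x (.inl i) else 0) -
      if y = .inl i then D.mat x (.inr i) else 0) = -(D.mat * Matrix.J (Fin g) ℚ) x y := by
    rw [Matrix.mul_apply, Fintype.sum_sum_type]
    rcases y with y | y <;>
      simp [Matrix.J, Matrix.fromBlocks, Matrix.one_apply, Finset.sum_ite_eq]
  have h2 : ∑ i : Fin g, ((if x = .inr i then D.mat y (.inl i) else 0) -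
      if x = .inl i then D.mat y (.inr i) else 0) =
        (Matrix.J (Fin g) ℚ * D.mat.transpose) x y := by
    rw [Matrix.mul_apply, Fintype.sum_sum_type]
    rcases x with x | x <;>
      simp [Matrix.J, Matrix.fromBlocks, Matrix.one_apply, Finset.sum_ite_eq]
  rw [h1, h2, Matrix.add_apply]
  ring

/-- Mathlib's `sp` preserves a bilinear form, Aᵀ J = -J A, whereas killing ω₀ is the dual condition
on a bivector. Multiplying by J on both sides and using J² = -1 exchanges the two. -/
theorem mem_sp_iff {A : Matrix (Fin g ⊕ Fin g) (Fin g ⊕ Fin g) ℚ} :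
    A ∈ LieAlgebra.Symplectic.sp (Fin g) ℚ ↔
      A * Matrix.J (Fin g) ℚ + Matrix.J (Fin g) ℚ * A.transpose = 0 := by
  have h : A ∈ LieAlgebra.Symplectic.sp (Fin g) ℚ ↔
      A.transpose * Matrix.J (Fin g) ℚ = Matrix.J (Fin g) ℚ * -A := by
    rw [LieAlgebra.Symplectic.sp, mem_skewAdjointMatricesLieSubalgebra,
      mem_skewAdjointMatricesSubmodule]
    rfl
  rw [h]
  have hJ := Matrix.J_squared (Fin g) ℚ
  set J := Matrix.J (Fin g) ℚ
  have hJ' : ∀ B : Matrix (Fin g ⊕ Fin g) (Fin g ⊕ Fin g) ℚ, J * (J * B) = -B := fun B => by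
    rw [← mul_assoc, hJ, neg_one_mul]
  constructor
  · intro h
    have h1 := congrArg (fun B => J * B * J) h
    simp only [mul_neg, neg_mul, mul_assoc, hJ, hJ', mul_one] at h1
    rw [neg_neg, neg_eq_iff_eq_neg] at h1
    rw [h1, add_neg_cancel]
  · intro h
    have h1 := congrArg (fun B => J * B * J) h
    simp only [mul_add, add_mul, mul_neg, neg_mul, mul_assoc, hJ, hJ', mul_one, mul_zero,
      zero_mul] at h1
    rw [mul_neg, ← sub_eq_zero, ← neg_eq_zero, ← h1]
    abel

theorem mat_mem_sp (D : symp g) : D.1.mat ∈ LieAlgebra.Symplectic.sp (Fin g) ℚ := by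
  rw [mem_sp_iff]
  ext x y
  have h := wordCoeff_omega D.1 x y
  rw [show D.1.1 (omega g) = 0 from D.2] at h
  exact neg_eq_zero.1 (h.symm.trans (map_zero (wordCoeff ℚ [x, y])))

theorem mem_symp_of_mat {D : DerT ℚ (Fin g ⊕ Fin g)} (hD : D ∈ DerT.deg ℚ (Fin g ⊕ Fin g) 0)
    (h : D.mat ∈ LieAlgebra.Symplectic.sp (Fin g) ℚ) : D ∈ symp g := by
  change D.1 (omega g) = 0
  refine Subtype.ext (eq_zero_of_wordCoeff fun w => ?_)
  by_cases hw : w.length = 2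
  · obtain ⟨x, y, rfl⟩ := List.length_eq_two.1 hw
    rw [wordCoeff_omega, mem_sp_iff.1 h]
    simp
  -- A derivation of degree zero sends ω₀ to an element of degree two, so no other words can occur.
  · refine wordCoeff_of_mem_wordDeg (i := 2) ?_ hw
    rw [toEnd_omega]
    have h1 : ∀ x, FreeAlgebra.ι ℚ x ∈ wordDeg ℚ (Fin g ⊕ Fin g) 1 := fun x => by
      rw [← word_singleton]; exact word_mem_wordDeg rfl
    have h2 := DerT.mem_deg.1 hD
    have h3 : ∀ {a b : FreeAlgebra ℚ (Fin g ⊕ Fin g)}, a ∈ wordDeg ℚ (Fin g ⊕ Fin g) 1 →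
        b ∈ wordDeg ℚ (Fin g ⊕ Fin g) 1 → a * b ∈ wordDeg ℚ (Fin g ⊕ Fin g) 2 := by
      intro a b ha hb
      have : wordDeg ℚ (Fin g ⊕ Fin g) 2 = wordDeg ℚ (Fin g ⊕ Fin g) 1 *
          wordDeg ℚ (Fin g ⊕ Fin g) 1 := by rw [wordDeg, wordDeg, ← pow_add]
      rw [this]
      exact Submodule.mul_mem_mul ha hb
    exact sub_mem
      (Submodule.sum_mem _ fun i _ => sub_mem (h3 (h2 _) (h1 _)) (h3 (h2 _) (h1 _)))
      (Submodule.sum_mem _ fun i _ => sub_mem (h3 (h1 _) (h2 _)) (h3 (h1 _) (h2 _)))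

theorem eq_zero_of_mat {D : DerT ℚ (Fin g ⊕ Fin g)} (hD : D ∈ DerT.deg ℚ (Fin g ⊕ Fin g) 0)
    (h : D.mat = 0) : D = 0 := by
  refine DerT.ext_ι fun x => ?_
  rw [DerT.toEnd_zero_ι]
  refine eq_zero_of_mem_wordDeg_one (DerT.mem_deg.1 hD x) fun y => ?_
  rw [DerT.toEnd_ι]
  exact congrFun (congrFun h y) x

/-- The Lie algebra homomorphism sending a derivation of degree zero to its matrix. -/
noncomputable def sympZeroToSp (g : ℕ) : sympZero g →ₗ⁅ℚ⁆ LieAlgebra.Symplectic.sp (Fin g) ℚ where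
  toFun D := ⟨D.1.1.mat, mat_mem_sp D.1⟩
  map_add' _ _ := Subtype.ext (Matrix.ext fun i _ => (wordCoeff ℚ [i]).map_add _ _)
  map_smul' _ _ := Subtype.ext (Matrix.ext fun i _ => (wordCoeff ℚ [i]).map_smul _ _)
  map_lie' {D E} := Subtype.ext (DerT.mat_lie D.1.1 E.1.1)

theorem sympZeroToSp_bijective (g : ℕ) : Function.Bijective (sympZeroToSp g) := by
  constructor
  · refine (injective_iff_map_eq_zero (sympZeroToSp g)).2 fun D hD => ?_
    exact Subtype.ext (Subtype.ext (eq_zero_of_mat D.2 (congrArg Subtype.val hD)))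
  · intro A
    let D : DerT ℚ (Fin g ⊕ Fin g) := DerT.ofVal fun j => ∑ i, A.1 i j • FreeAlgebra.ι ℚ i
    have hι : ∀ j, D.toEnd (FreeAlgebra.ι ℚ j) = ∑ i, A.1 i j • FreeAlgebra.ι ℚ i := fun j =>
      DerT.toEnd_ofVal (Submodule.sum_mem (T ℚ _).toSubmodule fun i _ =>
        Submodule.smul_mem _ _ (ι_mem_T i))
    have hdeg : D ∈ DerT.deg ℚ (Fin g ⊕ Fin g) 0 := by
      refine DerT.mem_deg.2 fun j => ?_
      rw [hι]
      refine Submodule.sum_mem _ fun i _ => Submodule.smul_mem _ _ ?_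
      rw [← word_singleton]
      exact word_mem_wordDeg rfl
    have hmat : D.mat = A.1 := by
      ext i j
      have : D.mat i j = wordCoeff ℚ [i] (D.toEnd (FreeAlgebra.ι ℚ j)) := by
        rw [DerT.toEnd_ι]; rfl
      rw [this, hι, map_sum]
      simp only [map_smul, ← linCoeff_eq, linCoeff_ι]
      simp
    exact ⟨⟨⟨D, mem_symp_of_mat hdeg (hmat ▸ A.2)⟩, hdeg⟩, Subtype.ext hmat⟩

theorem isCompl_sympZero_sympPlus (g : ℕ) :
    IsCompl (sympZero g).toSubmodule (sympPlus g).toSubmodule := by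
  constructor
  · rw [Submodule.disjoint_def]
    intro D h0 h1
    refine Subtype.ext (eq_zero_of_mat h0 (Matrix.ext fun i j => ?_))
    exact linCoeff_of_mem_geTwo (h1 j) i
  -- The spanning cyclic words are homogeneous: those of length two have degree zero, the longer
  -- ones positive degree.
  · rw [codisjoint_iff, eq_top_iff, ← span_sympCyclic, Submodule.span_le]
    rintro _ ⟨w, hw, rfl⟩
    obtain ⟨k, hk⟩ := Nat.exists_eq_add_of_le' hw
    have hdeg := cyclicDer_mem_deg hk
    rw [← sympCyclic_coe hw] at hdeg
    rcases Nat.eq_zero_or_pos k with rfl | hpos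
    · exact Submodule.mem_sup_left hdeg
    · refine Submodule.mem_sup_right fun x => ?_
      exact (le_iSup₂_of_le (f := fun i (_ : i ≥ 2) => wordDeg ℚ (Fin g ⊕ Fin g) i) (k + 1)
        (by omega) le_rfl) (hdeg x)

end Matrices

/-! ### Abelianization of a semidirect product. -/

section SemidirectProduct

variable {R L K : Type*} [CommRing R] [LieRing L] [LieAlgebra R L] [LieRing K] [LieAlgebra R K]

/-- The abelianization of the semidirect product of an ideal `I` and a subalgebra `S`. -/
theorem exists_H1_equiv_of_isCompl {I : LieIdeal R L} {S : LieSubalgebra R L}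
    (h : IsCompl S.toSubmodule I.toSubmodule) (φ : S ≃ₗ⁅R⁆ K) :
    ∃ e : H1 R L ≃ₗ[R] H1coinv R I S × H1 R K,
      (∀ x : I, e (H1.mk R (x : L)) = (Submodule.Quotient.mk (H1.mk R x), 0)) ∧
      ∀ s : S, e (H1.mk R (s : L)) = (0, H1.mk R (φ s)) := by
  let p : (S × I) ≃ₗ[R] L := Submodule.prodEquivOfIsCompl S.toSubmodule I.toSubmodule h
  have hp : ∀ (s : S) (x : I), p (s, x) = (s : L) + (x : L) := fun s x =>
    Submodule.coe_prodEquivOfIsCompl' _ _ h (s, x)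
  let F : L →ₗ[R] H1coinv R I S × H1 R K :=
    (LinearMap.prodMap (Submodule.mkQ _ ∘ₗ H1.mkHom R I)
      (H1.mkHom R K ∘ₗ (φ : S →ₗ[R] K))) ∘ₗ (LinearEquiv.prodComm R S I).toLinearMap ∘ₗ
        p.symm.toLinearMap
  have hF : ∀ (s : S) (x : I),
      F ((s : L) + (x : L)) = (Submodule.Quotient.mk (H1.mk R x), H1.mk R (φ s)) := by
    intro s x
    rw [← hp]
    simp only [F, LinearMap.comp_apply, LinearEquiv.coe_coe, LinearEquiv.symm_apply_apply]
    rfl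
  have hker : bracketSpan R (⊤ : Submodule R L) ⊤ ≤ LinearMap.ker F := by
    refine bracketSpan_le.2 fun x _ y _ => ?_
    obtain ⟨⟨s, a⟩, rfl⟩ := p.surjective x
    obtain ⟨⟨t, b⟩, rfl⟩ := p.surjective y
    let u : I := ⟨⁅(s : L), (b : L)⁆, I.lie_mem b.2⟩
    let v : I := ⟨⁅(t : L), (a : L)⁆, I.lie_mem a.2⟩
    -- The component of a bracket in the ideal consists of two action terms, which die in the
    -- coinvariants, and a bracket inside the ideal.
    have h1 : ⁅p (s, a), p (t, b)⁆ = ((⁅s, t⁆ : S) : L) + ((u - v + ⁅a, b⁆ : I) : L) := by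
      rw [hp, hp]
      change _ = ⁅(s : L), (t : L)⁆ + (⁅(s : L), (b : L)⁆ - ⁅(t : L), (a : L)⁆ + ⁅(a : L), (b : L)⁆)
      rw [add_lie, lie_add, lie_add, ← lie_skew (a : L) (t : L)]
      abel
    have hu : ∀ (s : S) (b : I), (Submodule.Quotient.mk
        (H1.mk R (⟨⁅(s : L), (b : L)⁆, I.lie_mem b.2⟩ : I)) : H1coinv R I S) = 0 := fun s b =>
      (Submodule.Quotient.mk_eq_zero _).2 (Submodule.subset_span ⟨s, s.2, b, rfl⟩)
    have h2 : H1.mk R (u - v + ⁅a, b⁆ : I) = H1.mk R u - H1.mk R v := by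
      rw [← H1.mkHom_apply, map_add, map_sub, H1.mkHom_apply, H1.mkHom_apply, H1.mkHom_apply,
        H1.mk_lie, add_zero]
    rw [LinearMap.mem_ker, h1, hF, h2, Submodule.Quotient.mk_sub, hu, hu, sub_zero,
      LieEquiv.map_lie, H1.mk_lie]
    rfl
  let f : H1 R L →ₗ[R] H1coinv R I S × H1 R K := Submodule.liftQ _ F hker
  have hf : ∀ x, f (H1.mk R x) = F x := fun x => rfl
  -- The inclusions of the ideal and of the subalgebra induce maps back, which together form a left
  -- inverse and give injectivity.
  let G1 : H1coinv R I S →ₗ[R] H1 R L := Submodule.liftQ _ (H1.map R I.incl) (by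
    refine Submodule.span_le.2 ?_
    rintro _ ⟨s, hs, x, rfl⟩
    exact H1.mk_lie s (x : L))
  let G2 : H1 R K →ₗ[R] H1 R L := H1.map R (S.incl.comp (φ.symm : K →ₗ⁅R⁆ S))
  have hG : ∀ x : L, G1 (F x).1 + G2 (F x).2 = H1.mk R x := by
    intro x
    obtain ⟨⟨s, a⟩, rfl⟩ := p.surjective x
    rw [hp, hF]
    change H1.mk R (a : L) + H1.mk R ((φ.symm (φ s) : S) : L) = _
    rw [LieEquiv.symm_apply_apply, add_comm, ← H1.mkHom_apply, ← H1.mkHom_apply, ← map_add]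
    rfl
  refine ⟨LinearEquiv.ofBijective f ⟨?_, ?_⟩, fun x => ?_, fun s => ?_⟩
  · refine (injective_iff_map_eq_zero f).2 fun z hz => ?_
    obtain ⟨x, rfl⟩ := H1.mk_surjective z
    rw [hf] at hz
    rw [← hG, hz, Prod.fst_zero, Prod.snd_zero, map_zero, map_zero, add_zero]
  · rintro ⟨y, z⟩
    obtain ⟨y, rfl⟩ := Submodule.Quotient.mk_surjective _ y
    obtain ⟨x, rfl⟩ := H1.mk_surjective y
    obtain ⟨k, rfl⟩ := H1.mk_surjective z
    refine ⟨H1.mk R ((φ.symm k : S) + (x : L)), ?_⟩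
    rw [hf, hF, LieEquiv.apply_symm_apply]
  · have := hF 0 x
    rw [ZeroMemClass.coe_zero, zero_add, map_zero] at this
    exact this
  · have := hF s 0
    rw [ZeroMemClass.coe_zero, add_zero] at this
    exact this

end SemidirectProduct
end StableAb

/-! ### The theorem. -/

theorem theorem1p1 :
    -- derivations of the free associative algebra without constant terms
    ((∃ e : stableT ≃ₗ[ℤ] ℤ, ∀ (n : ℕ) (D : DerT ℤ (Fin n)),
        e (Module.DirectLimit.of ℤ ℕ _ stabT n (H1.mk ℤ D)) = D.mat.trace) ∧
      (∀ n : ℕ, 2 ≤ n → ∃ e : H1wt ℤ (DerT.deg ℤ (Fin n)) 0 ≃ₗ[ℤ] ℤ,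
        ∀ D : DerT.deg ℤ (Fin n) 0, e (Submodule.Quotient.mk D) = D.1.mat.trace) ∧
      (∀ n : ℕ, 2 ≤ n → Subsingleton (H1wt ℤ (DerT.deg ℤ (Fin n)) 1)) ∧
      (∀ n k : ℕ, 2 ≤ k → k ≤ n → Subsingleton (H1wt ℤ (DerT.deg ℤ (Fin n)) k))) ∧
    -- derivations of the free Lie algebra
    ((∃ e : stableL ≃ₗ[ℤ] ℤ, ∀ (n : ℕ) (D : DerL ℤ (Fin n)),
        e (Module.DirectLimit.of ℤ ℕ _ stabL n (H1.mk ℤ D)) = D.mat.trace) ∧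
      (∀ n : ℕ, 2 ≤ n → ∃ e : H1wt ℤ (DerL.deg ℤ (Fin n)) 0 ≃ₗ[ℤ] ℤ,
        ∀ D : DerL.deg ℤ (Fin n) 0, e (Submodule.Quotient.mk D) = D.1.mat.trace) ∧
      (∀ n : ℕ, 2 ≤ n → Subsingleton (H1wt ℤ (DerL.deg ℤ (Fin n)) 1)) ∧
      (∀ n k : ℕ, 2 ≤ k → k + 2 ≤ n → Subsingleton (H1wt ℤ (DerL.deg ℤ (Fin n)) k))) ∧
    -- symplectic derivations of the free associative algebra over `ℚ`
    (Subsingleton stableA ∧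
      (∀ g : ℕ, ∃ φ : sympZero g ≃ₗ⁅ℚ⁆ LieAlgebra.Symplectic.sp (Fin g) ℚ,
        (∀ D : sympZero g, (φ D : Matrix (Fin g ⊕ Fin g) (Fin g ⊕ Fin g) ℚ) = D.1.1.mat) ∧
        ∃ e : H1 ℚ (symp g) ≃ₗ[ℚ]
            H1coinv ℚ (sympPlus g) (sympZero g) × H1 ℚ (LieAlgebra.Symplectic.sp (Fin g) ℚ),
          (∀ D : sympPlus g, e (H1.mk ℚ (D : symp g)) =
            (Submodule.Quotient.mk (H1.mk ℚ D), 0)) ∧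
          (∀ D : sympZero g, e (H1.mk ℚ (D : symp g)) = (0, H1.mk ℚ (φ D))))) := by
  refine ⟨⟨?_, fun n hn => ?_, fun n hn => ?_, fun n k hk hn => ?_⟩,
    ⟨?_, fun n hn => ?_, fun n hn => ?_, fun n k hk hn => ?_⟩, subsingleton_stableA, fun g => ?_⟩
  · exact DerT.exists_stable_equiv ℤ
  · have : Nonempty (Fin n) := ⟨⟨0, by omega⟩⟩
    exact DerT.exists_H1wt_equiv ℤ (Fin n)
  · exact subsingleton_H1wt DerT.deg_one_le_gradedBracketSpan
  · exact subsingleton_H1wt (DerT.deg_le_gradedBracketSpan hk (by simpa using hn))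
  · exact DerL.exists_stable_equiv ℤ
  · have : Nonempty (Fin n) := ⟨⟨0, by omega⟩⟩
    exact DerL.exists_H1wt_equiv ℤ (Fin n)
  · exact subsingleton_H1wt DerL.deg_one_le_gradedBracketSpan
  · exact subsingleton_H1wt (DerL.deg_le_gradedBracketSpan (by omega) (by simpa using hn))
  · let φ := LieEquiv.ofBijective (sympZeroToSp g) (sympZeroToSp_bijective g)
    exact ⟨φ, fun D => rfl, exists_H1_equiv_of_isCompl (isCompl_sympZero_sympPlus g) φ⟩
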